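/- Work in $\mathbb R^3$. For a closed embedded curve $\gamma$ of length $L$, parametrised by arc length, call $\gamma$ \emph{$1$-constrained} if it is $C^1$, piecewise $C^2$, and has curvature at most $1$ wherever $\gamma''$ exists. Let $\tau(\gamma)=\min\{R_1,\tfrac12R_2\}$, where $R_1$ is the reciprocal of the maximal curvature and $R_2$ is the least distance between two distinct points of $\gamma$ whose connecting chord is orthogonal to $\gamma$ at both points. A \emph{thin link} of thickness $1$ is a pair $(\gamma,\beta)$ of $1$-constrained closed curves with $\tau(\gamma),\tau(\beta)\ge\tfrac12$ whose open tubes of radius $\tfrac12$ are disjoint. A \emph{thin isotopy} is a family $(\gamma_t,\beta_t)_{t\in[0,1]}$ of thin links of thickness $1$, continuous in the $C^1$ metric, along which the length of each component is constant. A thin link is \emph{separable} if for every $R>0$ there is a thin isotopy from it to a thin link whose two components have disjoint $R$-neighbourhoods. It is an \emph{unlink} if some ambient isotopy of $\mathbb R^3$ carries it to two round circles lying side by side in a plane, and a \emph{gordian unlink} if it is an unlink that is not separable. Call $(\gamma,\beta)$ a \emph{stadium pair} if: \begin{itemize} \item $\gamma$ meets the $xy$-plane in exactly two points $a,b$, with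 $|a-b|=1$, and crosses the plane orthogonally at both; \item the portion of $\gamma$ above the plane is a long arc: some point of it lies vertically above the unit sphere through $a$ and $b$ whose centre lies below the plane on the vertical line through the midpoint of $a$ and $b$; and symmetrically the portion below the plane is a long arc; \item $\beta$ is the stadium curve of length $2\pi+2$ consisting of all points of the $xy$-plane at distance $1$ from the segment $[a,b]$. \end{itemize} \textbf{Theorem.} (1) No thin link of thickness $1$ that is a stadium pair is separable. (2) There is $L_0$ such that for every $L\ge L_0$ there is a stadium pair $(\gamma,\beta)$ which is a gordian unlink of thickness $1$ with $\operatorname{length}(\gamma)=L$. In particular (since a thin isotopy preserves lengths) there are infinitely many gordian unlinks, no two of which are related by a thin isotopy. -/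

import Mathlib

open scoped ENNReal

namespace GordianLinks

/-- Euclidean 3-space, with coordinates `p 0`, `p 1`, `p 2`; the `xy`-plane is `p 2 = 0`. -/
abbrev E3 : Type := EuclideanSpace ℝ (Fin 3)

/-- The upward unit normal of the `xy`-plane. -/
noncomputable def ez : E3 := EuclideanSpace.single 2 1

/-- A `κ`-constrained loop of length `L`: an embedded closed curve, parametrised by arc length as an
`L`-periodic map, that is `C¹` and piecewise `C²` and whose curvature is at most `κ` wherever the
second derivative exists. -/
structure IsConstrainedLoop (κ L : ℝ) (γ : ℝ → E3) : Prop where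
  length_pos : 0 < L
  periodic : Function.Periodic γ L
  injOn : Set.InjOn γ (Set.Ico 0 L)
  contDiff : ContDiff ℝ 1 γ
  unit_speed : ∀ s, ‖deriv γ s‖ = 1
  piecewise : ∃ (n : ℕ) (a : Fin (n + 1) → ℝ), StrictMono a ∧ a 0 = 0 ∧ a (Fin.last n) = L ∧
    ∀ i : Fin n, ContDiffOn ℝ 2 γ (Set.Icc (a i.castSucc) (a i.succ))
  curvature_le : ∀ s, DifferentiableAt ℝ (deriv γ) s → ‖deriv (deriv γ) s‖ ≤ κ

/-- `R₁`: the reciprocal of the maximal curvature (`deriv` is `0` at the finitely many points of a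
period where the curvature is not defined, so these do not affect the supremum). -/
noncomputable def curvatureRadius (γ : ℝ → E3) : ℝ≥0∞ :=
  (⨆ s : ℝ, ‖deriv (deriv γ) s‖ₑ)⁻¹

/-- Two distinct points of the curve are doubly critical if the chord joining them is orthogonal to
the curve at both of them. -/
def DoublyCritical (γ : ℝ → E3) (u v : ℝ) : Prop :=
  γ u ≠ γ v ∧ inner ℝ (γ u - γ v) (deriv γ u) = 0 ∧ inner ℝ (γ u - γ v) (deriv γ v) = 0

/-- `R₂`: the least distance between doubly critical points. -/
noncomputable def criticalDistance (γ : ℝ → E3) : ℝ≥0∞ :=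
  ⨅ (u : ℝ) (v : ℝ) (_ : DoublyCritical γ u v), edist (γ u) (γ v)

/-- The radius of thickness `τ(γ) = min {R₁, R₂ / 2}`. -/
noncomputable def thicknessRadius (γ : ℝ → E3) : ℝ≥0∞ :=
  min (curvatureRadius γ) (criticalDistance γ / 2)

/-- `γ` is the core of a thin knot of thickness `δ` (the diameter of the tube, `1 ≤ δ < 2`) and
length `L`: it is `1`-constrained, and it carries an embedded tube of radius `δ / 2`, that is,
`τ(γ) ≥ δ / 2`. -/
structure IsThinCore (δ L : ℝ) (γ : ℝ → E3) : Prop where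
  thickness_mem : δ ∈ Set.Ico (1 : ℝ) 2
  constrained : IsConstrainedLoop 1 L γ
  thick : ENNReal.ofReal (δ / 2) ≤ thicknessRadius γ

/-- The open tube of thickness `δ` around the core `γ`. -/
def tube (δ : ℝ) (γ : ℝ → E3) : Set E3 :=
  Metric.thickening (δ / 2) (Set.range γ)

/-- A two-component thin link of thickness `δ`: two thin knots, of lengths `L₁` and `L₂`, whose
tubes are disjoint. -/
structure IsThinLink (δ L₁ L₂ : ℝ) (γ β : ℝ → E3) : Prop where
  core₁ : IsThinCore δ L₁ γ
  core₂ : IsThinCore δ L₂ β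
  disjoint_tubes : Disjoint (tube δ γ) (tube δ β)

/-- A `1`-constrained isotopy of two-component links that preserves the lengths `L₁`, `L₂` and the
thickness `δ`: a family of thin links, continuous in the `C¹` sense. -/
structure IsThinIsotopy (δ L₁ L₂ : ℝ) (G B : unitInterval → ℝ → E3) : Prop where
  continuous₁ : Continuous fun p : unitInterval × ℝ => G p.1 p.2
  continuous_deriv₁ : Continuous fun p : unitInterval × ℝ => deriv (G p.1) p.2
  continuous₂ : Continuous fun p : unitInterval × ℝ => B p.1 p.2
  continuous_deriv₂ : Continuous fun p : unitInterval × ℝ => deriv (B p.1) p.2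
  isThinLink : ∀ t, IsThinLink δ L₁ L₂ (G t) (B t)

/-- The link can be carried by such isotopies to positions in which its two components have
arbitrarily large disjoint neighbourhoods. -/
def IsSeparable (δ L₁ L₂ : ℝ) (γ β : ℝ → E3) : Prop :=
  ∀ R : ℝ, 0 < R → ∃ G B : unitInterval → ℝ → E3,
    IsThinIsotopy δ L₁ L₂ G B ∧ G 0 = γ ∧ B 0 = β ∧
      Disjoint (Metric.thickening R (Set.range (G 1))) (Metric.thickening R (Set.range (B 1)))

/-- The round unit circle with centre `c` in the horizontal plane through `c`. -/
def roundCircle (c : E3) : Set E3 :=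
  {p | p 2 = c 2 ∧ dist p c = 1}

/-- The link with components `γ` and `β` is topologically trivial: an ambient isotopy of `ℝ³`
carries it onto two round circles lying side by side in a plane (at distance `3` between centres).
In particular both components are unknots. -/
def IsUnlink (γ β : ℝ → E3) : Prop :=
  ∃ H : unitInterval → (E3 ≃ₜ E3),
    (Continuous fun p : unitInterval × E3 => H p.1 p.2) ∧ H 0 = Homeomorph.refl E3 ∧
      H 1 '' Set.range γ = roundCircle 0 ∧
      H 1 '' Set.range β = roundCircle (EuclideanSpace.single 0 3)

/-- A gordian unlink of thickness `δ` with components of lengths `L₁` and `L₂`. -/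
structure IsGordianUnlink (δ L₁ L₂ : ℝ) (γ β : ℝ → E3) : Prop where
  isThinLink : IsThinLink δ L₁ L₂ γ β
  isUnlink : IsUnlink γ β
  not_separable : ¬ IsSeparable δ L₁ L₂ γ β

/-- The stadium curve around two points `a`, `b` of the `xy`-plane: the points of the plane at
distance `1` from the segment `[a, b]`, i.e. two unit half-circles centred at `a` and `b`, and two
line segments parallel to `[a, b]`. For `dist a b = 1` its length is `2π + 2`. -/
def stadium (a b : E3) : Set E3 :=
  {p | p 2 = 0 ∧ Metric.infDist p (segment ℝ a b) = 1}

/-- The arc `γ|[u, v]` is a long arc above (`σ = 1`) or below (`σ = -1`) the `xy`-plane. Its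
endpoints lie on a unit sphere `S` whose centre `c` is on the vertical axis through the midpoint of
the endpoints, on the other side of the plane, and some point of the arc lies vertically above `S`
(respectively below `S`). -/
def IsLongArc (σ : ℝ) (γ : ℝ → E3) (u v : ℝ) : Prop :=
  ∃ c : E3, c 0 = midpoint ℝ (γ u) (γ v) 0 ∧ c 1 = midpoint ℝ (γ u) (γ v) 1 ∧ σ * c 2 < 0 ∧
    dist (γ u) c = 1 ∧ dist (γ v) c = 1 ∧
    ∃ s ∈ Set.Icc u v,
      (∃ q : E3, dist q c = 1 ∧ q 0 = γ s 0 ∧ q 1 = γ s 1) ∧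
      ∀ q : E3, dist q c = 1 → q 0 = γ s 0 → q 1 = γ s 1 → σ * q 2 < σ * γ s 2

/-- The closed curve `γ` of length `L` meets the `xy`-plane in exactly two points, `γ t₁` and
`γ t₂`, which are at distance `1`; it crosses the plane orthogonally there (upwards at `t₁`,
downwards at `t₂`); the portions of `γ` above and below the plane are long arcs; and `β` traces the
stadium curve around the two crossing points. -/
structure IsStadiumPair (L : ℝ) (γ β : ℝ → E3) (t₁ t₂ : ℝ) : Prop where
  lt : t₁ < t₂
  lt_add : t₂ < t₁ + L
  height₁ : γ t₁ 2 = 0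
  height₂ : γ t₂ 2 = 0
  dist_eq : dist (γ t₁) (γ t₂) = 1
  orthogonal₁ : deriv γ t₁ = ez
  orthogonal₂ : deriv γ t₂ = -ez
  above : ∀ s ∈ Set.Ioo t₁ t₂, 0 < γ s 2
  below : ∀ s ∈ Set.Ioo t₂ (t₁ + L), γ s 2 < 0
  long_above : IsLongArc 1 γ t₁ t₂
  long_below : IsLongArc (-1) γ t₂ (t₁ + L)
  range_eq : Set.range β = stadium (γ t₁) (γ t₂)

end GordianLinks

/-! Statement (1) rests on a sharp length bound. Let p lie in the convex hull of β, let q lie on the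
segment from p to some point of β, let |p - q| ≥ 1, and let β stay outside the open unit balls about
p and q. Then β has length at least 2π + 2, with equality only for the stadium curve around p and q;
`stadium_rigidity` is the equality case. Seen from p, β projects to a closed spherical curve
contained in no open hemisphere, so this projection has length at least 2π
(`IsSphericalLoop.two_pi_le`). Develop the cone over β with apex p into the plane. Lengths and
distances to p are preserved, and distances to q do not decrease over the first and the last
half-turn. Each of these half-turns starts on the ray from p beyond q, so it has to go round the
unit disc about q, pass across, and go round the unit disc about p: π/2 + |p - q| + π/2
(`IsPolarArc.half_turn`). Equality makes the developed halves stadium arcs and the projection a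
great circle (`IsSphericalLoop.inner_eq_cos`), so β is planar.

Along a thin isotopy the length of β stays 2π + 2. The times at which β is a stadium around two
points of γ (`StadiumPosition`) form a closed set, by compactness. The set is also open. In stadium
position the points of γ realise the least distance 1 to β, so γ is orthogonal to the plane of β at
both points. By transversality, at nearby times a point of γ still lies in the convex hull of β
(`eventually_exists_crossing_hull`) and another strand of γ still crosses the cone from that point
over β (`eventually_exists_crossing_cone`). The curvature bound and the thickness keep the two
points of γ at distance at least 1, so rigidity puts β back into stadium position. As [0, 1] is
connected, stadium position persists, and the components never get farther apart than 1.

For (2), γ is an explicit dumbbell in the xz-plane: two parallel strands at distance 1, of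
adjustable length, closed up at either end by a round head of radius 3/2 attached by unit arcs. It
is described by its normal angle and central symmetry. A doubly critical chord of a plane curve is
parallel to the normals at both ends, so thickness reduces to a finite comparison of arcs. An
explicit chain of coordinatewise scalings, shears and translations turns the pair into two circles
side by side, so it is an unlink, and (1) shows that it is gordian. -/

namespace GordianLinks

open Set Filter Topology InnerProductGeometry

/-! ### Angles swept by curves of vectors -/

section Angles

variable {E : Type*} [NormedAddCommGroup E] [InnerProductSpace ℝ E]

/-- The angle swept by a curve of unit vectors is at most the length of the curve. -/
theorem angle_le_of_norm_sub_le {u : ℝ → E} {B k : ℝ → ℝ} {a b : ℝ} (hab : a ≤ b)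
    (hu : ∀ s ∈ Icc a b, ‖u s‖ = 1) (hc : ContinuousOn u (Icc a b))
    (hB : ∀ s, HasDerivAt B (k s) s) (hk : ∀ s, 0 ≤ k s)
    (h : ∀ s ∈ Ico a b, ∀ r, k s < r → ∀ᶠ z in 𝓝[>] s, ‖u z - u s‖ ≤ r * (z - s)) :
    angle (u a) (u b) ≤ B b - B a := by
  have hne : ∀ s ∈ Icc a b, u s ≠ 0 := fun s hs h0 => by simpa [h0] using hu s hs
  have hcont : ∀ s ∈ Icc a b, ContinuousOn (fun z => angle (u s) (u z)) (Icc a b) :=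
    fun s hs z hz => ContinuousAt.comp_continuousWithinAt (f := fun z => (u s, u z))
      (continuousAt_angle (x := (u s, u z)) (hne s hs) (hne z hz))
      (continuousWithinAt_const.prodMk (hc z hz))
  -- `u` need not be differentiable, so the angle is bounded through its right-hand difference
  -- quotients only.
  have key := image_le_of_liminf_slope_right_le_deriv_boundary
    (f := fun z => angle (u a) (u z)) (a := a) (b := b) (B := fun z => B z - B a) (B' := k)
    (hcont a (left_mem_Icc.2 hab)) (by simp [angle_self (hne a (left_mem_Icc.2 hab))])
    (fun z _ => ((hB z).continuousAt.sub continuousAt_const).continuousWithinAt)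
    (fun z _ => ((hB z).sub_const _).hasDerivWithinAt) ?_
  · exact key (right_mem_Icc.2 hab)
  intro s hs r hr
  have hs' : s ∈ Icc a b := Ico_subset_Icc_self hs
  apply Eventually.frequently
  obtain ⟨r', hr1, hr2⟩ := exists_between hr
  have hr0 : 0 < r := (hk s).trans_lt hr
  have hmem : Icc a b ∈ 𝓝[>] s :=
    mem_of_superset (Ioo_mem_nhdsGT hs.2) fun z hz => ⟨hs.1.trans hz.1.le, hz.2.le⟩
  -- A chord of the unit sphere is 2 sin (θ/2) > θ - θ³/24, since sin x > x - x³/6. The correction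
  -- factor tends to 1, so it fits between r' and r.
  have htend : Tendsto (fun z => (1 - angle (u s) (u z) ^ 2 / 24) * r) (𝓝[>] s) (𝓝 r) := by
    have h1 : Tendsto (fun z => angle (u s) (u z)) (𝓝[>] s) (𝓝 0) := by
      simpa [angle_self (hne s hs')] using
        (hcont s hs' s hs').tendsto.mono_left (nhdsWithin_le_iff.2 hmem)
    simpa using (((h1.pow 2).div_const 24).const_sub 1).mul_const r
  filter_upwards [h s hs r' hr1, htend.eventually_const_lt hr2, self_mem_nhdsWithin, hmem]
    with z hz1 hz2 hz3 hz4
  have hz3 : 0 < z - s := sub_pos.2 hz3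
  have htri := angle_le_angle_add_angle (u a) (u s) (u z)
  rw [slope_def_field, div_lt_iff₀ hz3]
  refine lt_of_le_of_lt (by linarith : _ ≤ angle (u s) (u z)) ?_
  set θ := angle (u s) (u z) with hθ
  have hθ0 : 0 ≤ θ := angle_nonneg _ _
  rcases hθ0.eq_or_lt with h0 | h0
  · rw [← h0]; positivity
  have hθπ : θ ≤ Real.pi := angle_le_pi _ _
  have hnorm : ‖u z - u s‖ = 2 * Real.sin (θ / 2) := by
    have h1 := norm_sub_sq_eq_norm_sq_add_norm_sq_sub_two_mul_norm_mul_norm_mul_cos_angle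
      (u s) (u z)
    rw [hu s hs', hu z hz4, ← hθ, norm_sub_rev] at h1
    have h2 := Real.cos_sq' (θ / 2)
    have h3 := Real.cos_two_mul (θ / 2)
    rw [mul_div_cancel₀ θ two_ne_zero] at h3
    have hs : 0 ≤ Real.sin (θ / 2) := Real.sin_nonneg_of_nonneg_of_le_pi (by linarith)
      (by linarith)
    refine (sq_eq_sq₀ (norm_nonneg _) (by positivity)).1 ?_
    nlinarith
  have hsin := Real.sin_gt_sub_cube (x := θ / 2) (by linarith)
  rw [hnorm] at hz1
  have h4 : θ * (1 - θ ^ 2 / 24) < r' * (z - s) := by nlinarith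
  have h5 : r' * (z - s) < (1 - θ ^ 2 / 24) * r * (z - s) := mul_lt_mul_of_pos_right hz2 hz3
  have h6 : 0 < 1 - θ ^ 2 / 24 := by
    nlinarith [(hk s).trans_lt hr1]
  have h7 : (1 - θ ^ 2 / 24) * θ < (1 - θ ^ 2 / 24) * (r * (z - s)) := by linarith
  exact lt_of_mul_lt_mul_left h7 h6.le

/-- The angle swept by a differentiable curve of unit vectors is at most its length. -/
theorem angle_le_of_norm_deriv_le {u u' : ℝ → E} {B k : ℝ → ℝ} {a b : ℝ} (hab : a ≤ b)
    (hu : ∀ s ∈ Icc a b, ‖u s‖ = 1) (hd : ∀ s ∈ Icc a b, HasDerivAt u (u' s) s)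
    (hB : ∀ s, HasDerivAt B (k s) s) (hk0 : ∀ s, 0 ≤ k s) (hk : ∀ s ∈ Icc a b, ‖u' s‖ ≤ k s) :
    angle (u a) (u b) ≤ B b - B a := by
  refine angle_le_of_norm_sub_le hab hu
    (fun s hs => (hd s hs).continuousAt.continuousWithinAt) hB hk0 fun s hs r hr => ?_
  have hs' := Ico_subset_Icc_self hs
  obtain ⟨r', hr1, hr2⟩ := exists_between ((hk s hs').trans_lt hr)
  have h1 := (hd s hs').isLittleO.def (c := r - r') (by linarith)
  filter_upwards [nhdsWithin_le_nhds h1, self_mem_nhdsWithin] with z hz hz3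
  have hz3 : 0 < z - s := sub_pos.2 hz3
  have h2 : ‖u z - u s‖ ≤ ‖u z - u s - (z - s) • u' s‖ + ‖(z - s) • u' s‖ := by
    simpa using norm_add_le (u z - u s - (z - s) • u' s) ((z - s) • u' s)
  rw [norm_smul, Real.norm_of_nonneg hz3.le] at h2
  rw [Real.norm_of_nonneg hz3.le] at hz
  nlinarith

/-- The derivative of the radial projection of a curve to the unit sphere. -/
theorem hasDerivAt_normalize {w : ℝ → E} {w' : E} {s : ℝ} (hd : HasDerivAt w w' s)
    (h0 : w s ≠ 0) :
    HasDerivAt (fun z => ‖w z‖⁻¹ • w z)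
      (‖w s‖⁻¹ • w' - (inner ℝ (w s) w' / ‖w s‖ ^ 3) • w s) s := by
  have hn : HasDerivAt (fun z => ‖w z‖) (inner ℝ (w s) w' / ‖w s‖) s := by
    have h1 := (hd.norm_sq).sqrt (by positivity)
    simp only [Real.sqrt_sq (norm_nonneg _)] at h1
    convert h1 using 1
    field_simp
  have hnz : ‖w s‖ ≠ 0 := norm_ne_zero_iff.2 h0
  refine ((hn.inv hnz).smul hd).congr_deriv ?_
  rw [sub_eq_add_neg, ← neg_smul]
  congr 2
  field_simp

/-- The squared speed of the radial projection of a curve. -/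
theorem norm_normalize_deriv_sq {x v : E} (hx : x ≠ 0) :
    ‖‖x‖⁻¹ • v - (inner ℝ x v / ‖x‖ ^ 3) • x‖ ^ 2 =
      (‖v‖ ^ 2 - (inner ℝ x v / ‖x‖) ^ 2) / ‖x‖ ^ 2 := by
  have hnz : ‖x‖ ≠ 0 := norm_ne_zero_iff.2 hx
  rw [norm_sub_sq_real, norm_smul, norm_smul, inner_smul_left, inner_smul_right,
    real_inner_comm]
  simp only [norm_inv, mul_pow, map_inv₀, conj_trivial, norm_div, norm_pow,
    Real.norm_eq_abs, div_pow, sq_abs, abs_norm]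
  field_simp
  ring

/-- The angle swept by a curve seen from the origin. -/
theorem angle_le_of_norm_deriv_div_le {w w' : ℝ → E} {B k : ℝ → ℝ} {a b : ℝ} (hab : a ≤ b)
    (h0 : ∀ s ∈ Icc a b, w s ≠ 0) (hd : ∀ s ∈ Icc a b, HasDerivAt w (w' s) s)
    (hB : ∀ s, HasDerivAt B (k s) s) (hk0 : ∀ s, 0 ≤ k s)
    (hk : ∀ s ∈ Icc a b, ‖w' s‖ / ‖w s‖ ≤ k s) :
    angle (w a) (w b) ≤ B b - B a := by
  have hpos : ∀ s ∈ Icc a b, 0 < ‖w s‖ := fun s hs => norm_pos_iff.2 (h0 s hs)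
  have key := angle_le_of_norm_deriv_le (u := fun z => ‖w z‖⁻¹ • w z) hab (fun s hs => by
    rw [norm_smul, norm_inv, norm_norm, inv_mul_cancel₀ (hpos s hs).ne'])
    (fun s hs => hasDerivAt_normalize (hd s hs) (h0 s hs)) hB hk0 (fun s hs => by
      refine le_trans ((sq_le_sq₀ (norm_nonneg _)
        (div_nonneg (norm_nonneg _) (norm_nonneg _))).1 ?_) (hk s hs)
      rw [norm_normalize_deriv_sq (h0 s hs), div_pow ‖w' s‖]
      exact div_le_div_of_nonneg_right (sub_le_self _ (sq_nonneg _)) (by positivity))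
  simpa only [angle_smul_left_of_pos _ _ (inv_pos.2 (hpos a (left_mem_Icc.2 hab))),
    angle_smul_right_of_pos _ _ (inv_pos.2 (hpos b (right_mem_Icc.2 hab)))] using key

/-- The inner product of unit vectors bounded below through an upper bound for their angle. -/
theorem cos_le_inner_of_angle_le {x y : E} {θ : ℝ} (hx : ‖x‖ = 1) (hy : ‖y‖ = 1)
    (h : angle x y ≤ θ) (hθ : θ ≤ Real.pi) : Real.cos θ ≤ inner ℝ x y := by
  have h1 := cos_angle x y
  rw [hx, hy, one_mul, div_one] at h1
  rw [← h1]
  exact Real.cos_le_cos_of_nonneg_of_le_pi (angle_nonneg _ _) hθ h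

end Angles

/-! ### Consequences of the curvature bound and of thickness -/

section ThinLoops

variable {L : ℝ} {γ : ℝ → E3}

theorem IsConstrainedLoop.periodic_deriv {κ : ℝ} (h : IsConstrainedLoop κ L γ) :
    Function.Periodic (deriv γ) L := fun s => by
  have h1 : (fun x => γ (x + L)) = γ := funext h.periodic
  rw [← deriv_comp_add_const, h1]

theorem IsConstrainedLoop.continuous_deriv {κ : ℝ} (h : IsConstrainedLoop κ L γ) :
    Continuous (deriv γ) := h.contDiff.continuous_deriv le_rfl

theorem IsConstrainedLoop.hasDerivAt {κ : ℝ} (h : IsConstrainedLoop κ L γ) (s : ℝ) :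
    HasDerivAt γ (deriv γ s) s := (h.contDiff.differentiable one_ne_zero s).hasDerivAt

theorem exists_mem_Ico_of_strictMono {n : ℕ} {a : Fin (n + 1) → ℝ} {s : ℝ} (h0 : a 0 ≤ s)
    (h1 : s < a (Fin.last n)) : ∃ i : Fin n, s ∈ Ico (a i.castSucc) (a i.succ) := by
  have : ∀ j : Fin (n + 1), s < a j → ∃ i : Fin n, s ∈ Ico (a i.castSucc) (a i.succ) := by
    intro j
    induction j using Fin.induction with
    | zero => exact fun h => absurd h0 h.not_ge
    | succ i ih =>
      intro h
      rcases lt_or_ge s (a i.castSucc) with h2 | h2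
      · exact ih h2
      · exact ⟨i, h2, h⟩
  exact this _ h1

/-- Only the right-hand side of `s` matters, and there the curve stays in one `C²` piece even if `s`
is a breakpoint. The tangent is 1-Lipschitz in the open piece, and continuity extends this to the
endpoints. -/
theorem IsConstrainedLoop.eventually_norm_deriv_sub_le (h : IsConstrainedLoop 1 L γ) (s : ℝ) :
    ∀ᶠ z in 𝓝[>] s, ‖deriv γ z - deriv γ s‖ ≤ z - s := by
  have base : ∀ s ∈ Ico 0 L, ∀ᶠ z in 𝓝[>] s, ‖deriv γ z - deriv γ s‖ ≤ z - s := by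
    intro s hs
    obtain ⟨n, a, -, ha0, ha1, hC⟩ := h.piecewise
    obtain ⟨i, hi⟩ := exists_mem_Ico_of_strictMono (ha0.trans_le hs.1) (hs.2.trans_eq ha1.symm)
    have hlt := hi.1.trans_lt hi.2
    have hdiff : ∀ x ∈ Ioo (a i.castSucc) (a i.succ), DifferentiableAt ℝ (deriv γ) x := by
      intro x hx
      have h1 : ContDiffOn ℝ 2 γ (Ioo (a i.castSucc) (a i.succ)) :=
        (hC i).mono Ioo_subset_Icc_self
      exact (((contDiffOn_succ_iff_deriv_of_isOpen (n := 1) isOpen_Ioo).1 h1).2.2.differentiableOn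
        one_ne_zero).differentiableAt (Ioo_mem_nhds hx.1 hx.2)
    have hL : LipschitzOnWith 1 (deriv γ) (Ioo (a i.castSucc) (a i.succ)) :=
      (convex_Ioo _ _).lipschitzOnWith_of_nnnorm_deriv_le hdiff
        fun x hx => by simpa [← NNReal.coe_le_coe] using h.curvature_le x (hdiff x hx)
    have hL' := hL.closure h.continuous_deriv.continuousOn
    rw [closure_Ioo hlt.ne] at hL'
    filter_upwards [Ioo_mem_nhdsGT hi.2] with z hz
    have := hL'.dist_le_mul z ⟨hi.1.trans hz.1.le, hz.2.le⟩ s ⟨hi.1, hi.2.le⟩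
    rwa [dist_eq_norm, dist_eq_norm, NNReal.coe_one, one_mul,
      Real.norm_of_nonneg (sub_pos.2 hz.1).le] at this
  have hper := h.periodic_deriv
  have h1 := base (toIcoMod h.length_pos 0 s) (by simpa using toIcoMod_mem_Ico h.length_pos 0 s)
  set k := toIcoDiv h.length_pos 0 s
  have hk : toIcoMod h.length_pos 0 s = s - k • L := rfl
  rw [hk] at h1
  have hmap : Tendsto (fun z => z - k • L) (𝓝[>] s) (𝓝[>] (s - k • L)) := by
    refine tendsto_nhdsWithin_iff.2 ⟨?_, ?_⟩
    · exact ((continuous_id.sub continuous_const).tendsto s).mono_left nhdsWithin_le_nhds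
    · filter_upwards [self_mem_nhdsWithin] with z hz
      exact sub_lt_sub_right (mem_Ioi.1 hz) _
  filter_upwards [hmap.eventually h1] with z hz
  rw [hper.sub_zsmul_eq, hper.sub_zsmul_eq] at hz
  linarith

/-- The tangent of a curve of curvature at most `1` turns with speed at most `1`. -/
theorem IsConstrainedLoop.cos_le_inner_deriv (h : IsConstrainedLoop 1 L γ) {s t : ℝ}
    (hst : |t - s| ≤ Real.pi) : Real.cos (t - s) ≤ inner ℝ (deriv γ t) (deriv γ s) := by
  wlog hle : s ≤ t generalizing s t
  · rw [real_inner_comm, ← Real.cos_neg, neg_sub]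
    exact this (by rwa [abs_sub_comm]) (not_le.1 hle).le
  rw [real_inner_comm]
  refine cos_le_inner_of_angle_le (h.unit_speed s) (h.unit_speed t) ?_ (le_of_abs_le hst)
  refine angle_le_of_norm_sub_le (B := id) (k := fun _ => 1) hle
    (fun s _ => h.unit_speed s) h.continuous_deriv.continuousOn (fun s => hasDerivAt_id s)
    (fun _ => zero_le_one) fun s _ r hr => ?_
  filter_upwards [h.eventually_norm_deriv_sub_le s, self_mem_nhdsWithin] with z hz hz'
  have : 0 < z - s := sub_pos.2 hz'
  nlinarith

/-- A comparison of a curve of curvature at most `1` with an arc of the unit circle. -/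
theorem IsConstrainedLoop.sin_sub_sin_le_inner (h : IsConstrainedLoop 1 L γ) {m u v : ℝ}
    (hu : m - Real.pi ≤ u) (huv : u ≤ v) (hv : v ≤ m + Real.pi) :
    Real.sin (v - m) - Real.sin (u - m) ≤ inner ℝ (γ v - γ u) (deriv γ m) := by
  have hd : ∀ x, HasDerivAt (fun x => inner ℝ (γ x) (deriv γ m) - Real.sin (x - m))
      (inner ℝ (deriv γ x) (deriv γ m) - Real.cos (x - m)) x := by
    intro x
    have h1 := (h.hasDerivAt x).inner ℝ (hasDerivAt_const x (deriv γ m))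
    have h2 := ((hasDerivAt_id x).sub_const m).sin
    simp only [inner_zero_right, zero_add, mul_one] at h1 h2
    exact h1.sub h2
  have hmono := monotoneOn_of_deriv_nonneg (convex_Icc (m - Real.pi) (m + Real.pi))
    (f := fun x => inner ℝ (γ x) (deriv γ m) - Real.sin (x - m))
    (fun x _ => (hd x).continuousAt.continuousWithinAt)
    (fun x _ => (hd x).differentiableAt.differentiableWithinAt)
    (fun x hx => by
      rw [interior_Icc] at hx
      rw [(hd x).deriv, sub_nonneg]
      exact h.cos_le_inner_deriv (abs_le.2 ⟨by linarith [hx.1], by linarith [hx.2]⟩))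
  have := hmono ⟨hu, huv.trans hv⟩ ⟨hu.trans huv, hv⟩ huv
  simp only [inner_sub_left] at this ⊢
  linarith

/-- A chord orthogonal to the curve at its initial point spans an arc of length at least `π`. -/
theorem IsConstrainedLoop.pi_le_of_inner_eq_zero (h : IsConstrainedLoop 1 L γ) {u v : ℝ}
    (huv : u < v) (ho : inner ℝ (γ v - γ u) (deriv γ u) = 0) : Real.pi ≤ v - u := by
  by_contra! hlt
  have h1 := h.sin_sub_sin_le_inner (m := u) (u := u) (v := v) (by linarith [Real.pi_pos])
    huv.le (by linarith)
  rw [ho, sub_self, Real.sin_zero, sub_zero] at h1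
  exact absurd (Real.sin_pos_of_pos_of_lt_pi (sub_pos.2 huv) hlt) h1.not_gt

/-- The same comparison run backwards from the parameter `u + L`, which names the same point of the
curve. -/
theorem IsConstrainedLoop.add_pi_le_of_inner_eq_zero (h : IsConstrainedLoop 1 L γ) {u v : ℝ}
    (huv : v < u + L) (ho : inner ℝ (γ v - γ u) (deriv γ u) = 0) : v + Real.pi ≤ u + L := by
  by_contra! hlt
  have h1 := h.sin_sub_sin_le_inner (m := u + L) (u := v) (v := u + L) (by linarith)
    huv.le (by linarith [Real.pi_pos])
  rw [h.periodic, h.periodic_deriv, ← neg_sub (γ v), inner_neg_left, ho, neg_zero, sub_self,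
    Real.sin_zero, zero_sub, ← Real.sin_neg] at h1
  exact absurd (Real.sin_pos_of_pos_of_lt_pi (by linarith) (by linarith)) h1.not_gt

/-- Projected to the tangent at the middle of the arc, the chord has length at least 2 sin (π/6) =
1. -/
theorem IsConstrainedLoop.one_le_dist_of_sub_eq (h : IsConstrainedLoop 1 L γ) {u v : ℝ}
    (huv : v - u = Real.pi / 3) : 1 ≤ dist (γ u) (γ v) := by
  have hp := Real.pi_pos
  have h1 := h.sin_sub_sin_le_inner (m := (u + v) / 2) (u := u) (v := v) (by linarith)
    (by linarith) (by linarith)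
  rw [show v - (u + v) / 2 = Real.pi / 6 by linarith,
    show u - (u + v) / 2 = -(Real.pi / 6) by linarith, Real.sin_neg, Real.sin_pi_div_six] at h1
  have h2 := real_inner_le_norm (γ v - γ u) (deriv γ ((u + v) / 2))
  rw [h.unit_speed, mul_one] at h2
  rw [dist_comm, dist_eq_norm]
  linarith

theorem IsThinCore.one_le_dist_of_doublyCritical (h : IsThinCore 1 L γ) {u v : ℝ}
    (huv : DoublyCritical γ u v) : 1 ≤ dist (γ u) (γ v) := by
  have h1 : criticalDistance γ ≤ edist (γ u) (γ v) := iInf_le_of_le u (iInf_le_of_le v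
    (iInf_le_of_le huv le_rfl))
  have h2 : ENNReal.ofReal (1 / 2) ≤ edist (γ u) (γ v) / 2 :=
    h.thick.trans ((min_le_right _ _).trans (by gcongr))
  have h3 : edist (γ u) (γ v) / 2 = ENNReal.ofReal (dist (γ u) (γ v) / 2) := by
    rw [edist_dist, ENNReal.ofReal_div_of_pos two_pos, ENNReal.ofReal_ofNat]
  rw [h3, ENNReal.ofReal_le_ofReal_iff (by positivity)] at h2
  linarith

theorem IsConstrainedLoop.ne_of_lt {κ : ℝ} (h : IsConstrainedLoop κ L γ) {u v : ℝ}
    (huv : u < v) (hv : v < u + L) : γ u ≠ γ v := by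
  intro heq
  have hL := h.length_pos
  have h1 : γ (toIcoMod hL 0 u) = γ (toIcoMod hL 0 v) := by
    rw [← self_sub_toIcoDiv_zsmul, ← self_sub_toIcoDiv_zsmul, h.periodic.sub_zsmul_eq,
      h.periodic.sub_zsmul_eq, heq]
  have h2 := h.injOn (by simpa using toIcoMod_mem_Ico hL 0 u)
    (by simpa using toIcoMod_mem_Ico hL 0 v) h1
  obtain ⟨n, hn⟩ := (toIcoMod_eq_toIcoMod hL).1 h2
  rw [zsmul_eq_mul] at hn
  have h3 : (0 : ℝ) < n := by
    by_contra! hc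
    nlinarith
  have h4 : (n : ℝ) < 1 := by
    by_contra! hc
    nlinarith
  norm_cast at h3 h4
  lia

/-- Points of a thin knot whose distance along the knot is at least `π / 3` have distance at
least `1`. -/
theorem IsThinCore.one_le_dist (h : IsThinCore 1 L γ) {u v : ℝ} (h1 : Real.pi / 3 ≤ v - u)
    (h2 : v - u ≤ L - Real.pi / 3) : 1 ≤ dist (γ u) (γ v) := by
  have hc := h.constrained
  have hL := hc.length_pos
  have hp := Real.pi_pos
  have hcont : Continuous γ := hc.contDiff.continuous
  -- Minimise the distance over all pairs whose separation `w` along the knot lies in the admissible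
  -- range; by periodicity the base point may be taken in one period.
  obtain ⟨⟨x, w⟩, hxw, hmin⟩ := (isCompact_Icc.prod isCompact_Icc :
    IsCompact (Icc (0 : ℝ) L ×ˢ Icc (Real.pi / 3) (L - Real.pi / 3))).exists_isMinOn
    ⟨(0, v - u), ⟨le_rfl, hL.le⟩, h1, h2⟩
    (f := fun q => dist (γ q.1) (γ (q.1 + q.2))) (by fun_prop)
  have hmin' : ∀ a b, Real.pi / 3 ≤ b - a → b - a ≤ L - Real.pi / 3 →
      dist (γ x) (γ (x + w)) ≤ dist (γ a) (γ b) := by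
    intro a b hab hab'
    have hm := toIcoMod_mem_Ico hL 0 a
    have := hmin (show (toIcoMod hL 0 a, b - a) ∈ _ from
      ⟨⟨hm.1, by simpa using hm.2.le⟩, hab, hab'⟩)
    simp only [mem_ofPred_eq, ← self_sub_toIcoDiv_zsmul] at this
    rwa [hc.periodic.sub_zsmul_eq, sub_add_eq_add_sub, hc.periodic.sub_zsmul_eq,
      add_sub_cancel] at this
  refine le_trans ?_ (hmin' u v h1 h2)
  obtain ⟨-, hw1, hw2⟩ := hxw
  simp only at hw1 hw2
  -- If the minimum is at an extreme separation, the arc has length π/3 one way round. Otherwise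
  -- both endpoints can vary freely, and the minimising chord is doubly critical.
  rcases hw1.eq_or_lt with hw1 | hw1
  · exact hc.one_le_dist_of_sub_eq (by linarith)
  rcases hw2.eq_or_lt with hw2 | hw2
  · rw [dist_comm, ← hc.periodic x]
    exact hc.one_le_dist_of_sub_eq (by linarith)
  have hne : γ x ≠ γ (x + w) := hc.ne_of_lt (by linarith) (by linarith)
  refine h.one_le_dist_of_doublyCritical ⟨hne, ?_, ?_⟩
  · have hmin1 : IsLocalMin (fun a => ‖γ a - γ (x + w)‖ ^ 2) x := by
      filter_upwards [Ioo_mem_nhds (show x - (L - Real.pi / 3 - w) < x by linarith)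
        (show x < x + (w - Real.pi / 3) by linarith)] with a ha
      have := hmin' a (x + w) (by linarith [ha.2]) (by linarith [ha.1])
      rw [dist_eq_norm, dist_eq_norm] at this
      gcongr
    have := hmin1.hasDerivAt_eq_zero ((hc.hasDerivAt x).sub_const _).norm_sq
    linarith
  · have hmin1 : IsLocalMin (fun b => ‖γ x - γ b‖ ^ 2) (x + w) := by
      filter_upwards [Ioo_mem_nhds (show x + Real.pi / 3 < x + w by linarith)
        (show x + w < x + (L - Real.pi / 3) by linarith)] with b hb
      have := hmin' x b (by linarith [hb.1]) (by linarith [hb.2])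
      rw [dist_eq_norm, dist_eq_norm] at this
      gcongr
    have := hmin1.hasDerivAt_eq_zero ((hc.hasDerivAt (x + w)).const_sub _).norm_sq
    rw [inner_neg_right] at this
    linarith

/-- Disjoint tubes: points of the two components have distance at least the thickness. -/
theorem IsThinLink.one_le_dist {L₂ : ℝ} {β : ℝ → E3} (h : IsThinLink 1 L L₂ γ β) (u s : ℝ) :
    1 ≤ dist (γ u) (β s) := by
  by_contra! hlt
  refine Set.disjoint_left.1 h.disjoint_tubes
    (show midpoint ℝ (γ u) (β s) ∈ tube 1 γ from ?_) ?_
  · refine Metric.mem_thickening_iff.2 ⟨_, mem_range_self u, ?_⟩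
    rw [dist_midpoint_left]
    norm_num
    linarith
  · refine Metric.mem_thickening_iff.2 ⟨_, mem_range_self s, ?_⟩
    rw [dist_midpoint_right]
    norm_num
    linarith

end ThinLoops

/-! ### Plane arcs around two unit discs -/

section HalfTurn

theorem sub_le_sub_of_deriv_le_one {f f' : ℝ → ℝ} {a b : ℝ} (hab : a ≤ b)
    (hd : ∀ s ∈ Icc a b, HasDerivAt f (f' s) s) (h1 : ∀ s ∈ Icc a b, f' s ≤ 1) :
    f b - f a ≤ b - a := by
  have hm : MonotoneOn (fun s => s - f s) (Icc a b) :=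
    monotoneOn_of_deriv_nonneg (convex_Icc a b)
      (fun s hs => (continuousAt_id.sub (hd s hs).continuousAt).continuousWithinAt)
      (fun s hs => ((hasDerivAt_id s).sub
        (hd s (interior_subset hs))).differentiableAt.differentiableWithinAt)
      (fun s hs => by
        have h2 : HasDerivAt (fun s => s - f s) (1 - f' s) s :=
          (hasDerivAt_id s).sub (hd s (interior_subset hs))
        rw [h2.deriv, sub_nonneg]
        exact h1 s (interior_subset hs))
  have := hm (left_mem_Icc.2 hab) (right_mem_Icc.2 hab) hab
  simp only at this
  linarith

/-- A function with derivative at most `1` and maximal increment is a translation. -/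
theorem eq_add_of_deriv_le_one {f f' : ℝ → ℝ} {a b : ℝ}
    (hd : ∀ s ∈ Icc a b, HasDerivAt f (f' s) s) (h1 : ∀ s ∈ Icc a b, f' s ≤ 1)
    (hb : b - a ≤ f b - f a) : ∀ s ∈ Icc a b, f s = f a + (s - a) := by
  intro s hs
  have e1 := sub_le_sub_of_deriv_le_one hs.1 (fun x hx => hd x ⟨hx.1, hx.2.trans hs.2⟩)
    (fun x hx => h1 x ⟨hx.1, hx.2.trans hs.2⟩)
  have e2 := sub_le_sub_of_deriv_le_one hs.2 (fun x hx => hd x ⟨hs.1.trans hx.1, hx.2⟩)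
    (fun x hx => h1 x ⟨hs.1.trans hx.1, hx.2⟩)
  linarith

theorem deriv_eq_of_eqOn_Icc {f g : ℝ → ℝ} {f' g' a b s : ℝ} (hab : a < b) (hs : s ∈ Icc a b)
    (hf : HasDerivAt f f' s) (hg : HasDerivAt g g' s) (h : EqOn f g (Icc a b)) : f' = g' :=
  (uniqueDiffOn_Icc hab s hs).eq_deriv _ hf.hasDerivWithinAt
    (hg.hasDerivWithinAt.congr h (h hs))

/-- A planar arc of unit speed, with polar coordinates `ρ` and `φ`. -/
structure IsPolarArc (ρ ρ' φ k : ℝ → ℝ) : Prop where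
  hasDerivAt_radius : ∀ s, HasDerivAt ρ (ρ' s) s
  hasDerivAt_angle : ∀ s, HasDerivAt φ (k s) s
  unit_speed : ∀ s, ρ' s ^ 2 + (ρ s * k s) ^ 2 = 1
  one_le : ∀ s, 1 ≤ ρ s
  nonneg : ∀ s, 0 ≤ k s

/-- The half-turn of the stadium curve, in polar coordinates. -/
structure IsStadiumHalf (ρ φ : ℝ → ℝ) : Prop where
  first_x : ∀ s ∈ Icc 0 (Real.pi / 2), ρ s * Real.cos (φ s) = 1 + Real.cos s
  first_y : ∀ s ∈ Icc 0 (Real.pi / 2), ρ s * Real.sin (φ s) = Real.sin s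
  second_x : ∀ s ∈ Icc (Real.pi / 2) (Real.pi / 2 + 1),
    ρ s * Real.cos (φ s) = Real.pi / 2 + 1 - s
  second_y : ∀ s ∈ Icc (Real.pi / 2) (Real.pi / 2 + 1), ρ s * Real.sin (φ s) = 1
  third_x : ∀ s ∈ Icc (Real.pi / 2 + 1) (Real.pi + 1), ρ s * Real.cos (φ s) = Real.cos (s - 1)
  third_y : ∀ s ∈ Icc (Real.pi / 2 + 1) (Real.pi + 1), ρ s * Real.sin (φ s) = Real.sin (s - 1)

variable {ρ ρ' φ k : ℝ → ℝ}

theorem IsPolarArc.angle_deriv_le (h : IsPolarArc ρ ρ' φ k) (s : ℝ) : ρ s * k s ≤ 1 := by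
  nlinarith [h.unit_speed s, sq_nonneg (ρ' s), h.one_le s, h.nonneg s]

theorem IsPolarArc.angle_deriv_le_one (h : IsPolarArc ρ ρ' φ k) (s : ℝ) : k s ≤ 1 := by
  nlinarith [h.angle_deriv_le s, h.one_le s, h.nonneg s]

theorem IsPolarArc.hasDerivAt_x (h : IsPolarArc ρ ρ' φ k) (s : ℝ) :
    HasDerivAt (fun s => ρ s * Real.cos (φ s))
      (ρ' s * Real.cos (φ s) - ρ s * k s * Real.sin (φ s)) s := by
  refine ((h.hasDerivAt_radius s).mul (h.hasDerivAt_angle s).cos).congr_deriv ?_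
  ring

theorem IsPolarArc.hasDerivAt_y (h : IsPolarArc ρ ρ' φ k) (s : ℝ) :
    HasDerivAt (fun s => ρ s * Real.sin (φ s))
      (ρ' s * Real.sin (φ s) + ρ s * k s * Real.cos (φ s)) s := by
  refine ((h.hasDerivAt_radius s).mul (h.hasDerivAt_angle s).sin).congr_deriv ?_
  ring

theorem IsPolarArc.deriv_sq (h : IsPolarArc ρ ρ' φ k) (s : ℝ) :
    (ρ' s * Real.cos (φ s) - ρ s * k s * Real.sin (φ s)) ^ 2 +
      (ρ' s * Real.sin (φ s) + ρ s * k s * Real.cos (φ s)) ^ 2 = 1 := by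
  rw [← h.unit_speed s]
  linear_combination (ρ' s ^ 2 + (ρ s * k s) ^ 2) * Real.sin_sq_add_cos_sq (φ s)

/-- A plane arc outside the unit disc around the point `r` of the real axis that leads from the
real axis beyond `r` to a point above `r` has length at least `π / 2`, and in case of equality it
is a quarter circle. -/
theorem quarter_turn {x y x' y' : ℝ → ℝ} {r σ : ℝ} (hx : ∀ s, HasDerivAt x (x' s) s)
    (hy : ∀ s, HasDerivAt y (y' s) s) (hn : ∀ s, x' s ^ 2 + y' s ^ 2 = 1) (hσ : 0 ≤ σ)
    (hq : ∀ s ∈ Icc 0 σ, 1 ≤ (x s - r) ^ 2 + y s ^ 2) (h0 : r < x 0) (h0' : y 0 = 0)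
    (h1 : x σ = r) (h1' : 0 ≤ y σ) : Real.pi / 2 ≤ σ ∧
      (σ = Real.pi / 2 → ∀ s ∈ Icc 0 σ, x s = r + Real.cos s ∧ y s = Real.sin s) := by
  set w : ℝ → ℂ := fun s => ⟨x s - r, y s⟩ with hw
  have hwd : ∀ s, HasDerivAt w ⟨x' s, y' s⟩ s := by
    intro s
    have e1 := (((hx s).sub_const r).ofReal_comp).add ((hy s).ofReal_comp.mul_const Complex.I)
    refine (e1.congr_deriv (by simp [Complex.ext_iff])).congr_of_eventuallyEq
      (Eventually.of_forall fun z => ?_)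
    simp [hw, Complex.ext_iff]
  have hnorm : ∀ s, ‖w s‖ ^ 2 = (x s - r) ^ 2 + y s ^ 2 := fun s => by
    rw [← Complex.normSq_eq_norm_sq, Complex.normSq_apply]; simp only [hw]; ring
  have hinner : ∀ s t, inner ℝ (w s) (w t) = (x s - r) * (x t - r) + y s * y t := fun s t => by
    rw [Complex.inner]; simp [hw]; ring
  have hone : ∀ s ∈ Icc 0 σ, 1 ≤ ‖w s‖ := fun s hs => by
    nlinarith [hq s hs, hnorm s, norm_nonneg (w s)]
  have hwc : Continuous w := continuous_iff_continuousAt.2 fun s => (hwd s).continuousAt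
  -- A unit-speed curve at distance |w| ≥ 1 turns with angular speed at most 1/|w|. The maximum with
  -- 1 makes this bound continuous on the whole line.
  set κ : ℝ → ℝ := fun s => (max 1 ‖w s‖)⁻¹ with hκ
  have hκc : Continuous κ := (continuous_const.max hwc.norm).inv₀
    fun s => (zero_lt_one.trans_le (le_max_left _ _)).ne'
  have hκ0 : ∀ s, 0 ≤ κ s := fun s => inv_nonneg.2 (zero_le_one.trans (le_max_left _ _))
  have hκ1 : ∀ s, κ s ≤ 1 := fun s => inv_le_one_of_one_le₀ (le_max_left _ _)
  set B : ℝ → ℝ := fun s => ∫ t in (0 : ℝ)..s, κ t with hB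
  have hBd : ∀ s, HasDerivAt B (κ s) s := fun s =>
    intervalIntegral.integral_hasDerivAt_right (hκc.intervalIntegrable _ _)
      (hκc.stronglyMeasurableAtFilter _ _) hκc.continuousAt
  have hB0 : B 0 = 0 := intervalIntegral.integral_same
  have hang : ∀ a b, 0 ≤ a → a ≤ b → b ≤ σ → angle (w a) (w b) ≤ B b - B a := by
    intro a b ha hab hb
    refine angle_le_of_norm_deriv_div_le hab (fun s hs h => ?_) (fun s _ => hwd s) hBd hκ0 ?_
    · have := hone s ⟨ha.trans hs.1, hs.2.trans hb⟩
      rw [h, norm_zero] at this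
      linarith
    · intro s hs
      have e1 : ‖(⟨x' s, y' s⟩ : ℂ)‖ = 1 := by
        rw [Complex.norm_eq_sqrt_sq_add_sq]; simp [hn]
      rw [e1, one_div, hκ]
      simp only
      rw [max_eq_right (hone s ⟨ha.trans hs.1, hs.2.trans hb⟩)]
  have hright : angle (w 0) (w σ) = Real.pi / 2 := by
    rw [← inner_eq_zero_iff_angle_eq_pi_div_two, hinner, h0', h1]
    ring
  have hBle : ∀ a b, a ≤ b → B b - B a ≤ b - a := fun a b hab =>
    sub_le_sub_of_deriv_le_one hab (fun s _ => hBd s) (fun s _ => hκ1 s)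
  refine ⟨by linarith [hang 0 σ le_rfl hσ le_rfl, hBle 0 σ hσ], fun hσe => ?_⟩
  have hBeq := eq_add_of_deriv_le_one (a := 0) (b := σ) (fun s _ => hBd s) (fun s _ => hκ1 s)
    (by linarith [hang 0 σ le_rfl hσ le_rfl])
  -- Without slack in the length bound the angular speed bound is 1 throughout, which puts the arc
  -- on the unit circle.
  have hunit : ∀ s ∈ Icc 0 σ, ‖w s‖ = 1 := by
    intro s hs
    have e1 : κ s = 1 := deriv_eq_of_eqOn_Icc (by linarith [Real.pi_pos]) hs (hBd s)
      (((hasDerivAt_id s).sub_const 0).const_add (B 0)) hBeq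
    simp only [hκ, inv_eq_one] at e1
    exact le_antisymm (e1 ▸ le_max_right _ _) (hone s hs)
  have hx0 : x 0 - r = 1 := by
    have := hnorm 0
    rw [hunit 0 ⟨le_rfl, hσ⟩, h0'] at this
    nlinarith
  have hy1 : y σ = 1 := by
    have := hnorm σ
    rw [hunit σ ⟨hσ, le_rfl⟩, h1] at this
    nlinarith
  intro s hs
  have a1 := hang 0 s le_rfl hs.1 hs.2
  have a2 := hang s σ hs.1 hs.2 le_rfl
  have a3 := angle_le_angle_add_angle (w 0) (w s) (w σ)
  have a4 := hBeq s hs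
  have a5 := hBle s σ hs.2
  have a6 : angle (w 0) (w s) = s := by linarith
  have a7 : angle (w s) (w σ) = Real.pi / 2 - s := by linarith
  have c1 := cos_angle (w 0) (w s)
  have c2 := cos_angle (w s) (w σ)
  rw [a6, hunit 0 ⟨le_rfl, hσ⟩, hunit s hs, hinner, hx0, h0'] at c1
  rw [a7, hunit σ ⟨hσ, le_rfl⟩, hunit s hs, hinner, h1, hy1, Real.cos_pi_div_two_sub] at c2
  constructor <;> linarith

/-- An arc of unit speed outside the unit discs around `0` and `r ≥ 1` that makes half a turn
around `0`, starting on the real axis beyond `r`, has length at least `π + r`. Only the half-turn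
of the stadium curve has length `π + 1`. -/
theorem IsPolarArc.half_turn (h : IsPolarArc ρ ρ' φ k) {r S : ℝ} (hS : 0 ≤ S) (h0 : φ 0 = 0)
    (hφS : φ S = Real.pi) (hr : 1 ≤ r) (hρ0 : r < ρ 0)
    (hq : ∀ s ∈ Icc 0 S,
      1 ≤ (ρ s * Real.cos (φ s) - r) ^ 2 + (ρ s * Real.sin (φ s)) ^ 2) :
    Real.pi + r ≤ S ∧ (S ≤ Real.pi + 1 →
      r = 1 ∧ S = Real.pi + 1 ∧ IsStadiumHalf ρ φ ∧ ∀ s ∈ Icc 0 S, 0 < k s) := by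
  have hp := Real.pi_pos
  have hφc : Continuous φ := continuous_iff_continuousAt.2 fun s =>
    (h.hasDerivAt_angle s).continuousAt
  have hφm : Monotone φ := monotone_of_deriv_nonneg
    (fun s => (h.hasDerivAt_angle s).differentiableAt)
    (fun s => by rw [(h.hasDerivAt_angle s).deriv]; exact h.nonneg s)
  -- The arc is cut at abscissa `r` (time `σ₁`) and at angle π/2 (time `σ₂`). The pieces have length
  -- at least π/2 (a quarter turn around `r`), `r` (the abscissa falls from `r` to 0 with speed at
  -- most 1), and π/2 (the angular speed is at most 1).
  obtain ⟨σ₂, hσ₂, hφσ⟩ : Real.pi / 2 ∈ φ '' Icc 0 S :=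
    intermediate_value_Icc hS hφc.continuousOn ⟨by linarith, by linarith⟩
  have hXc : Continuous fun s => ρ s * Real.cos (φ s) :=
    continuous_iff_continuousAt.2 fun s => (h.hasDerivAt_x s).continuousAt
  obtain ⟨σ₁, hσ₁, hXσ⟩ : r ∈ (fun s => ρ s * Real.cos (φ s)) '' Icc 0 σ₂ :=
    intermediate_value_Icc' hσ₂.1 hXc.continuousOn
      ⟨by simp [hφσ]; linarith, by simp [h0]; linarith⟩
  simp only at hXσ
  have l3 := sub_le_sub_of_deriv_le_one hσ₂.2 (fun s _ => h.hasDerivAt_angle s)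
    (fun s _ => h.angle_deriv_le_one s)
  have hX1 : ∀ s, -(ρ' s * Real.cos (φ s) - ρ s * k s * Real.sin (φ s)) ≤ 1 := fun s => by
    nlinarith [h.deriv_sq s]
  have l2 := sub_le_sub_of_deriv_le_one hσ₁.2 (fun s _ => (h.hasDerivAt_x s).neg)
    (fun s _ => hX1 s)
  simp only [Pi.neg_apply, hφσ, Real.cos_pi_div_two, mul_zero, hXσ] at l2
  obtain ⟨l1, e1⟩ := quarter_turn h.hasDerivAt_x h.hasDerivAt_y h.deriv_sq (r := r) hσ₁.1
    (fun s hs => hq s ⟨hs.1, hs.2.trans (hσ₁.2.trans hσ₂.2)⟩) (by simpa [h0] using hρ0)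
    (by simp [h0]) hXσ (mul_nonneg (zero_le_one.trans (h.one_le _))
      (Real.sin_nonneg_of_nonneg_of_le_pi (h0 ▸ hφm hσ₁.1)
        (hφS ▸ hφm (hσ₁.2.trans hσ₂.2))))
  rw [hφS, hφσ] at l3
  refine ⟨by linarith, fun hSle => ?_⟩
  -- The total is at most π + 1 and `r` is at least 1, so every piece has its minimal length.
  obtain rfl : r = 1 := by linarith
  obtain rfl : σ₁ = Real.pi / 2 := by linarith
  obtain rfl : σ₂ = Real.pi / 2 + 1 := by linarith
  obtain rfl : S = Real.pi + 1 := by linarith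
  have t1 := eq_add_of_deriv_le_one (a := Real.pi / 2 + 1) (b := Real.pi + 1)
    (fun s _ => h.hasDerivAt_angle s) (fun s _ => h.angle_deriv_le_one s) (by linarith)
  have tk : ∀ s ∈ Icc (Real.pi / 2 + 1) (Real.pi + 1), k s = 1 := fun s hs =>
    deriv_eq_of_eqOn_Icc (by linarith) hs (h.hasDerivAt_angle s)
      (((hasDerivAt_id s).sub_const (Real.pi / 2 + 1)).const_add (φ (Real.pi / 2 + 1))) t1
  have tρ : ∀ s ∈ Icc (Real.pi / 2 + 1) (Real.pi + 1), ρ s = 1 := fun s hs => by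
    have := h.angle_deriv_le s
    rw [tk s hs, mul_one] at this
    exact le_antisymm this (h.one_le s)
  have tφ : ∀ s ∈ Icc (Real.pi / 2 + 1) (Real.pi + 1), φ s = s - 1 := fun s hs => by
    rw [t1 s hs, hφσ]; ring
  have m1 := eq_add_of_deriv_le_one (a := Real.pi / 2) (b := Real.pi / 2 + 1)
    (fun s _ => (h.hasDerivAt_x s).neg) (fun s _ => hX1 s)
    (by simp only [Pi.neg_apply, hφσ, Real.cos_pi_div_two, mul_zero, hXσ]; linarith)
  simp only [Pi.neg_apply, hXσ] at m1
  have mx : ∀ s ∈ Icc (Real.pi / 2) (Real.pi / 2 + 1),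
      ρ s * Real.cos (φ s) = Real.pi / 2 + 1 - s := fun s hs => by linarith [m1 s hs]
  have mX' : ∀ s ∈ Icc (Real.pi / 2) (Real.pi / 2 + 1),
      ρ' s * Real.cos (φ s) - ρ s * k s * Real.sin (φ s) = -1 := fun s hs =>
    deriv_eq_of_eqOn_Icc (by linarith) hs (h.hasDerivAt_x s)
      ((hasDerivAt_id s).const_sub (Real.pi / 2 + 1)) mx
  -- The abscissa uses up the whole unit speed, so the ordinate is constant; its value is read off
  -- at the start of the last quarter circle.
  have mY' : ∀ s ∈ Icc (Real.pi / 2) (Real.pi / 2 + 1),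
      ρ' s * Real.sin (φ s) + ρ s * k s * Real.cos (φ s) = 0 := fun s hs => by
    have := h.deriv_sq s
    rw [mX' s hs] at this
    nlinarith
  have my : ∀ s ∈ Icc (Real.pi / 2) (Real.pi / 2 + 1), ρ s * Real.sin (φ s) = 1 := by
    have hconst := constant_of_has_deriv_right_zero (a := Real.pi / 2) (b := Real.pi / 2 + 1)
      (f := fun s => ρ s * Real.sin (φ s))
      (fun s _ => (h.hasDerivAt_y s).continuousAt.continuousWithinAt)
      (fun s hs => by
        have := h.hasDerivAt_y s
        rw [mY' s (Ico_subset_Icc_self hs)] at this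
        exact this.hasDerivWithinAt)
    intro s hs
    have e2 := hconst s hs
    have e3 := hconst (Real.pi / 2 + 1) ⟨by linarith, le_rfl⟩
    rw [e2, ← e3, tρ _ ⟨le_rfl, by linarith⟩, hφσ, Real.sin_pi_div_two, one_mul]
  refine ⟨rfl, rfl, ⟨fun s hs => (e1 rfl s hs).1, fun s hs => (e1 rfl s hs).2, mx, my,
    fun s hs => by rw [tρ s hs, tφ s hs, one_mul], fun s hs => by rw [tρ s hs, tφ s hs, one_mul]⟩,
    fun s hs => ?_⟩
  have hsq : ρ s ^ 2 = (ρ s * Real.cos (φ s)) ^ 2 + (ρ s * Real.sin (φ s)) ^ 2 := by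
    linear_combination -(ρ s ^ 2) * Real.sin_sq_add_cos_sq (φ s)
  -- This is the areal velocity x y' - y x'. Its positivity on each of the three pieces shows that
  -- the angle never stops.
  have hcross : ρ s ^ 2 * k s = ρ s * Real.cos (φ s) *
      (ρ' s * Real.sin (φ s) + ρ s * k s * Real.cos (φ s)) - ρ s * Real.sin (φ s) *
      (ρ' s * Real.cos (φ s) - ρ s * k s * Real.sin (φ s)) := by
    linear_combination -(ρ s ^ 2 * k s) * Real.sin_sq_add_cos_sq (φ s)
  have hρpos := h.one_le s
  suffices 0 < ρ s ^ 2 * k s from pos_of_mul_pos_right this (sq_nonneg _)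
  rcases le_total s (Real.pi / 2) with hs1 | hs1
  · have hs' : s ∈ Icc 0 (Real.pi / 2) := ⟨hs.1, hs1⟩
    have d1 := deriv_eq_of_eqOn_Icc (by linarith) hs' (h.hasDerivAt_x s)
      ((Real.hasDerivAt_cos s).const_add 1) fun t ht => (e1 rfl t ht).1
    have d2 := deriv_eq_of_eqOn_Icc (by linarith) hs' (h.hasDerivAt_y s)
      (Real.hasDerivAt_sin s) fun t ht => (e1 rfl t ht).2
    rw [hcross, d1, d2, (e1 rfl s hs').1, (e1 rfl s hs').2]
    have := Real.cos_nonneg_of_mem_Icc (x := s) ⟨by linarith [hs.1], hs1⟩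
    nlinarith [Real.sin_sq_add_cos_sq s]
  rcases le_total s (Real.pi / 2 + 1) with hs2 | hs2
  · rw [hcross, mX' s ⟨hs1, hs2⟩, mY' s ⟨hs1, hs2⟩, my s ⟨hs1, hs2⟩]
    norm_num
  · rw [tk s ⟨hs2, hs.2⟩, tρ s ⟨hs2, hs.2⟩]
    norm_num

end HalfTurn

/-! ### Closed spherical curves of length at most 2π -/

section Spherical

variable {E : Type*} [NormedAddCommGroup E] [InnerProductSpace ℝ E]

theorem eq_neg_of_inner_eq_neg_one {x y : E} (hx : ‖x‖ = 1) (hy : ‖y‖ = 1)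
    (h : inner ℝ x y = -1) : y = -x := by
  have : ‖x + y‖ ^ 2 = 0 := by
    rw [norm_add_sq_real, hx, hy, h]; norm_num
  exact eq_neg_of_add_eq_zero_right (norm_eq_zero.1 (pow_eq_zero_iff two_ne_zero |>.1 this))

/-- The components along `c` and `d` already account for the whole norm of `x`. -/
theorem eq_of_inner_eq {x c d : E} {α : ℝ} (hx : ‖x‖ = 1) (hc : ‖c‖ = 1) (hd : ‖d‖ = 1)
    (hcd : inner ℝ c d = 0) (h1 : inner ℝ x c = Real.cos α) (h2 : inner ℝ x d = Real.sin α) :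
    x = Real.cos α • c + Real.sin α • d := by
  have : ‖x - (Real.cos α • c + Real.sin α • d)‖ ^ 2 = 0 := by
    rw [norm_sub_sq_real, norm_add_sq_real, norm_smul, norm_smul, inner_add_right,
      inner_smul_right, inner_smul_right, inner_smul_right, inner_smul_left, hcd, hx, hc, hd,
      h1, h2]
    simp only [Real.norm_eq_abs, mul_one, mul_zero, sq_abs]
    linear_combination -Real.sin_sq_add_cos_sq α
  exact sub_eq_zero.1 (norm_eq_zero.1 (pow_eq_zero_iff two_ne_zero |>.1 this))

/-- A closed curve on the unit sphere with speed `k` and length `Θ`; `φ` measures length. -/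
structure IsSphericalLoop (u u' : ℝ → E) (φ k : ℝ → ℝ) (ℓ Θ : ℝ) : Prop where
  norm_eq : ∀ s, ‖u s‖ = 1
  hasDerivAt : ∀ s, HasDerivAt u (u' s) s
  norm_deriv : ∀ s, ‖u' s‖ = k s
  hasDerivAt_length : ∀ s, HasDerivAt φ (k s) s
  periodic : Function.Periodic u ℓ
  length_add : ∀ s, φ (s + ℓ) = φ s + Θ
  pos : 0 < ℓ

variable {u u' : ℝ → E} {φ k : ℝ → ℝ} {ℓ Θ : ℝ}

theorem IsSphericalLoop.continuous_length (h : IsSphericalLoop u u' φ k ℓ Θ) : Continuous φ :=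
  continuous_iff_continuousAt.2 fun s => (h.hasDerivAt_length s).continuousAt

theorem IsSphericalLoop.angle_le (h : IsSphericalLoop u u' φ k ℓ Θ) {s t : ℝ} (hst : s ≤ t) :
    angle (u s) (u t) ≤ φ t - φ s :=
  angle_le_of_norm_deriv_le hst (fun s _ => h.norm_eq s) (fun s _ => h.hasDerivAt s)
    h.hasDerivAt_length (fun s => h.norm_deriv s ▸ norm_nonneg _) fun s _ => (h.norm_deriv s).le

theorem IsSphericalLoop.monotone (h : IsSphericalLoop u u' φ k ℓ Θ) : Monotone φ :=
  fun _ _ hst => sub_nonneg.1 ((angle_nonneg _ _).trans (h.angle_le hst))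

theorem IsSphericalLoop.cos_le_inner (h : IsSphericalLoop u u' φ k ℓ Θ) {s t : ℝ} (hst : s ≤ t)
    (hπ : φ t - φ s ≤ Real.pi) : Real.cos (φ t - φ s) ≤ inner ℝ (u t) (u s) := by
  rw [real_inner_comm]
  exact cos_le_inner_of_angle_le (h.norm_eq s) (h.norm_eq t) (h.angle_le hst) hπ

/-- A closed spherical curve of length less than `2π` lies in an open hemisphere. -/
theorem IsSphericalLoop.two_pi_le (h : IsSphericalLoop u u' φ k ℓ Θ)
    (hull : ∀ N, ∃ s, inner ℝ (u s) N ≤ 0) : 2 * Real.pi ≤ Θ := by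
  by_contra! hlt
  have hΘ0 : 0 ≤ Θ := by
    have := h.monotone (le_add_of_nonneg_right h.pos.le : (0 : ℝ) ≤ 0 + ℓ)
    rw [h.length_add] at this
    linarith
  -- The points `u 0` and `u m` halve the curve, and their sum is the pole of the hemisphere. A
  -- point at arc distance a from one of them is at arc distance Θ/2 - a from the other on the same
  -- half, and cos a + cos (Θ/2 - a) > 0 because Θ/2 < π.
  obtain ⟨m, hm, hφm⟩ : φ 0 + Θ / 2 ∈ φ '' Icc 0 (0 + ℓ) :=
    intermediate_value_Icc (by linarith [h.pos]) h.continuous_length.continuousOn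
      ⟨by linarith, by rw [h.length_add]; linarith⟩
  obtain ⟨s, hs⟩ := hull (u 0 + u m)
  have hper : ∃ r ∈ Ico 0 (0 + ℓ), u s = u r :=
    ⟨toIcoMod h.pos 0 s, toIcoMod_mem_Ico _ _ _, by
      rw [← self_sub_toIcoDiv_zsmul, h.periodic.sub_zsmul_eq]⟩
  obtain ⟨r, hr, hsr⟩ := hper
  rw [hsr, inner_add_right] at hs
  have hp := Real.pi_pos
  have hΘ := h.length_add 0
  have pos : ∀ a, 0 ≤ a → a ≤ Θ / 2 → 0 < Real.cos a + Real.cos (Θ / 2 - a) := by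
    intro a ha ha'
    rw [Real.cos_add_cos]
    have e1 : 0 < Real.cos ((a + (Θ / 2 - a)) / 2) :=
      Real.cos_pos_of_mem_Ioo ⟨by linarith, by linarith⟩
    have e2 : 0 < Real.cos ((a - (Θ / 2 - a)) / 2) :=
      Real.cos_pos_of_mem_Ioo ⟨by linarith, by linarith⟩
    positivity
  rcases le_total r m with hrm | hrm
  · have a1 := h.monotone hr.1
    have a2 := h.monotone hrm
    have c1 := h.cos_le_inner hr.1 (by linarith)
    have c2 := h.cos_le_inner hrm (by linarith)
    have c3 := pos (φ r - φ 0) (by linarith) (by linarith)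
    rw [real_inner_comm] at c2
    rw [show φ m - φ r = Θ / 2 - (φ r - φ 0) by linarith] at c2
    linarith
  · have a1 := h.monotone hr.2.le
    have a2 := h.monotone hrm
    have c1 := h.cos_le_inner hr.2.le (by linarith)
    have c2 := h.cos_le_inner hrm (by linarith)
    have c3 := pos (φ r - φ m) (by linarith) (by linarith)
    rw [h.periodic, real_inner_comm, show φ (0 + ℓ) - φ r = Θ / 2 - (φ r - φ m) by linarith] at c1
    linarith

/-- If a regular spherical arc of length `π` is not contained in the open hemisphere centred
between its endpoints, then these are antipodal. -/
theorem IsSphericalLoop.eq_neg_of_inner_le (h : IsSphericalLoop u u' φ k ℓ Θ)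
    (hk : ∀ s, 0 < k s) {s t r : ℝ} (hst : φ t = φ s + Real.pi) (hr : r ∈ Icc s t)
    (hN : inner ℝ (u r) (u s + u t) ≤ 0) : u t = -u s := by
  rw [inner_add_right] at hN
  have c1 : ∀ x ∈ Icc s t, 0 ≤ inner ℝ (u x) (u s) - Real.cos (φ x - φ s) := fun x hx =>
    sub_nonneg.2 (h.cos_le_inner hx.1 (by linarith [h.monotone hx.2]))
  have c2 : ∀ x ∈ Icc s t, 0 ≤ inner ℝ (u x) (u t) + Real.cos (φ x - φ s) := fun x hx => by
    have := h.cos_le_inner hx.2 (by linarith [h.monotone hx.1])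
    rw [real_inner_comm, show φ t - φ x = Real.pi - (φ x - φ s) by linarith,
      Real.cos_pi_sub] at this
    linarith
  -- The two lower bounds cos a and -cos a add up to 0, the upper bound for the sum, so both are
  -- attained at `r`.
  have z1 : inner ℝ (u r) (u s) = Real.cos (φ r - φ s) := by linarith [c1 r hr, c2 r hr]
  have z2 : inner ℝ (u r) (u t) = -Real.cos (φ r - φ s) := by linarith [c1 r hr, c2 r hr]
  rcases hr.1.eq_or_lt with rfl | h1
  · rw [sub_self, Real.cos_zero] at z2
    exact eq_neg_of_inner_eq_neg_one (h.norm_eq _) (h.norm_eq _) z2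
  rcases hr.2.eq_or_lt with rfl | h2
  · rw [hst, add_sub_cancel_left, Real.cos_pi] at z1
    rw [eq_neg_of_inner_eq_neg_one (h.norm_eq _) (h.norm_eq _) z1, neg_neg]
  -- At an interior point `r` both differences have a local minimum. Their vanishing derivatives
  -- give the components of `u s` and `u t` along the unit tangent `D` at `r`, which exists because
  -- the speed is positive. Together with the components along `u r` this determines both points.
  have d0 := ((h.hasDerivAt_length r).sub_const (φ s)).cos
  have d1 : HasDerivAt (fun x => inner ℝ (u x) (u s) - Real.cos (φ x - φ s))
      (inner ℝ (u' r) (u s) + Real.sin (φ r - φ s) * k r) r := by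
    refine (((h.hasDerivAt r).inner ℝ (hasDerivAt_const r (u s))).sub d0).congr_deriv ?_
    simp
  have d2 : HasDerivAt (fun x => inner ℝ (u x) (u t) + Real.cos (φ x - φ s))
      (inner ℝ (u' r) (u t) - Real.sin (φ r - φ s) * k r) r := by
    refine (((h.hasDerivAt r).inner ℝ (hasDerivAt_const r (u t))).add d0).congr_deriv ?_
    simp [sub_eq_add_neg]
  have m1 : IsLocalMin (fun x => inner ℝ (u x) (u s) - Real.cos (φ x - φ s)) r := by
    filter_upwards [Icc_mem_nhds h1 h2] with x hx
    linarith [c1 x hx]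
  have m2 : IsLocalMin (fun x => inner ℝ (u x) (u t) + Real.cos (φ x - φ s)) r := by
    filter_upwards [Icc_mem_nhds h1 h2] with x hx
    linarith [c2 x hx]
  have e1 := m1.hasDerivAt_eq_zero d1
  have e2 := m2.hasDerivAt_eq_zero d2
  have hkr := hk r
  have hperp : inner ℝ (u r) (u' r) = 0 := by
    have d3 := (h.hasDerivAt r).norm_sq
    simp only [h.norm_eq] at d3
    have := d3.unique (hasDerivAt_const r _)
    linarith
  set D := (k r)⁻¹ • u' r with hD
  have hDn : ‖D‖ = 1 := by
    rw [hD, norm_smul, h.norm_deriv, norm_inv, Real.norm_of_nonneg hkr.le,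
      inv_mul_cancel₀ hkr.ne']
  have hDp : inner ℝ (u r) D = 0 := by rw [hD, inner_smul_right, hperp, mul_zero]
  have f1 : inner ℝ (u s) D = Real.sin (-(φ r - φ s)) := by
    rw [hD, inner_smul_right, real_inner_comm, Real.sin_neg, inv_mul_eq_iff_eq_mul₀ hkr.ne']
    linarith
  have f2 : inner ℝ (u t) D = Real.sin (Real.pi - (φ r - φ s)) := by
    rw [hD, inner_smul_right, real_inner_comm, Real.sin_pi_sub, inv_mul_eq_iff_eq_mul₀ hkr.ne']
    linarith
  have g1 := eq_of_inner_eq (h.norm_eq s) (h.norm_eq r) hDn hDp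
    (by rw [real_inner_comm, z1, Real.cos_neg]) f1
  have g2 := eq_of_inner_eq (h.norm_eq t) (h.norm_eq r) hDn hDp
    (by rw [real_inner_comm, z2, Real.cos_pi_sub]) f2
  rw [g1, g2, Real.cos_pi_sub, Real.sin_pi_sub, Real.cos_neg, Real.sin_neg]
  module

/-- A regular closed spherical curve of length `2π` that is not contained in an open hemisphere
is a great circle. -/
theorem IsSphericalLoop.inner_eq_cos (h : IsSphericalLoop u u' φ k ℓ (2 * Real.pi))
    (hk : ∀ s, 0 < k s) (hull : ∀ N, ∃ s, inner ℝ (u s) N ≤ 0) {s r : ℝ}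
    (hr : r ∈ Icc s (s + ℓ)) : inner ℝ (u r) (u s) = Real.cos (φ r - φ s) := by
  have hp := Real.pi_pos
  have hΘ := h.length_add s
  obtain ⟨t, ht, hφt⟩ : φ s + Real.pi ∈ φ '' Icc s (s + ℓ) :=
    intermediate_value_Icc (by linarith [h.pos]) h.continuous_length.continuousOn
      ⟨by linarith, by linarith⟩
  -- The parameter `t` is halfway around. The vector `u s + u t` serves both halves, so it does not
  -- matter on which half the point outside its open hemisphere is found.
  have hanti : u t = -u s := by
    obtain ⟨x, hx⟩ := hull (u s + u t)
    have hper : ∃ y ∈ Ico s (s + ℓ), u x = u y :=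
      ⟨toIcoMod h.pos s x, toIcoMod_mem_Ico _ _ _, by
        rw [← self_sub_toIcoDiv_zsmul, h.periodic.sub_zsmul_eq]⟩
    obtain ⟨y, hy, hxy⟩ := hper
    rw [hxy] at hx
    rcases le_total y t with hyt | hyt
    · exact h.eq_neg_of_inner_le hk hφt ⟨hy.1, hyt⟩ hx
    · have := h.eq_neg_of_inner_le hk (s := t) (t := s + ℓ) (r := y) (by linarith)
        ⟨hyt, hy.2.le⟩ (by rwa [h.periodic, add_comm])
      rw [← h.periodic s, this, neg_neg]
  rcases le_total r t with hrt | hrt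
  · have c1 := h.cos_le_inner hr.1 (by linarith [h.monotone hrt])
    have c2 := h.cos_le_inner hrt (by linarith [h.monotone hr.1])
    rw [hanti, inner_neg_left, real_inner_comm, hφt,
      show φ s + Real.pi - φ r = Real.pi - (φ r - φ s) by ring, Real.cos_pi_sub] at c2
    linarith
  · have c1 := h.cos_le_inner hrt (by linarith [h.monotone hr.2])
    have c2 := h.cos_le_inner hr.2 (by linarith [h.monotone hrt])
    rw [hanti, inner_neg_right, hφt, show φ r - (φ s + Real.pi) = φ r - φ s - Real.pi by ring,
      Real.cos_sub_pi] at c1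
    rw [h.periodic, real_inner_comm, hΘ,
      show φ s + 2 * Real.pi - φ r = 2 * Real.pi - (φ r - φ s) by ring,
      Real.cos_two_pi_sub] at c2
    linarith

end Spherical

/-! ### Rigidity of the stadium curve -/

section Rigidity

variable {E : Type*} [NormedAddCommGroup E] [InnerProductSpace ℝ E]

/-- A closed curve of length `2π + 2` around the origin and a point `q` at distance at least `1`
from the origin, which keeps distance at least `1` from both and does not lie in an open
half-space, is the planar stadium curve. -/
theorem stadium_rigidity {b b' : ℝ → E} {q : E} (hd : ∀ s, HasDerivAt b (b' s) s)
    (hc : Continuous b') (hn : ∀ s, ‖b' s‖ = 1)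
    (hper : Function.Periodic b (2 * Real.pi + 2)) (hb : ∀ s, 1 ≤ ‖b s‖)
    (hbq : ∀ s, 1 ≤ ‖b s - q‖) (hq : 1 ≤ ‖q‖) (hseg : ∃ c ∈ Icc (0 : ℝ) 1, q = c • b 0)
    (hull : ∀ N, ∃ s, inner ℝ (b s) N ≤ 0) :
    ‖q‖ = 1 ∧ inner ℝ q (b' 0) = 0 ∧ b 0 = q + q ∧ b (Real.pi / 2) = q + b' 0 ∧
      b (Real.pi / 2 + 1) = b' 0 ∧ b (Real.pi + 1) = -q ∧
      b (2 * Real.pi + 2 - Real.pi / 2) = q - b' 0 := by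
  have hp := Real.pi_pos
  set ℓ := 2 * Real.pi + 2 with hℓ
  have hb0 : ∀ s, b s ≠ 0 := fun s h => by
    have := hb s
    rw [h, norm_zero] at this
    linarith
  have hpos : ∀ s, 0 < ‖b s‖ := fun s => norm_pos_iff.2 (hb0 s)
  have hbc : Continuous b := continuous_iff_continuousAt.2 fun s => (hd s).continuousAt
  set ρ : ℝ → ℝ := fun s => ‖b s‖ with hρ
  set ρ' : ℝ → ℝ := fun s => inner ℝ (b s) (b' s) / ‖b s‖ with hρ'
  set u : ℝ → E := fun s => ‖b s‖⁻¹ • b s with hu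
  set u' : ℝ → E := fun s => ‖b s‖⁻¹ • b' s - (inner ℝ (b s) (b' s) / ‖b s‖ ^ 3) • b s with hu'
  set k : ℝ → ℝ := fun s => ‖u' s‖ with hk
  have hu'c : Continuous u' := by
    have h1 : Continuous fun s => ‖b s‖⁻¹ := hbc.norm.inv₀ fun s => (hpos s).ne'
    have h2 : Continuous fun s => inner ℝ (b s) (b' s) / ‖b s‖ ^ 3 :=
      (hbc.inner hc).div (hbc.norm.pow 3) fun s => pow_ne_zero 3 (hpos s).ne'
    exact (h1.smul hc).sub (h2.smul hbc)
  have hkc : Continuous k := hu'c.norm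
  -- The length `φ` of the radial projection is the polar angle after developing the cone over the
  -- curve into the plane; `(ρ, φ)` are the polar coordinates of the developed curve.
  set φ : ℝ → ℝ := fun s => ∫ t in (0 : ℝ)..s, k t with hφ
  have hφd : ∀ s, HasDerivAt φ (k s) s := fun s =>
    intervalIntegral.integral_hasDerivAt_right (hkc.intervalIntegrable _ _)
      (hkc.stronglyMeasurableAtFilter _ _) hkc.continuousAt
  have hφ0 : φ 0 = 0 := intervalIntegral.integral_same
  have hper' : Function.Periodic b' ℓ := fun s => by
    have h1 : HasDerivAt (fun x => b (x + ℓ)) (b' (s + ℓ)) s := (hd (s + ℓ)).comp_add_const s ℓ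
    rw [show (fun x => b (x + ℓ)) = b from funext hper] at h1
    exact h1.unique (hd s)
  have hkper : Function.Periodic k ℓ := fun s => by simp only [hk, hu', hper s, hper' s]
  set Θ := φ ℓ with hΘ
  have hsph : IsSphericalLoop u u' φ k ℓ Θ :=
    { norm_eq := fun s => by
        rw [hu]; simp only
        rw [norm_smul, norm_inv, norm_norm, inv_mul_cancel₀ (hpos s).ne']
      hasDerivAt := fun s => hasDerivAt_normalize (hd s) (hb0 s)
      norm_deriv := fun s => rfl
      hasDerivAt_length := hφd
      periodic := fun s => by simp only [hu, hper s]
      length_add := fun s => by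
        simp only [hΘ, hφ]
        rw [← intervalIntegral.integral_add_adjacent_intervals (b := s)
          (hkc.intervalIntegrable _ _) (hkc.intervalIntegrable _ _),
          hkper.intervalIntegral_add_eq s 0, zero_add]
      pos := by positivity }
  have hullu : ∀ N, ∃ s, inner ℝ (u s) N ≤ 0 := fun N => by
    obtain ⟨s, hs⟩ := hull N
    refine ⟨s, ?_⟩
    simp only [hu, inner_smul_left, conj_trivial]
    exact mul_nonpos_of_nonneg_of_nonpos (inv_nonneg.2 (norm_nonneg _)) hs
  have hΘ2 := hsph.two_pi_le hullu
  have hpolar : IsPolarArc ρ ρ' φ k :=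
    { hasDerivAt_radius := fun s => by
        have h1 := ((hd s).norm_sq).sqrt (pow_ne_zero 2 (hpos s).ne')
        simp only [Real.sqrt_sq (norm_nonneg _)] at h1
        refine h1.congr_deriv ?_
        simp only [hρ']
        field_simp
      hasDerivAt_angle := hφd
      unit_speed := fun s => by
        rw [mul_pow]
        simp only [hk, hu', hρ, hρ']
        rw [norm_normalize_deriv_sq (hb0 s), hn]
        have := (hpos s).ne'
        field_simp
        ring
      one_le := hb
      nonneg := fun s => norm_nonneg _ }
  have hbu : ∀ s, b s = ρ s • u s := fun s => by
    simp only [hu, hρ]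
    rw [smul_smul, mul_inv_cancel₀ (hpos s).ne', one_smul]
  obtain ⟨c, hc01, hqc⟩ := hseg
  have hqu : q = ‖q‖ • u 0 := by
    rw [hqc, norm_smul, Real.norm_of_nonneg hc01.1, mul_smul]
    exact congrArg _ (hbu 0)
  have hqρ : ‖q‖ ≤ ρ 0 := by
    rw [hqc, norm_smul, Real.norm_of_nonneg hc01.1]
    exact mul_le_of_le_one_left (norm_nonneg _) hc01.2
  have hqlt : ‖q‖ < ρ 0 := by
    have h1 := hbq 0
    rw [hqu, hbu 0, ← sub_smul, norm_smul, hsph.norm_eq, mul_one, Real.norm_of_nonneg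
      (sub_nonneg.2 hqρ)] at h1
    linarith
  -- Developing replaces the angle to the ray through `q` by one that is no smaller, up to π. By the
  -- law of cosines the distance to `q` does not decrease.
  have hdist : ∀ s α, Real.cos α ≤ inner ℝ (u s) (u 0) →
      1 ≤ (ρ s * Real.cos α - ‖q‖) ^ 2 + (ρ s * Real.sin α) ^ 2 := fun s α hα => by
    have h1 : 1 ≤ ‖b s - q‖ ^ 2 := one_le_pow₀ (hbq s)
    rw [hqu, hbu s, norm_sub_sq_real, norm_smul (ρ s) (u s), norm_smul ‖q‖ (u 0),
      hsph.norm_eq, hsph.norm_eq,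
      inner_smul_left, inner_smul_right, Real.norm_of_nonneg (norm_nonneg q),
      show ‖ρ s‖ = ρ s from norm_norm _] at h1
    simp only [conj_trivial, mul_one] at h1
    have h2 : ρ s * (‖q‖ * Real.cos α) ≤ ρ s * (‖q‖ * inner ℝ (u s) (u 0)) := by
      have := (hpos s).le
      gcongr
    nlinarith [Real.sin_sq_add_cos_sq α]
  obtain ⟨S, hS, hφS⟩ : Real.pi ∈ φ '' Icc 0 ℓ :=
    intermediate_value_Icc (by positivity) hsph.continuous_length.continuousOn
      ⟨by linarith, by linarith⟩
  -- As Θ ≥ 2π, the first half-turn ends before the last one begins. Both start on the ray through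
  -- `q` when the second is run backwards, so each has length at least π + 1, and together they use
  -- up the length 2π + 2.
  obtain ⟨S', hS', hφS'⟩ : Θ - Real.pi ∈ φ '' Icc S ℓ :=
    intermediate_value_Icc hS.2 hsph.continuous_length.continuousOn
      ⟨by linarith, by linarith⟩
  obtain ⟨hS1, hS2⟩ := hpolar.half_turn hS.1 hφ0 hφS hq hqlt fun s hs => hdist s _ (by
    have := hsph.cos_le_inner hs.1 (by linarith [hsph.monotone hs.2])
    rwa [hφ0, sub_zero] at this)
  have hpolar' : IsPolarArc (fun s => ρ (ℓ - s)) (fun s => -ρ' (ℓ - s)) (fun s => Θ - φ (ℓ - s))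
      (fun s => k (ℓ - s)) :=
    { hasDerivAt_radius := fun s => (hpolar.hasDerivAt_radius (ℓ - s)).comp_const_sub ℓ s
      hasDerivAt_angle := fun s => by
        simpa using ((hφd (ℓ - s)).comp_const_sub ℓ s).const_sub Θ
      unit_speed := fun s => by rw [neg_sq]; exact hpolar.unit_speed _
      one_le := fun s => hpolar.one_le _
      nonneg := fun s => hpolar.nonneg _ }
  have hρℓ : ρ ℓ = ρ 0 := by simp only [hρ]; rw [← zero_add ℓ, hper]
  have huℓ : u ℓ = u 0 := by simpa using hsph.periodic 0
  obtain ⟨hT1, hT2⟩ := hpolar'.half_turn (S := ℓ - S') (by linarith [hS'.2]) (by simp [hΘ])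
    (by simp [hφS']) hq (by simpa [hρℓ] using hqlt) fun s hs => hdist (ℓ - s) _ (by
      have := hsph.cos_le_inner (s := ℓ - s) (t := ℓ) (by linarith [hs.1])
        (by linarith [hsph.monotone (show S' ≤ ℓ - s by linarith [hs.2])])
      rwa [huℓ, real_inner_comm] at this)
  obtain ⟨hq1, hSe, hH, hkpos⟩ := hS2 (by linarith [hS'.1])
  obtain ⟨-, hTe, hH', hkpos'⟩ := hT2 (by linarith [hS'.1])
  have hSS : S' = S := by linarith
  have hΘe : Θ = 2 * Real.pi := by rw [hSS] at hφS'; linarith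
  have hkall : ∀ s, 0 < k s := by
    have h1 : ∀ s ∈ Icc 0 ℓ, 0 < k s := fun s hs => by
      rcases le_total s S with h2 | h2
      · exact hkpos s ⟨hs.1, h2⟩
      · have := hkpos' (ℓ - s) ⟨by linarith [hs.2], by linarith⟩
        rwa [sub_sub_cancel] at this
    intro s
    have := h1 _ (Ico_subset_Icc_self (by
      simpa using toIcoMod_mem_Ico hsph.pos 0 s : toIcoMod hsph.pos 0 s ∈ Ico 0 ℓ))
    rwa [← self_sub_toIcoDiv_zsmul, hkper.sub_zsmul_eq] at this
  rw [hΘe] at hsph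
  have hcos : ∀ s r, r ∈ Icc s (s + ℓ) → inner ℝ (u r) (u s) = Real.cos (φ r - φ s) :=
    fun s r hr => hsph.inner_eq_cos hkall hullu hr
  obtain ⟨m, hm, hφm⟩ : Real.pi / 2 ∈ φ '' Icc 0 ℓ :=
    intermediate_value_Icc (by positivity) hsph.continuous_length.continuousOn
      ⟨by linarith, by linarith⟩
  have hperp : inner ℝ (u 0) (u m) = 0 := by
    rw [real_inner_comm, hcos 0 m ⟨hm.1, by linarith [hm.2]⟩, hφm, hφ0, sub_zero,
      Real.cos_pi_div_two]
  -- The projection has length 2π and positive speed, so it is a great circle spanned by `u 0` and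
  -- `u m`. The curve is therefore planar, and the developed coordinates are its actual coordinates.
  have hcirc : ∀ r ∈ Icc 0 ℓ, b r = (ρ r * Real.cos (φ r)) • q + (ρ r * Real.sin (φ r)) • u m := by
    intro r hr
    have h1 := eq_of_inner_eq (α := φ r) (hsph.norm_eq r) (hsph.norm_eq 0) (hsph.norm_eq m) hperp
      (by rw [hcos 0 r ⟨hr.1, by linarith [hr.2]⟩, hφ0, sub_zero]) (by
        rw [← Real.cos_sub_pi_div_two, ← hφm]
        rcases le_total m r with h2 | h2
        · exact hcos m r ⟨h2, by linarith [hr.2, hm.1]⟩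
        · rw [real_inner_comm, hcos r m ⟨h2, by linarith [hr.1, hm.2]⟩, ← Real.cos_neg, neg_sub])
    rw [hbu r, h1, smul_add, smul_smul (ρ r) _ (u 0), smul_smul (ρ r) _ (u m), hqu, hq1,
      one_smul]
  have hfirst : ∀ s ∈ Icc 0 (Real.pi / 2), b s = (1 + Real.cos s) • q + Real.sin s • u m :=
    fun s hs => by
      rw [hcirc s ⟨hs.1, by linarith [hs.2]⟩, hH.first_x s hs, hH.first_y s hs]
  have hb'0 : b' 0 = u m := by
    have h1 : HasDerivAt (fun s => (1 + Real.cos s) • q + Real.sin s • u m) (u m) 0 := by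
      refine ((((Real.hasDerivAt_cos 0).const_add 1).smul_const q).add
        ((Real.hasDerivAt_sin 0).smul_const (u m))).congr_deriv ?_
      simp
    have h2 : (0 : ℝ) ∈ Icc 0 (Real.pi / 2) := ⟨le_rfl, by positivity⟩
    exact (uniqueDiffOn_Icc (by positivity) 0 h2).eq_deriv _ (hd 0).hasDerivWithinAt
      (h1.hasDerivWithinAt.congr hfirst (hfirst 0 h2))
  rw [hb'0]
  refine ⟨hq1, ?_, ?_, ?_, ?_, ?_, ?_⟩
  · rw [hqu, inner_smul_left, hperp, mul_zero]
  · rw [hfirst 0 ⟨le_rfl, by positivity⟩, Real.cos_zero, Real.sin_zero]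
    module
  · rw [hfirst _ ⟨by positivity, le_rfl⟩, Real.cos_pi_div_two, Real.sin_pi_div_two]
    module
  · rw [hcirc _ ⟨by positivity, by linarith⟩, hH.second_x _ ⟨by linarith, le_rfl⟩,
      hH.second_y _ ⟨by linarith, le_rfl⟩]
    module
  · rw [hcirc _ ⟨by positivity, by linarith⟩, hH.third_x _ ⟨by linarith, le_rfl⟩,
      hH.third_y _ ⟨by linarith, le_rfl⟩, add_sub_cancel_right, Real.cos_pi, Real.sin_pi]
    module
  · have h1 := hH'.first_x (Real.pi / 2) ⟨by positivity, le_rfl⟩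
    have h2 := hH'.first_y (Real.pi / 2) ⟨by positivity, le_rfl⟩
    rw [hΘe, Real.cos_two_pi_sub, Real.cos_pi_div_two] at h1
    rw [hΘe, Real.sin_two_pi_sub, Real.sin_pi_div_two] at h2
    rw [hcirc _ ⟨by linarith, by linarith⟩, h1,
      show ρ (ℓ - Real.pi / 2) * Real.sin (φ (ℓ - Real.pi / 2)) = -1 by linarith]
    module

end Rigidity

/-! ### Stability of transversal crossings -/

section Crossing

/-- An intermediate value theorem for a pair of functions on a rectangle, the first of which is
strictly decreasing in the second variable. -/
theorem exists_zero_of_strictAntiOn {F₁ F₂ : ℝ × ℝ → ℝ} {a b c d : ℝ} (hab : a ≤ b)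
    (hcd : c ≤ d) (h1 : Continuous F₁) (h2 : Continuous F₂) (hc : ∀ v ∈ Icc a b, 0 < F₁ (v, c))
    (hd : ∀ v ∈ Icc a b, F₁ (v, d) < 0)
    (hanti : ∀ v ∈ Icc a b, StrictAntiOn (fun s => F₁ (v, s)) (Icc c d))
    (ha : ∀ s ∈ Icc c d, F₂ (a, s) < 0) (hb : ∀ s ∈ Icc c d, 0 < F₂ (b, s)) :
    ∃ v ∈ Icc a b, ∃ s ∈ Icc c d, F₁ (v, s) = 0 ∧ F₂ (v, s) = 0 := by
  have hR : IsCompact (Icc a b ×ˢ Icc c d) := isCompact_Icc.prod isCompact_Icc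
  have hex : ∀ v ∈ Icc a b, ∃ s ∈ Icc c d, F₁ (v, s) = 0 := fun v hv =>
    intermediate_value_Icc' hcd (f := fun s => F₁ (v, s))
      (by fun_prop) ⟨(hd v hv).le, (hc v hv).le⟩
  -- The parameters `v` whose zero of `F₁` has `F₂ ≤ 0`, and those with `F₂ ≥ 0`, form closed sets
  -- covering the interval, so they share a point. Monotonicity makes the zero over this point
  -- unique, hence `F₂` vanishes there.
  have hclosed : ∀ I : Set ℝ, IsClosed I →
      IsClosed (Prod.fst '' ((Icc a b ×ˢ Icc c d) ∩ (F₁ ⁻¹' {0} ∩ F₂ ⁻¹' I))) := fun I hI =>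
    ((hR.inter_right ((isClosed_singleton.preimage h1).inter (hI.preimage h2))).image
      continuous_fst).isClosed
  obtain ⟨v, hv, ⟨⟨v', s⟩, ⟨hR1, hz1, hle⟩, rfl⟩, ⟨⟨v'', s'⟩, ⟨hR2, hz2, hge⟩, hvv⟩⟩ :=
    isPreconnected_closed_iff.1 (isPreconnected_Icc (a := a) (b := b)) _ _ (hclosed _ isClosed_Iic)
      (hclosed _ isClosed_Ici)
      (fun v hv => by
        obtain ⟨s, hs, hz⟩ := hex v hv
        rcases le_total (F₂ (v, s)) 0 with h | h
        · exact Or.inl ⟨(v, s), ⟨⟨hv, hs⟩, hz, h⟩, rfl⟩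
        · exact Or.inr ⟨(v, s), ⟨⟨hv, hs⟩, hz, h⟩, rfl⟩)
      (by
        obtain ⟨s, hs, hz⟩ := hex a (left_mem_Icc.2 hab)
        exact ⟨a, left_mem_Icc.2 hab, (a, s), ⟨⟨left_mem_Icc.2 hab, hs⟩, hz, (ha s hs).le⟩, rfl⟩)
      (by
        obtain ⟨s, hs, hz⟩ := hex b (right_mem_Icc.2 hab)
        exact ⟨b, right_mem_Icc.2 hab, (b, s), ⟨⟨right_mem_Icc.2 hab, hs⟩, hz, (hb s hs).le⟩, rfl⟩)
  simp only at hvv hv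
  subst hvv
  have hss : s' = s := (hanti _ hv).injOn hR2.2 hR1.2 (hz2.trans hz1.symm)
  subst hss
  exact ⟨v'', hv, s', hR1.2, hz1, le_antisymm hle hge⟩

/-- An orthonormal triple of vectors of `ℝ³`. -/
structure IsFrame (e f n : E3) : Prop where
  norm_e : ‖e‖ = 1
  norm_f : ‖f‖ = 1
  norm_n : ‖n‖ = 1
  inner_ef : inner ℝ e f = 0
  inner_en : inner ℝ e n = 0
  inner_fn : inner ℝ f n = 0

theorem IsFrame.ext_inner {e f n : E3} (h : IsFrame e f n) {x y : E3}
    (he : inner ℝ e x = inner ℝ e y) (hf : inner ℝ f x = inner ℝ f y)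
    (hn : inner ℝ n x = inner ℝ n y) : x = y := by
  have ho : Orthonormal ℝ ![e, f, n] := by
    rw [orthonormal_iff_ite]
    intro i j
    fin_cases i <;> fin_cases j <;>
      simp [h.norm_e, h.norm_f, h.norm_n, h.inner_ef, h.inner_en, h.inner_fn,
        real_inner_comm e f, real_inner_comm e n, real_inner_comm f n]
  refine InnerProductSpace.ext_inner_left_basis
    (basisOfOrthonormalOfCardEqFinrank ho (by simp)) fun i => ?_
  rw [coe_basisOfOrthonormalOfCardEqFinrank]
  fin_cases i
  exacts [he, hf, hn]

variable {T : Type*} [TopologicalSpace T] {G B : T → ℝ → E3} {t₀ : T} {e f n : E3}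

/-- A strand that crosses a triangle with vertices on a second curve transversally keeps meeting
the convex hull of the second curve under small deformations. -/
theorem eventually_exists_crossing_hull (hF : IsFrame e f n)
    (hG : Continuous fun p : T × ℝ => G p.1 p.2) (hB : Continuous fun p : T × ℝ => B p.1 p.2)
    {u₀ s₁ s₂ s₃ : ℝ} (hn : HasDerivAt (G t₀) n u₀) (h1 : B t₀ s₁ = G t₀ u₀ - e)
    (h2 : B t₀ s₂ = G t₀ u₀ + e + f) (h3 : B t₀ s₃ = G t₀ u₀ + e - f) {ε : ℝ} (hε : 0 < ε) :
    ∀ᶠ t in 𝓝 t₀, ∃ u, |u - u₀| < ε ∧ ∀ N, ∃ s, inner ℝ (B t s - G t u) N ≤ 0 := by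
  obtain ⟨a, ha⟩ : ∃ a : E3 → T → ℝ, ∀ w t, a w t = inner ℝ w (B t s₂ - B t s₁) :=
    ⟨_, fun _ _ => rfl⟩
  obtain ⟨b, hb⟩ : ∃ b : E3 → T → ℝ, ∀ w t, b w t = inner ℝ w (B t s₃ - B t s₁) :=
    ⟨_, fun _ _ => rfl⟩
  obtain ⟨x, hx⟩ : ∃ x : E3 → T → ℝ → ℝ, ∀ w t u, x w t u = inner ℝ w (G t u - B t s₁) :=
    ⟨_, fun _ _ _ => rfl⟩
  have hBc : ∀ s, Continuous fun t => B t s := fun s =>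
    hB.comp (f := fun t => (t, s)) (by fun_prop)
  have hac : ∀ w, Continuous fun z : T × ℝ => a w z.1 := fun w => by
    have := hBc s₁; have := hBc s₂; simp only [ha]; fun_prop
  have hbc : ∀ w, Continuous fun z : T × ℝ => b w z.1 := fun w => by
    have := hBc s₁; have := hBc s₃; simp only [hb]; fun_prop
  have hxc : ∀ w, Continuous fun z : T × ℝ => x w z.1 z.2 := fun w => by
    have := hBc s₁; simp only [hx]; fun_prop
  -- Cramer's rule in the `e` and `f` coordinates: α/D and β/D are the coordinates of the strand
  -- point relative to two sides of the triangle, and ζ/D is its remaining offset from the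
  -- triangle's plane along `n`. At the start the barycentric weights are 1/2, 1/4, 1/4.
  obtain ⟨D, hD⟩ : ∃ D : T × ℝ → ℝ, ∀ z, D z = a e z.1 * b f z.1 - a f z.1 * b e z.1 :=
    ⟨_, fun _ => rfl⟩
  obtain ⟨α, hα⟩ : ∃ α : T × ℝ → ℝ, ∀ z, α z = x e z.1 z.2 * b f z.1 - x f z.1 z.2 * b e z.1 :=
    ⟨_, fun _ => rfl⟩
  obtain ⟨β, hβ⟩ : ∃ β : T × ℝ → ℝ, ∀ z, β z = a e z.1 * x f z.1 z.2 - a f z.1 * x e z.1 z.2 :=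
    ⟨_, fun _ => rfl⟩
  obtain ⟨ζ, hζ⟩ : ∃ ζ : T × ℝ → ℝ,
      ∀ z, ζ z = D z * x n z.1 z.2 - α z * a n z.1 - β z * b n z.1 := ⟨_, fun _ => rfl⟩
  have hDc : Continuous D := by
    rw [funext hD]; exact ((hac e).mul (hbc f)).sub ((hac f).mul (hbc e))
  have hαc : Continuous α := by
    rw [funext hα]; exact ((hxc e).mul (hbc f)).sub ((hxc f).mul (hbc e))
  have hβc : Continuous β := by
    rw [funext hβ]; exact ((hac e).mul (hxc f)).sub ((hac f).mul (hxc e))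
  have hζc : Continuous ζ := by
    rw [funext hζ]
    exact ((hDc.mul (hxc n)).sub (hαc.mul (hac n))).sub (hβc.mul (hbc n))
  have ea : B t₀ s₂ - B t₀ s₁ = e + e + f := by rw [h1, h2]; abel
  have eb : B t₀ s₃ - B t₀ s₁ = e + e - f := by rw [h1, h3]; abel
  have ex : G t₀ u₀ - B t₀ s₁ = e := by rw [h1]; abel
  have hfe : inner ℝ f e = 0 := by rw [real_inner_comm]; exact hF.inner_ef
  have hne : inner ℝ n e = 0 := by rw [real_inner_comm]; exact hF.inner_en
  have hnf : inner ℝ n f = 0 := by rw [real_inner_comm]; exact hF.inner_fn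
  have hee : inner ℝ e e = (1 : ℝ) := by rw [real_inner_self_eq_norm_sq, hF.norm_e, one_pow]
  have hff : inner ℝ f f = (1 : ℝ) := by rw [real_inner_self_eq_norm_sq, hF.norm_f, one_pow]
  have hnn : inner ℝ n n = (1 : ℝ) := by rw [real_inner_self_eq_norm_sq, hF.norm_n, one_pow]
  have aE : a e t₀ = 2 := by
    rw [ha, ea, inner_add_right, inner_add_right, hee, hF.inner_ef]; norm_num
  have aF : a f t₀ = 1 := by
    rw [ha, ea, inner_add_right, inner_add_right, hfe, hff]; norm_num
  have va : a n t₀ = 0 := by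
    rw [ha, ea, inner_add_right, inner_add_right, hne, hnf]; norm_num
  have bE : b e t₀ = 2 := by
    rw [hb, eb, inner_sub_right, inner_add_right, hee, hF.inner_ef]; norm_num
  have bF : b f t₀ = -1 := by
    rw [hb, eb, inner_sub_right, inner_add_right, hfe, hff]; norm_num
  have vb : b n t₀ = 0 := by
    rw [hb, eb, inner_sub_right, inner_add_right, hne, hnf]; norm_num
  have xE : x e t₀ u₀ = 1 := by rw [hx, ex, hee]
  have xF : x f t₀ u₀ = 0 := by rw [hx, ex, hfe]
  have vD : ∀ u, D (t₀, u) = -4 := fun u => by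
    simp only [hD, aE, aF, bE, bF]; norm_num
  have vα : α (t₀, u₀) = -1 := by
    simp only [hα, xE, xF, bE, bF]; norm_num
  have vβ : β (t₀, u₀) = -1 := by
    simp only [hβ, xE, xF, aE, aF]; norm_num
  have vζ : ∀ u, ζ (t₀, u) = -4 * x n t₀ u := fun u => by
    simp only [hζ, vD, va, vb]; ring
  have hev : ∀ᶠ z : T × ℝ in 𝓝 (t₀, u₀), α z < 0 ∧ β z < 0 ∧ D z - α z - β z < 0 :=
    (hαc.continuousAt.eventually_lt continuousAt_const (by rw [vα]; norm_num)).and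
      ((hβc.continuousAt.eventually_lt continuousAt_const (by rw [vβ]; norm_num)).and
        (((hDc.sub hαc).sub hβc).continuousAt.eventually_lt continuousAt_const
          (by simp only [Pi.sub_apply, vα, vβ, vD]; norm_num)))
  rw [nhds_prod_eq, eventually_prod_iff] at hev
  obtain ⟨pa, hpa, pb, hpb, hab⟩ := hev
  obtain ⟨δ, hδ, hball⟩ := Metric.eventually_nhds_iff_ball.1 hpb
  -- The strand crosses the plane of the triangle with speed 1, so ζ has opposite strict signs at
  -- `u₀ - h` and `u₀ + h`. Both signs survive small changes of `t`, and the intermediate value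
  -- theorem gives a crossing.
  have hxd : HasDerivAt (fun u => x n t₀ u) 1 u₀ := by
    have := (hasDerivAt_const u₀ n).inner ℝ (hn.sub_const (B t₀ s₁))
    rw [inner_zero_left, add_zero, hnn] at this
    exact this.congr_of_eventuallyEq (Eventually.of_forall fun u => hx n t₀ u)
  have hx0 : x n t₀ u₀ = 0 := by rw [hx, ex, hne]
  have hlin := hxd.isLittleO.def (c := 1 / 2) (by norm_num)
  obtain ⟨δ', hδ', hball'⟩ := Metric.eventually_nhds_iff_ball.1 hlin
  obtain ⟨h, hh0, hh⟩ : ∃ h, 0 < h ∧ h < min ε (min δ δ') := exists_between (by positivity)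
  obtain ⟨hh1, hh2, hh3⟩ : h < ε ∧ h < δ ∧ h < δ' := by simpa using hh
  have hplus := hball' (u₀ + h) (by simpa [abs_of_pos hh0] using hh3)
  have hminus := hball' (u₀ - h) (by simpa [abs_of_pos hh0] using hh3)
  simp only [hx0, sub_zero, add_sub_cancel_left, smul_eq_mul, mul_one, sub_sub_cancel_left,
    Real.norm_eq_abs, abs_neg, abs_of_pos hh0, abs_le] at hplus hminus
  have hζp : ∀ᶠ t in 𝓝 t₀, ζ (t, u₀ + h) < 0 :=
    (hζc.comp (Continuous.prodMk_left (u₀ + h))).continuousAt.eventually_lt continuousAt_const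
      (by rw [Function.comp_apply, vζ]; linarith)
  have hζm : ∀ᶠ t in 𝓝 t₀, 0 < ζ (t, u₀ - h) :=
    continuousAt_const.eventually_lt (hζc.comp (Continuous.prodMk_left (u₀ - h))).continuousAt
      (by rw [vζ]; linarith)
  filter_upwards [hpa, hζp, hζm] with t ht htp htm
  obtain ⟨u, hu, hζu⟩ := intermediate_value_Icc' (by linarith : u₀ - h ≤ u₀ + h)
    (f := fun u => ζ (t, u)) (hζc.comp (Continuous.prodMk_right t)).continuousOn ⟨htp.le, htm.le⟩
  have huh : |u - u₀| ≤ h := abs_le.2 ⟨by linarith [hu.1], by linarith [hu.2]⟩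
  refine ⟨u, huh.trans_lt hh1, fun N => ?_⟩
  obtain ⟨cα, cβ, cD⟩ := hab ht (hball u (by
    rw [Metric.mem_ball, Real.dist_eq]; exact huh.trans_lt hh2))
  have hcomb : D (t, u) • (G t u - B t s₁) =
      α (t, u) • (B t s₂ - B t s₁) + β (t, u) • (B t s₃ - B t s₁) := by
    refine hF.ext_inner ?_ ?_ ?_
    · rw [inner_add_right, inner_smul_right, inner_smul_right, inner_smul_right,
        ← hx, ← ha, ← hb]
      simp only [hD, hα, hβ]; ring
    · rw [inner_add_right, inner_smul_right, inner_smul_right, inner_smul_right,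
        ← hx, ← ha, ← hb]
      simp only [hD, hα, hβ]; ring
    · rw [inner_add_right, inner_smul_right, inner_smul_right, inner_smul_right,
        ← hx, ← ha, ← hb]
      simp only [hζ] at hζu
      linarith
  -- The vectors from the strand point to the three vertices have a vanishing combination with
  -- weights α, β and D - α - β, all negative. They cannot all have positive inner product with `N`.
  by_contra! hpos
  have p1 := hpos s₁
  have p2 := hpos s₂
  have p3 := hpos s₃
  have key := congrArg (fun v => inner ℝ v N) hcomb
  simp only [inner_add_left, inner_smul_left, inner_sub_left, conj_trivial] at key p1 p2 p3
  nlinarith [mul_pos (neg_pos.2 cD) p1, mul_pos (neg_pos.2 cα) p2, mul_pos (neg_pos.2 cβ) p3]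

/-- The sign estimate on the sides of a box of half-width `h`: a coordinate that vanishes to first
order is at most h/10, one of slope ±1 is at least 9h/10, and the `e` coordinates stay within 1/2 of
the values 1 and 2. -/
theorem mul_lt_mul_of_abs_le {x y z w h : ℝ} (hx : |x| ≤ h / 10) (hy0 : 0 ≤ y)
    (hy : y ≤ 5 / 2) (hz : 9 / 10 * h ≤ z) (hw : 1 / 2 < w) (hh : 0 < h) :
    x * y < z * w := by
  have h1 : x * y ≤ h / 10 * y := mul_le_mul_of_nonneg_right (le_of_abs_le hx) hy0
  have h2 : 9 / 10 * h * w ≤ z * w := mul_le_mul_of_nonneg_right hz (by linarith)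
  nlinarith

/-- A strand that crosses the cone over a second curve from a point of the first one transversally
keeps doing so under small deformations. -/
theorem eventually_exists_crossing_cone (hF : IsFrame e f n)
    (hG : Continuous fun p : T × ℝ => G p.1 p.2) (hB : Continuous fun p : T × ℝ => B p.1 p.2)
    (hB' : Continuous fun p : T × ℝ => deriv (B p.1) p.2)
    (hBd : ∀ t s, HasDerivAt (B t) (deriv (B t) s) s)
    {u₀ v₀ s₀ : ℝ} (hv : G t₀ v₀ = G t₀ u₀ + e) (hs : B t₀ s₀ = G t₀ u₀ + e + e)
    (hn : HasDerivAt (G t₀) n v₀) (hf : deriv (B t₀) s₀ = f) {ε : ℝ} (hε : 0 < ε) :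
    ∀ᶠ z : T × ℝ in 𝓝 (t₀, u₀), ∃ v s, |v - v₀| < ε ∧
      ∃ c ∈ Icc (0 : ℝ) 1, G z.1 v - G z.1 z.2 = c • (B z.1 s - G z.1 z.2) := by
  obtain ⟨g, hg⟩ : ∃ g : E3 → T × ℝ → ℝ → ℝ,
      ∀ w z v, g w z v = inner ℝ w (G z.1 v - G z.1 z.2) := ⟨_, fun _ _ _ => rfl⟩
  obtain ⟨b, hb⟩ : ∃ b : E3 → T × ℝ → ℝ → ℝ,
      ∀ w z s, b w z s = inner ℝ w (B z.1 s - G z.1 z.2) := ⟨_, fun _ _ _ => rfl⟩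
  obtain ⟨b', hb'⟩ : ∃ b' : E3 → T × ℝ → ℝ → ℝ,
      ∀ w z s, b' w z s = inner ℝ w (deriv (B z.1) s) := ⟨_, fun _ _ _ => rfl⟩
  have hGz : Continuous fun q : (T × ℝ) × ℝ × ℝ => G q.1.1 q.1.2 :=
    hG.comp (f := fun q : (T × ℝ) × ℝ × ℝ => (q.1.1, q.1.2)) (by fun_prop)
  have hgc : ∀ w, Continuous fun q : (T × ℝ) × ℝ × ℝ => g w q.1 q.2.1 := fun w => by
    simp only [hg]
    exact continuous_const.inner ((hG.comp (f := fun q : (T × ℝ) × ℝ × ℝ => (q.1.1, q.2.1))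
      (by fun_prop)).sub hGz)
  have hbc : ∀ w, Continuous fun q : (T × ℝ) × ℝ × ℝ => b w q.1 q.2.2 := fun w => by
    simp only [hb]
    exact continuous_const.inner ((hB.comp (f := fun q : (T × ℝ) × ℝ × ℝ => (q.1.1, q.2.2))
      (by fun_prop)).sub hGz)
  have hb'c : ∀ w, Continuous fun q : (T × ℝ) × ℝ × ℝ => b' w q.1 q.2.2 := fun w => by
    simp only [hb']
    exact continuous_const.inner (hB'.comp (f := fun q : (T × ℝ) × ℝ × ℝ => (q.1.1, q.2.2))
      (by fun_prop))
  have hbd : ∀ w z s, HasDerivAt (b w z) (b' w z s) s := fun w z s => by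
    have := (hasDerivAt_const s w).inner ℝ ((hBd z.1 s).sub_const (G z.1 z.2))
    rw [inner_zero_left, add_zero, ← hb'] at this
    exact this.congr_of_eventuallyEq (Eventually.of_forall fun s => hb w z s)
  -- Both curves are projected centrally from the apex `G z.1 z.2` along `e`. The functions `F₁` and
  -- `F₂` are the cross-multiplied differences of the projections in the directions `f` and `n`. The
  -- function `F'` is the derivative of `F₁` in `s`; it is -1 at the centre because the second curve
  -- moves along `f`.
  obtain ⟨F₁, hF₁⟩ : ∃ F₁ : (T × ℝ) × ℝ × ℝ → ℝ, ∀ z v s,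
      F₁ (z, v, s) = g f z v * b e z s - b f z s * g e z v :=
    ⟨fun q => g f q.1 q.2.1 * b e q.1 q.2.2 - b f q.1 q.2.2 * g e q.1 q.2.1, fun _ _ _ => rfl⟩
  obtain ⟨F₂, hF₂⟩ : ∃ F₂ : (T × ℝ) × ℝ × ℝ → ℝ, ∀ z v s,
      F₂ (z, v, s) = g n z v * b e z s - b n z s * g e z v :=
    ⟨fun q => g n q.1 q.2.1 * b e q.1 q.2.2 - b n q.1 q.2.2 * g e q.1 q.2.1, fun _ _ _ => rfl⟩
  obtain ⟨F', hF'⟩ : ∃ F' : (T × ℝ) × ℝ × ℝ → ℝ, ∀ z v s,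
      F' (z, v, s) = g f z v * b' e z s - b' f z s * g e z v :=
    ⟨fun q => g f q.1 q.2.1 * b' e q.1 q.2.2 - b' f q.1 q.2.2 * g e q.1 q.2.1, fun _ _ _ => rfl⟩
  have hF₁c : Continuous F₁ :=
    (((hgc f).mul (hbc e)).sub ((hbc f).mul (hgc e))).congr fun q => (hF₁ q.1 q.2.1 q.2.2).symm
  have hF₂c : Continuous F₂ :=
    (((hgc n).mul (hbc e)).sub ((hbc n).mul (hgc e))).congr fun q => (hF₂ q.1 q.2.1 q.2.2).symm
  have hF'c : Continuous F' :=
    (((hgc f).mul (hb'c e)).sub ((hb'c f).mul (hgc e))).congr fun q =>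
      (hF' q.1 q.2.1 q.2.2).symm
  have eg : G t₀ v₀ - G t₀ u₀ = e := by rw [hv]; abel
  have eb : B t₀ s₀ - G t₀ u₀ = e + e := by rw [hs]; abel
  have hfe : inner ℝ f e = 0 := by rw [real_inner_comm]; exact hF.inner_ef
  have hne : inner ℝ n e = 0 := by rw [real_inner_comm]; exact hF.inner_en
  have hnf : inner ℝ n f = 0 := by rw [real_inner_comm]; exact hF.inner_fn
  have hee : inner ℝ e e = (1 : ℝ) := by rw [real_inner_self_eq_norm_sq, hF.norm_e, one_pow]
  have hff : inner ℝ f f = (1 : ℝ) := by rw [real_inner_self_eq_norm_sq, hF.norm_f, one_pow]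
  have hnn : inner ℝ n n = (1 : ℝ) := by rw [real_inner_self_eq_norm_sq, hF.norm_n, one_pow]
  obtain ⟨z₀, hz₀⟩ : ∃ z : T × ℝ, z = (t₀, u₀) := ⟨_, rfl⟩
  rw [← hz₀]
  have gE : g e z₀ v₀ = 1 := by simp only [hg, hz₀, eg, hee]
  have gF : g f z₀ v₀ = 0 := by simp only [hg, hz₀, eg, hfe]
  have gN : g n z₀ v₀ = 0 := by simp only [hg, hz₀, eg, hne]
  have bE : b e z₀ s₀ = 2 := by simp only [hb, hz₀, eb, inner_add_right, hee]; norm_num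
  have bF : b f z₀ s₀ = 0 := by simp only [hb, hz₀, eb, inner_add_right, hfe]; norm_num
  have bN : b n z₀ s₀ = 0 := by simp only [hb, hz₀, eb, inner_add_right, hne]; norm_num
  have b'F : b' f z₀ s₀ = 1 := by simp only [hb', hz₀, hf, hff]
  have hgd : ∀ w, HasDerivAt (g w z₀) (inner ℝ w n) v₀ := fun w => by
    have := (hasDerivAt_const v₀ w).inner ℝ (hn.sub_const (G t₀ u₀))
    rw [inner_zero_left, add_zero] at this
    exact this.congr_of_eventuallyEq (Eventually.of_forall fun v => by rw [hg, hz₀])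
  have hbd0 : ∀ w, HasDerivAt (b w z₀) (inner ℝ w f) s₀ := fun w => by
    have := hbd w z₀ s₀
    rwa [hb', hz₀, hf, ← hz₀] at this
  have lin : ∀ {y : ℝ → ℝ} {y' x₀ : ℝ}, HasDerivAt y y' x₀ → ∀ᶠ x in 𝓝 x₀,
      |y x - y x₀ - (x - x₀) * y'| ≤ 1 / 10 * |x - x₀| := fun hy => by
    simpa using hy.isLittleO.def (c := 1 / 10) (by norm_num)
  have hgcv : ∀ w, Continuous (g w z₀) := fun w =>
    (hgc w).comp (f := fun v : ℝ => (z₀, v, (0 : ℝ))) (by fun_prop)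
  have hbcs : ∀ w, Continuous (b w z₀) := fun w =>
    continuous_iff_continuousAt.2 fun s => (hbd w z₀ s).continuousAt
  have near : ∀ {y : ℝ → ℝ} {c x₀ : ℝ}, Continuous y → y x₀ = c → ∀ᶠ x in 𝓝 x₀,
      |y x - c| < 1 / 2 := fun {y c x₀} hy h => by
    have := (hy.tendsto x₀).eventually (Metric.ball_mem_nhds (y x₀) (by norm_num : (0 : ℝ) < 1 / 2))
    rw [h] at this
    simpa only [Metric.mem_ball, Real.dist_eq] using this
  obtain ⟨δ₁, hδ₁, hv₁⟩ := Metric.eventually_nhds_iff_ball.1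
    ((lin (hgd f)).and ((lin (hgd n)).and (near (hgcv e) gE)))
  obtain ⟨δ₂, hδ₂, hs₁⟩ := Metric.eventually_nhds_iff_ball.1
    ((lin (hbd0 f)).and ((lin (hbd0 n)).and (near (hbcs e) bE)))
  simp only [gF, gN, hF.inner_fn, hnn, mul_zero, mul_one, sub_zero, Metric.mem_ball,
    Real.dist_eq] at hv₁
  simp only [bF, bN, hff, hnf, mul_zero, mul_one, sub_zero, Metric.mem_ball,
    Real.dist_eq] at hs₁
  have hopen : ∀ᶠ q : (T × ℝ) × ℝ × ℝ in 𝓝 (z₀, v₀, s₀),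
      F' q < 0 ∧ 0 < g e q.1 q.2.1 ∧ g e q.1 q.2.1 < b e q.1 q.2.2 :=
    (hF'c.continuousAt.eventually_lt continuousAt_const (by
      simp only [hF', gF, gE, b'F]; norm_num)).and
      ((continuousAt_const.eventually_lt (hgc e).continuousAt (by simp only [gE]; norm_num)).and
        ((hgc e).continuousAt.eventually_lt (hbc e).continuousAt
          (by simp only [gE, bE]; norm_num)))
  rw [nhds_prod_eq, eventually_prod_iff] at hopen
  obtain ⟨pa, hpa, pb, hpb, hab⟩ := hopen
  obtain ⟨δ₃, hδ₃, hbox⟩ := Metric.eventually_nhds_iff_ball.1 hpb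
  obtain ⟨h, hh0, hh⟩ : ∃ h, 0 < h ∧ h < min (min ε δ₃) (min δ₁ δ₂) := exists_between (by positivity)
  obtain ⟨⟨hhε, hh3⟩, hh1, hh2⟩ : (h < ε ∧ h < δ₃) ∧ h < δ₁ ∧ h < δ₂ := by simpa using hh
  have habs : ∀ {y y₀ : ℝ}, y ∈ Icc (y₀ - h) (y₀ + h) → |y - y₀| ≤ h := fun hy =>
    abs_le.2 ⟨by linarith [hy.1], by linarith [hy.2]⟩
  have hmemp : ∀ {y₀ : ℝ}, y₀ + h ∈ Icc (y₀ - h) (y₀ + h) := ⟨by linarith, le_rfl⟩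
  have hmemm : ∀ {y₀ : ℝ}, y₀ - h ∈ Icc (y₀ - h) (y₀ + h) := ⟨le_rfl, by linarith⟩
  have B1 : ∀ v ∈ Icc (v₀ - h) (v₀ + h), F₁ (z₀, v, s₀ + h) < 0 ∧ 0 < F₁ (z₀, v, s₀ - h) := by
    intro v hv
    obtain ⟨a1, -, a3⟩ := hv₁ v ((habs hv).trans_lt hh1)
    obtain ⟨c1, -, c3⟩ := hs₁ (s₀ + h) ((habs hmemp).trans_lt hh2)
    obtain ⟨d1, -, d3⟩ := hs₁ (s₀ - h) ((habs hmemm).trans_lt hh2)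
    have a1' := a1.trans (mul_le_mul_of_nonneg_left (habs hv) (by norm_num))
    simp only [add_sub_cancel_left, sub_sub_cancel_left, abs_neg, abs_of_pos hh0, abs_le,
      abs_lt] at a1' a3 c1 c3 d1 d3
    constructor
    · rw [hF₁]
      exact sub_neg.2 (mul_lt_mul_of_abs_le (abs_le.2 ⟨by linarith, by linarith⟩)
        (by linarith) (by linarith) (by linarith) (by linarith) hh0)
    · have := mul_lt_mul_of_abs_le (x := -g f z₀ v) (y := b e z₀ (s₀ - h))
        (z := -b f z₀ (s₀ - h)) (w := g e z₀ v) (h := h) (abs_le.2 ⟨by linarith, by linarith⟩)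
        (by linarith) (by linarith) (by linarith) (by linarith) hh0
      rw [hF₁]
      exact sub_pos.2 (by linarith)
  have B2 : ∀ s ∈ Icc (s₀ - h) (s₀ + h), F₂ (z₀, v₀ - h, s) < 0 ∧ 0 < F₂ (z₀, v₀ + h, s) := by
    intro s hs
    obtain ⟨-, a1, a3⟩ := hs₁ s ((habs hs).trans_lt hh2)
    obtain ⟨-, c1, c3⟩ := hv₁ (v₀ + h) ((habs hmemp).trans_lt hh1)
    obtain ⟨-, d1, d3⟩ := hv₁ (v₀ - h) ((habs hmemm).trans_lt hh1)
    have a1' := a1.trans (mul_le_mul_of_nonneg_left (habs hs) (by norm_num))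
    simp only [add_sub_cancel_left, sub_sub_cancel_left, abs_neg, abs_of_pos hh0, abs_le,
      abs_lt] at a1' a3 c1 c3 d1 d3
    constructor
    · have := mul_lt_mul_of_abs_le (x := -b n z₀ s) (y := g e z₀ (v₀ - h))
        (z := -g n z₀ (v₀ - h)) (w := b e z₀ s) (h := h) (abs_le.2 ⟨by linarith, by linarith⟩)
        (by linarith) (by linarith) (by linarith) (by linarith) hh0
      rw [hF₂]
      exact sub_neg.2 (by linarith)
    · rw [hF₂]
      exact sub_pos.2 (mul_lt_mul_of_abs_le (abs_le.2 ⟨by linarith, by linarith⟩)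
        (by linarith) (by linarith) (by linarith) (by linarith) hh0)
  have hcp : ∀ s : ℝ, Continuous fun q : (T × ℝ) × ℝ => F₁ (q.1, q.2, s) := fun s =>
    hF₁c.comp (f := fun q : (T × ℝ) × ℝ => (q.1, q.2, s)) (by fun_prop)
  have hcv : ∀ v : ℝ, Continuous fun q : (T × ℝ) × ℝ => F₂ (q.1, v, q.2) := fun v =>
    hF₂c.comp (f := fun q : (T × ℝ) × ℝ => (q.1, v, q.2)) (by fun_prop)
  -- The strict signs on the compact sides of the box persist for all nearby times and apexes.
  have E1 := isCompact_Icc.eventually_forall_of_forall_eventually (x₀ := z₀)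
    (P := fun z v => F₁ (z, v, s₀ + h) < 0 ∧ 0 < F₁ (z, v, s₀ - h)) fun v hv =>
      ((hcp (s₀ + h)).continuousAt.eventually_lt continuousAt_const (B1 v hv).1).and
        (continuousAt_const.eventually_lt (hcp (s₀ - h)).continuousAt (B1 v hv).2)
  have E2 := isCompact_Icc.eventually_forall_of_forall_eventually (x₀ := z₀)
    (P := fun z s => F₂ (z, v₀ - h, s) < 0 ∧ 0 < F₂ (z, v₀ + h, s)) fun s hs =>
      ((hcv (v₀ - h)).continuousAt.eventually_lt continuousAt_const (B2 s hs).1).and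
        (continuousAt_const.eventually_lt (hcv (v₀ + h)).continuousAt (B2 s hs).2)
  filter_upwards [hpa, E1, E2] with z hz hz1 hz2
  have hin : ∀ v ∈ Icc (v₀ - h) (v₀ + h), ∀ s ∈ Icc (s₀ - h) (s₀ + h),
      F' (z, v, s) < 0 ∧ 0 < g e z v ∧ g e z v < b e z s := fun v hv s hs =>
    hab hz (hbox (v, s) (by
      rw [Metric.mem_ball, Prod.dist_eq, Real.dist_eq, Real.dist_eq]
      exact max_lt ((habs hv).trans_lt hh3) ((habs hs).trans_lt hh3)))
  obtain ⟨v, hv, s, hs, hz1, hz2⟩ := exists_zero_of_strictAntiOn (F₁ := fun q => F₁ (z, q))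
    (F₂ := fun q => F₂ (z, q)) (by linarith : v₀ - h ≤ v₀ + h) (by linarith : s₀ - h ≤ s₀ + h)
    (hF₁c.comp (Continuous.prodMk_right z)) (hF₂c.comp (Continuous.prodMk_right z))
    (fun v hv => (hz1 v hv).2) (fun v hv => (hz1 v hv).1)
    (fun v hv => by
      have hd : ∀ s, HasDerivAt (fun s => F₁ (z, v, s)) (F' (z, v, s)) s := fun s => by
        simp only [hF₁, hF']
        exact ((hbd e z s).const_mul (g f z v)).sub ((hbd f z s).mul_const (g e z v))
      exact strictAntiOn_of_deriv_neg (convex_Icc _ _)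
        (fun s _ => (hd s).continuousAt.continuousWithinAt) fun s hs => by
          rw [(hd s).deriv]
          exact (hin v hv s (interior_subset hs)).1)
    (fun s hs => (hz2 s hs).1) (fun s hs => (hz2 s hs).2)
  obtain ⟨-, i1, i2⟩ := hin v hv s hs
  -- Equal projections put both points on one ray from the apex; the ratio of their heights along
  -- `e` lies in [0, 1] because the strand point is the nearer one.
  refine ⟨v, s, (habs hv).trans_lt hhε, g e z v / b e z s,
    ⟨div_nonneg i1.le (i1.trans i2).le, (div_le_one (i1.trans i2)).2 i2.le⟩, ?_⟩
  have hbne := (i1.trans i2).ne'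
  refine hF.ext_inner ?_ ?_ ?_
  · rw [inner_smul_right, ← hg, ← hb]
    field_simp
  · rw [inner_smul_right, ← hg, ← hb]
    rw [hF₁] at hz1
    field_simp
    linarith
  · rw [inner_smul_right, ← hg, ← hb]
    rw [hF₂] at hz2
    field_simp
    linarith

end Crossing

/-! ### Stadium positions persist along thin isotopies -/

section NotSeparable

/-- The second curve passes through five characteristic points of the stadium curve around the
points `g u` and `g v`, which are at distance `1`; the first three coordinates of `x` are `u`,
`v - u` and the parameter of the point of the stadium curve farthest from `g u`. -/
def StadiumPosition (g b : ℝ → E3) (x : ℝ × ℝ × ℝ × ℝ × ℝ × ℝ × ℝ) : Prop :=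
  match x with
  | (u, w, s₀, s₁, s₂, s₃, s₄) =>
    ‖g (u + w) - g u‖ = 1 ∧ inner ℝ (g (u + w) - g u) (deriv b s₀) = 0 ∧
      b s₀ = g (u + w) + (g (u + w) - g u) ∧ b s₁ = g u - (g (u + w) - g u) ∧
      b s₂ = g (u + w) + deriv b s₀ ∧ b s₃ = g (u + w) - deriv b s₀ ∧ b s₄ = g u + deriv b s₀

/-- The parameters of a stadium position, up to periods. -/
def stadiumBox (L ℓ : ℝ) : Set (ℝ × ℝ × ℝ × ℝ × ℝ × ℝ × ℝ) :=
  Icc 0 L ×ˢ Icc 0 L ×ˢ Icc 0 ℓ ×ˢ Icc 0 ℓ ×ˢ Icc 0 ℓ ×ˢ Icc 0 ℓ ×ˢ Icc 0 ℓ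

theorem isCompact_stadiumBox (L ℓ : ℝ) : IsCompact (stadiumBox L ℓ) := by
  unfold stadiumBox
  repeat' first | exact isCompact_Icc | apply IsCompact.prod

variable {L ℓ : ℝ} {g b : ℝ → E3}

theorem StadiumPosition.exists_mem_box (hg : Function.Periodic g L) (hL : 0 < L)
    (hb : Function.Periodic b ℓ) (hb' : Function.Periodic (deriv b) ℓ) (hℓ : 0 < ℓ)
    {u w s₀ s₁ s₂ s₃ s₄ : ℝ} (hw : w ∈ Icc 0 L)
    (h : StadiumPosition g b (u, w, s₀, s₁, s₂, s₃, s₄)) :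
    ∃ x ∈ stadiumBox L ℓ, StadiumPosition g b x := by
  have hmem : ∀ {p : ℝ} (hp : 0 < p) (s : ℝ), toIcoMod hp 0 s ∈ Icc 0 p := fun hp s =>
    Ico_subset_Icc_self (by simpa using toIcoMod_mem_Ico hp 0 s)
  have hval : ∀ {f : ℝ → E3} {p : ℝ} (_ : Function.Periodic f p) (hp : 0 < p) (s : ℝ),
      f (toIcoMod hp 0 s) = f s := fun hf hp s => by
    rw [← self_sub_toIcoDiv_zsmul, hf.sub_zsmul_eq]
  have hval' : ∀ s, g (toIcoMod hL 0 s + w) = g (s + w) := fun s => by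
    rw [← self_sub_toIcoDiv_zsmul, sub_add_eq_add_sub, hg.sub_zsmul_eq]
  refine ⟨(toIcoMod hL 0 u, w, toIcoMod hℓ 0 s₀, toIcoMod hℓ 0 s₁, toIcoMod hℓ 0 s₂,
    toIcoMod hℓ 0 s₃, toIcoMod hℓ 0 s₄), ⟨hmem hL u, hw, hmem hℓ _, hmem hℓ _, hmem hℓ _,
    hmem hℓ _, hmem hℓ _⟩, ?_⟩
  simpa only [StadiumPosition, hval hg hL, hval hb hℓ, hval hb' hℓ, hval'] using h

theorem StadiumPosition.dist_eq_one {x : ℝ × ℝ × ℝ × ℝ × ℝ × ℝ × ℝ}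
    (h : StadiumPosition g b x) : ∃ u s, dist (g u) (b s) = 1 := by
  obtain ⟨u, w, s₀, s₁, s₂, s₃, s₄⟩ := x
  obtain ⟨h1, -, -, h2, -⟩ := h
  exact ⟨u, s₁, by rw [h2, dist_eq_norm, sub_sub_cancel, h1]⟩

/-- The equations are closed in time and parameters, and the parameters range over a compact box, so
the projection to time is closed. -/
theorem isClosed_stadiumPosition {T : Type*} [TopologicalSpace T] [CompactSpace T] [T2Space T]
    {G B : T → ℝ → E3} (hG : Continuous fun p : T × ℝ => G p.1 p.2)
    (hB : Continuous fun p : T × ℝ => B p.1 p.2)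
    (hB' : Continuous fun p : T × ℝ => deriv (B p.1) p.2) (L ℓ : ℝ) :
    IsClosed {t | ∃ x ∈ stadiumBox L ℓ, StadiumPosition (G t) (B t) x} := by
  have hGc : ∀ f : T × ℝ × ℝ × ℝ × ℝ × ℝ × ℝ × ℝ → ℝ, Continuous f →
      Continuous fun q => G q.1 (f q) := fun f hf => hG.comp (continuous_fst.prodMk hf)
  have hBc : ∀ f : T × ℝ × ℝ × ℝ × ℝ × ℝ × ℝ × ℝ → ℝ, Continuous f →
      Continuous fun q => B q.1 (f q) := fun f hf => hB.comp (continuous_fst.prodMk hf)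
  have hB'c : ∀ f : T × ℝ × ℝ × ℝ × ℝ × ℝ × ℝ × ℝ → ℝ, Continuous f →
      Continuous fun q => deriv (B q.1) (f q) := fun f hf => hB'.comp (continuous_fst.prodMk hf)
  have hclosed : IsClosed {q : T × ℝ × ℝ × ℝ × ℝ × ℝ × ℝ × ℝ |
      StadiumPosition (G q.1) (B q.1) q.2} := by
    have c1 := hGc (fun q => q.2.1 + q.2.2.1) (by fun_prop)
    have c2 := hGc (fun q => q.2.1) (by fun_prop)
    have c3 := hB'c (fun q => q.2.2.2.1) (by fun_prop)
    have c4 := hBc (fun q => q.2.2.2.1) (by fun_prop)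
    have c5 := hBc (fun q => q.2.2.2.2.1) (by fun_prop)
    have c6 := hBc (fun q => q.2.2.2.2.2.1) (by fun_prop)
    have c7 := hBc (fun q => q.2.2.2.2.2.2.1) (by fun_prop)
    have c8 := hBc (fun q => q.2.2.2.2.2.2.2) (by fun_prop)
    exact (isClosed_eq (c1.sub c2).norm continuous_const).inter
      ((isClosed_eq ((c1.sub c2).inner c3) continuous_const).inter
      ((isClosed_eq c4 (c1.add (c1.sub c2))).inter ((isClosed_eq c5 (c2.sub (c1.sub c2))).inter
      ((isClosed_eq c6 (c1.add c3)).inter ((isClosed_eq c7 (c1.sub c3)).inter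
      (isClosed_eq c8 (c2.add c3)))))))
  have := ((isCompact_univ.prod (isCompact_stadiumBox L ℓ)).inter_right hclosed).image
    (continuous_fst (X := T))
  convert this.isClosed using 1
  ext t
  constructor
  · rintro ⟨x, hx, h⟩
    exact ⟨(t, x), ⟨⟨mem_univ _, hx⟩, h⟩, rfl⟩
  · rintro ⟨⟨t', x⟩, ⟨⟨-, hx⟩, h⟩, rfl⟩
    exact ⟨x, hx, h⟩

/-- Transversality recovers, at nearby times, a hull point and a cone point of the first curve, and
rigidity then turns these weak conditions back into an exact stadium position. -/
theorem isOpen_stadiumPosition {G B : unitInterval → ℝ → E3}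
    (h : IsThinIsotopy 1 L (2 * Real.pi + 2) G B) :
    IsOpen {t | ∃ x ∈ stadiumBox L (2 * Real.pi + 2), StadiumPosition (G t) (B t) x} := by
  have hp := Real.pi_pos
  have hlink := h.isThinLink
  have hgc := fun t => (hlink t).core₁.constrained
  have hbc := fun t => (hlink t).core₂.constrained
  rw [isOpen_iff_mem_nhds]
  rintro t₀ ⟨⟨u₀, w₀, s₀, s₁, s₂, s₃, s₄⟩, ⟨-, hw₀, -⟩, p0, p1, p2, p3, p4, p5, p6⟩
  simp only at hw₀
  have hfar : ∀ u s, 1 ≤ ‖G t₀ u - B t₀ s‖ := fun u s => by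
    rw [← dist_eq_norm]; exact (hlink t₀).one_le_dist u s
  -- The least possible distance between the components is 1, so wherever it is attained the chord
  -- is orthogonal to `G t₀`. Applied to the characteristic points, this makes the tangents at `u₀`
  -- and `u₀ + w₀` orthogonal to both `e` and `f`.
  have hcrit : ∀ u s, ‖G t₀ u - B t₀ s‖ = 1 →
      inner ℝ (G t₀ u - B t₀ s) (deriv (G t₀) u) = 0 := fun u s hus => by
    have hmin : IsLocalMin (fun x => ‖G t₀ x - B t₀ s‖ ^ 2) u :=
      Eventually.of_forall fun x => by
        simp only [hus, one_pow]
        exact one_le_pow₀ (hfar x s)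
    have := hmin.hasDerivAt_eq_zero (((hgc t₀).hasDerivAt u).sub_const _).norm_sq
    linarith
  set e := G t₀ (u₀ + w₀) - G t₀ u₀ with he
  set f := deriv (B t₀) s₀ with hf
  have hfn : ‖f‖ = 1 := (hbc t₀).unit_speed s₀
  have q1 : G t₀ u₀ - B t₀ s₁ = e := by rw [p3]; abel
  have q4 : G t₀ u₀ - B t₀ s₄ = -f := by rw [p6]; abel
  have q0 : G t₀ (u₀ + w₀) - B t₀ s₀ = -e := by rw [p2]; abel
  have q2 : G t₀ (u₀ + w₀) - B t₀ s₂ = -f := by rw [p4]; abel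
  have hFu : IsFrame e f (deriv (G t₀) u₀) :=
    ⟨p0, hfn, (hgc t₀).unit_speed _, p1, q1 ▸ hcrit u₀ s₁ (q1 ▸ p0), by
      have := hcrit u₀ s₄ (by rw [q4, norm_neg, hfn])
      rwa [q4, inner_neg_left, neg_eq_zero] at this⟩
  have hFv : IsFrame e f (deriv (G t₀) (u₀ + w₀)) :=
    ⟨p0, hfn, (hgc t₀).unit_speed _, p1, by
      have := hcrit (u₀ + w₀) s₀ (by rw [q0, norm_neg, p0])
      rwa [q0, inner_neg_left, neg_eq_zero] at this, by
      have := hcrit (u₀ + w₀) s₂ (by rw [q2, norm_neg, hfn])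
      rwa [q2, inner_neg_left, neg_eq_zero] at this⟩
  have hw0 : 0 < w₀ := hw₀.1.lt_of_ne fun h0 => by
    rw [he, ← h0, add_zero, sub_self, norm_zero] at p0
    exact zero_ne_one p0
  have hwL : w₀ < L := hw₀.2.lt_of_ne fun h0 => by
    rw [he, h0, (hgc t₀).periodic, sub_self, norm_zero] at p0
    exact zero_ne_one p0
  -- The chord `e` is orthogonal to the curve, so its ends are at least π apart along the curve
  -- either way round. After moving each by less than π/6 they are still more than π/3 apart, which
  -- gives distance at least 1.
  have hπ1 := (hgc t₀).pi_le_of_inner_eq_zero (u := u₀) (v := u₀ + w₀) (by linarith) hFu.inner_en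
  have hπ2 := (hgc t₀).add_pi_le_of_inner_eq_zero (u := u₀) (v := u₀ + w₀) (by linarith)
    hFu.inner_en
  have hcone := eventually_exists_crossing_cone (u₀ := u₀) (v₀ := u₀ + w₀) (s₀ := s₀)
    (ε := Real.pi / 6) hFv h.continuous₁ h.continuous₂ h.continuous_deriv₂
    (fun t s => (hbc t).hasDerivAt s) (by rw [he]; abel) (by rw [p2, he]; abel)
    ((hgc t₀).hasDerivAt _) rfl (by positivity)
  rw [nhds_prod_eq, eventually_prod_iff] at hcone
  obtain ⟨pa, hpa, pb, hpb, hcone⟩ := hcone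
  obtain ⟨δ, hδ, hball⟩ := Metric.eventually_nhds_iff_ball.1 hpb
  have hhull := eventually_exists_crossing_hull (u₀ := u₀) (s₁ := s₁) (s₂ := s₂) (s₃ := s₃)
    -- The hull point must be so close to `u₀` that it may serve as apex of the cone, whence the
    -- bound δ.
    (ε := min δ (Real.pi / 6)) hFu h.continuous₁ h.continuous₂
    ((hgc t₀).hasDerivAt _) p3 (by rw [p4, he]; abel) (by rw [p5, he]; abel) (by positivity)
  filter_upwards [hpa, hhull] with t hta ⟨u, hu, hN⟩
  obtain ⟨hu1, hu2⟩ := lt_min_iff.1 hu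
  obtain ⟨v, s, hv, hseg⟩ := hcone hta (hball u hu1)
  rw [abs_lt] at hu2 hv
  have hdist := (hlink t).core₁.one_le_dist (u := u) (v := v) (by linarith) (by linarith)
  have hfar' : ∀ u s, 1 ≤ ‖B t s - G t u‖ := fun u s => by
    rw [← dist_eq_norm, dist_comm]; exact (hlink t).one_le_dist u s
  have hbd : ∀ x, HasDerivAt (fun x => B t (x + s) - G t u) (deriv (B t) (x + s)) x := fun x =>
    (((hbc t).hasDerivAt (x + s)).comp_add_const x s).sub_const _
  -- Coordinates are centred at the hull point, and the second curve is reparametrised to start at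
  -- the point seen behind `G t v`.
  obtain ⟨r0, r1, r2, r3, r4, r5, r6⟩ := stadium_rigidity (b := fun x => B t (x + s) - G t u)
    (q := G t v - G t u) hbd ((hbc t).continuous_deriv.comp (by fun_prop))
    (fun x => (hbc t).unit_speed _)
    (fun x => by beta_reduce; rw [add_right_comm, (hbc t).periodic]) (fun x => hfar' u _)
    (fun x => by rw [sub_sub_sub_cancel_right]; exact hfar' v _)
    (by rwa [← dist_eq_norm, dist_comm]) (by simpa only [zero_add] using hseg)
    (fun N => by
      obtain ⟨x, hx⟩ := hN N
      exact ⟨x - s, by simpa only [sub_add_cancel] using hx⟩)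
  simp only [zero_add] at r1 r2 r3 r4 r5 r6
  refine StadiumPosition.exists_mem_box (hgc t).periodic (hgc t).length_pos (hbc t).periodic
    (hbc t).periodic_deriv (by positivity) (u := u) (w := v - u) (s₀ := s)
    (s₁ := Real.pi + 1 + s) (s₂ := Real.pi / 2 + s)
    (s₃ := 2 * Real.pi + 2 - Real.pi / 2 + s) (s₄ := Real.pi / 2 + 1 + s)
    ⟨by linarith, by linarith⟩ ?_
  rw [sub_eq_iff_eq_add] at r2 r3 r4 r5 r6
  simp only [StadiumPosition, add_sub_cancel]
  refine ⟨r0, r1, ?_, ?_, ?_, ?_, ?_⟩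
  · rw [r2]; abel
  · rw [r5]; abel
  · rw [r3]; abel
  · rw [r6]; abel
  · rw [r4]; abel

theorem mem_stadium_of_dist {a b p c : E3} (hp : p 2 = 0) (hc : c ∈ segment ℝ a b)
    (hpc : dist p c = 1) (hle : ∀ x ∈ segment ℝ a b, 1 ≤ dist p x) : p ∈ stadium a b :=
  ⟨hp, le_antisymm (hpc ▸ Metric.infDist_le_dist_of_mem hc)
    ((Metric.le_infDist ⟨c, hc⟩).2 fun _ hx => hle _ hx)⟩

/-- A point of the plane over the end of a segment of unit length, in orthonormal coordinates. -/
theorem add_mem_stadium {a b x : E3} (hb : b 2 = 0) (hx : x 2 = 0)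
    (hxn : ‖x‖ = 1) (h : 0 ≤ inner ℝ (b - a) x) : b + x ∈ stadium a b := by
  refine mem_stadium_of_dist (c := b) (by simp [hb, hx]) (right_mem_segment ℝ a b)
    (by rw [dist_eq_norm, add_sub_cancel_left, hxn]) ?_
  rintro _ ⟨α, β, hα, hβ, hαβ, rfl⟩
  have h1 : b + x - (α • a + β • b) = x + α • (b - a) := by
    obtain rfl : β = 1 - α := by linarith
    module
  rw [dist_eq_norm, h1, ← one_le_sq_iff₀ (norm_nonneg _), norm_add_sq_real, hxn,
    inner_smul_right, real_inner_comm]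
  nlinarith [mul_nonneg hα h, sq_nonneg ‖α • (b - a)‖]

theorem stadium_comm (a b : E3) : stadium a b = stadium b a := by
  rw [stadium, stadium, segment_symm]

/-- A thin link that is a stadium pair is not separable. -/
theorem IsStadiumPair.not_isSeparable {γ β : ℝ → E3} {t₁ t₂ : ℝ}
    (hlink : IsThinLink 1 L (2 * Real.pi + 2) γ β) (h : IsStadiumPair L γ β t₁ t₂) :
    ¬ IsSeparable 1 L (2 * Real.pi + 2) γ β := by
  intro hsep
  -- Any radius greater than 1 would do, since a stadium position contains a pair of points at
  -- distance 1.
  obtain ⟨G, B, hiso, rfl, rfl, hdisj⟩ := hsep 2 two_pos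
  have hβ := hlink.core₂.constrained
  have hstart : ∃ x ∈ stadiumBox L (2 * Real.pi + 2), StadiumPosition (G 0) (B 0) x := by
    set e := G 0 t₂ - G 0 t₁ with he
    have hen : ‖e‖ = 1 := by rw [he, ← dist_eq_norm, dist_comm, h.dist_eq]
    have he2 : e 2 = 0 := by simp [he, h.height₁, h.height₂]
    have hee : inner ℝ e e = (1 : ℝ) := by rw [real_inner_self_eq_norm_sq, hen, one_pow]
    have hplane : ∀ s, B 0 s 2 = 0 := fun s => (h.range_eq ▸ mem_range_self s :
      B 0 s ∈ stadium (G 0 t₁) (G 0 t₂)).1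
    have hmem : ∀ p ∈ stadium (G 0 t₁) (G 0 t₂), ∃ s, B 0 s = p := fun p hp => by
      rwa [← h.range_eq] at hp
    obtain ⟨s₀, hs₀⟩ := hmem _ (add_mem_stadium (x := e) h.height₂ he2 hen
      (by rw [← he, hee]; exact zero_le_one))
    obtain ⟨s₁, hs₁⟩ := hmem _ (stadium_comm _ _ ▸ add_mem_stadium (x := -e) h.height₁
      (by simp [he2]) (by rw [norm_neg, hen])
      (by rw [← neg_sub (G 0 t₂), ← he, inner_neg_neg, hee]; exact zero_le_one))
    -- At the tip of the stadium the distance to `G 0 t₂` is minimal, so the tangent is orthogonal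
    -- to `e`; it is horizontal because the curve is planar. Its sign depends on the orientation of
    -- `B 0`, but the stadium is symmetric under reflection in its axis.
    set f := deriv (B 0) s₀ with hf
    have hfn : ‖f‖ = 1 := hβ.unit_speed s₀
    have hf2 : f 2 = 0 := by
      have h1 := (EuclideanSpace.proj (2 : Fin 3) : E3 →L[ℝ] ℝ).hasFDerivAt.comp_hasDerivAt s₀
        (hβ.hasDerivAt s₀)
      have h2 : HasDerivAt (fun s => B 0 s 2) (f 2) s₀ := h1
      simp only [hplane] at h2
      exact h2.unique (hasDerivAt_const s₀ 0)
    have hef : inner ℝ e f = 0 := by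
      have hmin : IsLocalMin (fun x => ‖B 0 x - G 0 t₂‖ ^ 2) s₀ :=
        Eventually.of_forall fun x => by
          simp only [hs₀, add_sub_cancel_left, hen, one_pow]
          rw [← dist_eq_norm, dist_comm]
          exact one_le_pow₀ (hlink.one_le_dist t₂ x)
      have := hmin.hasDerivAt_eq_zero ((hβ.hasDerivAt s₀).sub_const _).norm_sq
      rw [hs₀, add_sub_cancel_left] at this
      linarith
    obtain ⟨s₂, hs₂⟩ := hmem _ (add_mem_stadium (x := f) h.height₂ hf2 hfn
      (by rw [← he, hef]))
    obtain ⟨s₃, hs₃⟩ := hmem _ (add_mem_stadium (x := -f) h.height₂ (by simp [hf2])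
      (by rw [norm_neg, hfn]) (by rw [← he, inner_neg_right, hef, neg_zero]))
    obtain ⟨s₄, hs₄⟩ := hmem _ (stadium_comm _ _ ▸ add_mem_stadium (x := f) h.height₁
      hf2 hfn (by rw [← neg_sub (G 0 t₂), ← he, inner_neg_left, hef, neg_zero]))
    refine StadiumPosition.exists_mem_box hlink.core₁.constrained.periodic
      hlink.core₁.constrained.length_pos hβ.periodic hβ.periodic_deriv hβ.length_pos (u := t₁)
      (w := t₂ - t₁) (s₀ := s₀) (s₁ := s₁) (s₂ := s₂) (s₃ := s₃) (s₄ := s₄)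
      ⟨by linarith [h.lt], by linarith [h.lt_add]⟩ ?_
    simp only [StadiumPosition, add_sub_cancel]
    exact ⟨hen, hef, hs₀, by rw [hs₁, ← sub_eq_add_neg], hs₂, by rw [hs₃, ← sub_eq_add_neg], hs₄⟩
  have huniv := (show IsClopen _ from ⟨isClosed_stadiumPosition hiso.continuous₁ hiso.continuous₂
    hiso.continuous_deriv₂ L (2 * Real.pi + 2), isOpen_stadiumPosition hiso⟩).eq_univ ⟨0, hstart⟩
  obtain ⟨x, -, hx⟩ := eq_univ_iff_forall.1 huniv 1
  obtain ⟨u, s, hus⟩ := hx.dist_eq_one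
  refine Set.disjoint_left.1 hdisj (Metric.self_subset_thickening two_pos _ (mem_range_self u))
    (Metric.mem_thickening_iff.2 ⟨_, mem_range_self s, ?_⟩)
  rw [hus]
  exact one_lt_two

end NotSeparable

/-! ### Centrally symmetric plane curves given by their normal angle -/

section PlanarLoops

/-- `θ` is affine with slope at most `1` on each of finitely many intervals that follow each other
from `a` to `b`. -/
inductive PiecewiseAffine (θ : ℝ → ℝ) (a : ℝ) : ℝ → Prop
  | refl : PiecewiseAffine θ a a
  | snoc {b c κ d : ℝ} (h : PiecewiseAffine θ a b) (hbc : b < c) (hκ : |κ| ≤ 1)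
      (hθ : ∀ r ∈ Icc b c, θ r = d + κ * r) : PiecewiseAffine θ a c

theorem PiecewiseAffine.trans {θ : ℝ → ℝ} {a b c : ℝ} (hab : PiecewiseAffine θ a b)
    (hbc : PiecewiseAffine θ b c) : PiecewiseAffine θ a c := by
  induction hbc with
  | refl => exact hab
  | snoc _ h1 hκ hθ ih => exact ih.snoc h1 hκ hθ

theorem PiecewiseAffine.shift {θ : ℝ → ℝ} {a b P k : ℝ} (hab : PiecewiseAffine θ a b)
    (h : ∀ s, θ (s + P) = θ s + k) : PiecewiseAffine θ (a + P) (b + P) := by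
  induction hab with
  | refl => exact .refl
  | @snoc b c κ d _ h1 hκ hθ ih =>
    refine ih.snoc (κ := κ) (d := d + k - κ * P) (by linarith) hκ fun r hr => ?_
    rw [← sub_add_cancel r P, h, hθ (r - P) ⟨by linarith [hr.1], by linarith [hr.2]⟩]
    ring

theorem PiecewiseAffine.exists_partition {θ : ℝ → ℝ} {a b : ℝ} (h : PiecewiseAffine θ a b) :
    ∃ (n : ℕ) (p : Fin (n + 1) → ℝ), StrictMono p ∧ p 0 = a ∧ p (Fin.last n) = b ∧
      ∀ i : Fin n, ∃ κ c : ℝ, |κ| ≤ 1 ∧ ∀ r ∈ Icc (p i.castSucc) (p i.succ), θ r = c + κ * r := by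
  induction h with
  | refl => exact ⟨0, fun _ => a, fun i j h => absurd h (by omega), rfl, rfl, fun i => i.elim0⟩
  | @snoc b c κ d _ hbc hκ hθ ih =>
    obtain ⟨n, p, hp, hp0, hpn, haff⟩ := ih
    refine ⟨n + 1, Fin.snoc p c, ?_, ?_, by simp, fun i => ?_⟩
    · refine Fin.strictMono_iff_lt_succ.2 fun i => ?_
      induction i using Fin.lastCases with
      | last => simpa [hpn] using hbc
      | cast i =>
        rw [Fin.snoc_castSucc, ← Fin.castSucc_succ, Fin.snoc_castSucc]
        exact hp Fin.castSucc_lt_succ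
    · rw [← hp0, ← Fin.castSucc_zero, Fin.snoc_castSucc]
    · induction i using Fin.lastCases with
      | last =>
        refine ⟨κ, d, hκ, fun r hr => hθ r ?_⟩
        simpa [hpn] using hr
      | cast i =>
        obtain ⟨κ', d', hκ', h'⟩ := haff i
        refine ⟨κ', d', hκ', fun r hr => h' r ?_⟩
        rwa [Fin.snoc_castSucc, ← Fin.castSucc_succ, Fin.snoc_castSucc] at hr

/-- The extension of an angle function from `[0, P]` with `θ (s + P) = θ s + π`. -/
noncomputable def turningAngle (θ : ℝ → ℝ) (P s : ℝ) : ℝ :=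
  θ (P * Int.fract (s / P)) + Real.pi * ⌊s / P⌋

theorem turningAngle_add {θ : ℝ → ℝ} {P : ℝ} (hP : 0 < P) (s : ℝ) :
    turningAngle θ P (s + P) = turningAngle θ P s + Real.pi := by
  rw [turningAngle, turningAngle, add_div, div_self hP.ne', Int.fract_add_one, Int.floor_add_one]
  push_cast
  ring

theorem turningAngle_of_mem {θ : ℝ → ℝ} {P s : ℝ} (hP : 0 < P) (h0 : θ P = θ 0 + Real.pi)
    (hs : s ∈ Icc 0 P) : turningAngle θ P s = θ s := by
  rcases hs.2.eq_or_lt with rfl | h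
  · rw [turningAngle, div_self hP.ne']
    simp [h0]
  · have h1 : ⌊s / P⌋ = 0 := Int.floor_eq_zero_iff.2 ⟨div_nonneg hs.1 hP.le, (div_lt_one hP).2 h⟩
    have h2 : Int.fract (s / P) = s / P := by rw [Int.fract, h1]; simp
    rw [turningAngle, h1, h2, mul_div_cancel₀ s hP.ne']
    simp

/-- After subtracting the linear function of slope π/P the floor terms cancel. What remains is
periodic, with matching values at the ends of a period. -/
theorem continuous_turningAngle {θ : ℝ → ℝ} {P : ℝ} (h0 : θ P = θ 0 + Real.pi)
    (hθ : Continuous θ) : Continuous (turningAngle θ P) := by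
  have h1 : Continuous ((fun x => θ (P * x) - Real.pi * x) ∘ Int.fract) :=
    ContinuousOn.comp_fract'' (by fun_prop) (by simp [h0])
  have h2 : turningAngle θ P = fun s =>
      ((fun x => θ (P * x) - Real.pi * x) ∘ Int.fract) (s / P) + Real.pi * (s / P) := by
    funext s
    simp only [turningAngle, Function.comp_apply]
    linear_combination Real.pi * (Int.floor_add_fract (s / P))
  rw [h2]
  exact (h1.comp (continuous_id.div_const P)).add (by fun_prop)

/-- A centrally symmetric plane curve of length `2 P` with coordinates `x`, `y` and
outward normal angle `θ`. -/
structure IsCentralLoop (θ x y : ℝ → ℝ) (P : ℝ) : Prop where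
  pos : 0 < P
  continuous_angle : Continuous θ
  angle_add : ∀ s, θ (s + P) = θ s + Real.pi
  affine : PiecewiseAffine θ 0 (2 * P)
  hasDerivAt_x : ∀ s, HasDerivAt x (-Real.sin (θ s)) s
  hasDerivAt_y : ∀ s, HasDerivAt y (Real.cos (θ s)) s
  x_end : x P = -x 0
  y_end : y P = -y 0

variable {θ x y : ℝ → ℝ} {P : ℝ}

theorem eq_neg_of_hasDerivAt_neg {f f' : ℝ → ℝ} (hf : ∀ s, HasDerivAt f (f' s) s)
    (hf' : ∀ s, f' (s + P) = -f' s) (h0 : f P = -f 0) (s : ℝ) : f (s + P) = -f s := by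
  have h1 : ∀ s, HasDerivAt (fun s => f (s + P) + f s) 0 s := fun s =>
    (((hf (s + P)).comp_add_const s P).add (hf s)).congr_deriv (by rw [hf']; ring)
  have h2 := is_const_of_deriv_eq_zero (fun s => (h1 s).differentiableAt)
    (fun s => (h1 s).deriv) s 0
  simp only [zero_add, h0] at h2
  linarith

theorem IsCentralLoop.x_add (h : IsCentralLoop θ x y P) (s : ℝ) : x (s + P) = -x s :=
  eq_neg_of_hasDerivAt_neg h.hasDerivAt_x (fun s => by rw [h.angle_add, Real.sin_add_pi]) h.x_end s

theorem IsCentralLoop.y_add (h : IsCentralLoop θ x y P) (s : ℝ) : y (s + P) = -y s :=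
  eq_neg_of_hasDerivAt_neg h.hasDerivAt_y (fun s => by rw [h.angle_add, Real.cos_add_pi]) h.y_end s

theorem hasDerivAt_eq_of_eqOn_Icc {E : Type*} [NormedAddCommGroup E] [NormedSpace ℝ E]
    {f g : ℝ → E} {f' g' : E} {a b s : ℝ} (hs : s ∈ Ico a b) (hf : HasDerivAt f f' s)
    (hg : HasDerivAt g g' s) (h : EqOn f g (Icc a b)) : f' = g' :=
  (uniqueDiffOn_Icc (hs.1.trans_lt hs.2) s (Ico_subset_Icc_self hs)).eq_deriv _
    hf.hasDerivWithinAt (hg.hasDerivWithinAt.congr h (h (Ico_subset_Icc_self hs)))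

/-- The curve with coordinates `x`, `y` in the plane spanned by `e₁`, `e₂`. -/
noncomputable def planarCurve (e₁ e₂ : E3) (x y : ℝ → ℝ) (s : ℝ) : E3 := x s • e₁ + y s • e₂

variable {e₁ e₂ : E3}

theorem norm_smul_add_smul_sq (h1 : ‖e₁‖ = 1) (h2 : ‖e₂‖ = 1) (h12 : inner ℝ e₁ e₂ = 0)
    (a b : ℝ) : ‖a • e₁ + b • e₂‖ ^ 2 = a ^ 2 + b ^ 2 := by
  rw [norm_add_sq_real, norm_smul, norm_smul, inner_smul_left, inner_smul_right, h12, h1, h2]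
  simp

theorem inner_smul_add_smul (h1 : ‖e₁‖ = 1) (h2 : ‖e₂‖ = 1) (h12 : inner ℝ e₁ e₂ = 0)
    (a b c d : ℝ) : inner ℝ (a • e₁ + b • e₂) (c • e₁ + d • e₂) = a * c + b * d := by
  have h21 : inner ℝ e₂ e₁ = 0 := by rw [real_inner_comm]; exact h12
  simp only [inner_add_left, inner_add_right, inner_smul_left, inner_smul_right, h12, h21,
    real_inner_self_eq_norm_sq, h1, h2, conj_trivial]
  ring

theorem IsCentralLoop.hasDerivAt_curve (h : IsCentralLoop θ x y P) (s : ℝ) :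
    HasDerivAt (planarCurve e₁ e₂ x y) (-Real.sin (θ s) • e₁ + Real.cos (θ s) • e₂) s :=
  ((h.hasDerivAt_x s).smul_const e₁).add ((h.hasDerivAt_y s).smul_const e₂)

theorem IsCentralLoop.deriv_curve (h : IsCentralLoop θ x y P) :
    deriv (planarCurve e₁ e₂ x y) =
      fun s => -Real.sin (θ s) • e₁ + Real.cos (θ s) • e₂ :=
  funext fun s => (h.hasDerivAt_curve s).deriv

theorem IsCentralLoop.curve_add (h : IsCentralLoop θ x y P) (s : ℝ) :
    planarCurve e₁ e₂ x y (s + P) = -planarCurve e₁ e₂ x y s := by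
  rw [planarCurve, planarCurve, h.x_add, h.y_add]
  module

theorem IsCentralLoop.curve_periodic (h : IsCentralLoop θ x y P) :
    Function.Periodic (planarCurve e₁ e₂ x y) (2 * P) := fun s => by
  rw [two_mul, ← add_assoc, h.curve_add, h.curve_add, neg_neg]

theorem planarCurve_eq_iff (h1 : ‖e₁‖ = 1) (h2 : ‖e₂‖ = 1) (h12 : inner ℝ e₁ e₂ = 0) {s t : ℝ} :
    planarCurve e₁ e₂ x y s = planarCurve e₁ e₂ x y t ↔ x s = x t ∧ y s = y t := by
  constructor
  · intro h
    have h3 : (x s - x t) • e₁ + (y s - y t) • e₂ = 0 := by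
      rw [← sub_eq_zero.2 h, planarCurve, planarCurve]; module
    have h4 := norm_smul_add_smul_sq h1 h2 h12 (x s - x t) (y s - y t)
    rw [h3, norm_zero] at h4
    constructor <;> nlinarith [sq_nonneg (x s - x t), sq_nonneg (y s - y t)]
  · rintro ⟨h3, h4⟩
    rw [planarCurve, planarCurve, h3, h4]

theorem IsCentralLoop.isConstrainedLoop (h : IsCentralLoop θ x y P) (h1 : ‖e₁‖ = 1)
    (h2 : ‖e₂‖ = 1) (h12 : inner ℝ e₁ e₂ = 0)
    (hinj : ∀ s ∈ Ico 0 (2 * P), ∀ t ∈ Ico 0 (2 * P), x s = x t → y s = y t → s = t) :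
    IsConstrainedLoop 1 (2 * P) (planarCurve e₁ e₂ x y) := by
  have hL : 0 < 2 * P := by linarith [h.pos]
  have hθ := h.continuous_angle
  have hdper : ∀ s, deriv (planarCurve e₁ e₂ x y) (s + 2 * P) =
      deriv (planarCurve e₁ e₂ x y) s := fun s => by
    rw [← deriv_comp_add_const, show (fun s => planarCurve e₁ e₂ x y (s + 2 * P)) =
      planarCurve e₁ e₂ x y from funext h.curve_periodic]
  obtain ⟨n, p, hp, hp0, hpn, haff⟩ := h.affine.exists_partition
  have hcurv : ∀ s ∈ Ico 0 (2 * P), DifferentiableAt ℝ (deriv (planarCurve e₁ e₂ x y)) s →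
      ‖deriv (deriv (planarCurve e₁ e₂ x y)) s‖ ≤ 1 := by
    intro s hs hd
    obtain ⟨i, hi⟩ := exists_mem_Ico_of_strictMono (hp0.trans_le hs.1) (hs.2.trans_eq hpn.symm)
    obtain ⟨κ, c, hκ, hc⟩ := haff i
    have e0 : HasDerivAt (fun r => c + κ * r) κ s := by
      simpa using ((hasDerivAt_id s).const_mul κ).const_add c
    have e1 := (e0.sin.neg.smul_const e₁).add (e0.cos.smul_const e₂)
    have e2 := hasDerivAt_eq_of_eqOn_Icc hi hd.hasDerivAt e1 fun r hr => by
      rw [h.deriv_curve]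
      simp [hc r hr]
    rw [e2, ← sq_le_one_iff₀ (norm_nonneg _), norm_smul_add_smul_sq h1 h2 h12]
    have := Real.sin_sq_add_cos_sq (c + κ * s)
    have h3 : κ ^ 2 ≤ 1 := (sq_le_one_iff_abs_le_one κ).2 hκ
    calc _ = κ ^ 2 * (Real.sin (c + κ * s) ^ 2 + Real.cos (c + κ * s) ^ 2) := by ring
      _ ≤ 1 := by rw [this, mul_one]; exact h3
  refine ⟨hL, h.curve_periodic, fun s hs t ht hst => ?_, ?_, fun s => ?_,
    ⟨n, p, hp, hp0, hpn, fun i => ?_⟩, fun s hd => ?_⟩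
  · obtain ⟨hx, hy⟩ := (planarCurve_eq_iff h1 h2 h12).1 hst
    exact hinj s hs t ht hx hy
  · refine contDiff_one_iff_deriv.2 ⟨fun s => (h.hasDerivAt_curve s).differentiableAt, ?_⟩
    rw [h.deriv_curve]
    fun_prop
  · rw [h.deriv_curve, ← pow_eq_one_iff_of_nonneg (norm_nonneg _) two_ne_zero, norm_smul_add_smul_sq h1 h2 h12,
      neg_sq, Real.sin_sq_add_cos_sq]
  · obtain ⟨κ, c, -, hc⟩ := haff i
    have hlt : p i.castSucc < p i.succ := hp Fin.castSucc_lt_succ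
    have hu := uniqueDiffOn_Icc hlt
    refine (contDiffOn_succ_iff_derivWithin (n := 1) hu).2
      ⟨fun s _ => (h.hasDerivAt_curve s).differentiableAt.differentiableWithinAt,
        fun h => by simp at h, ?_⟩
    have hs : ContDiff ℝ 1 fun r : ℝ => -Real.sin (c + κ * r) • e₁ + Real.cos (c + κ * r) • e₂ := by
      fun_prop
    refine hs.contDiffOn.congr fun r hr => ?_
    rw [(h.hasDerivAt_curve r).hasDerivWithinAt.derivWithin (hu r hr), hc r hr]
  · have hm := toIcoMod_mem_Ico hL 0 s
    rw [zero_add] at hm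
    set k := toIcoDiv hL 0 s
    have hk : toIcoMod hL 0 s = s - k • (2 * P) := rfl
    have hf : (fun r => deriv (planarCurve e₁ e₂ x y) (r - -(k • (2 * P)))) =
        deriv (planarCurve e₁ e₂ x y) := funext fun r => by
      rw [sub_neg_eq_add]
      exact (Function.Periodic.zsmul hdper k) r
    have hs : s - k • (2 * P) - -(k • (2 * P)) = s := by abel
    have := hcurv _ hm (by
      rw [hk, ← hf]
      exact differentiableAt_comp_sub_const.2 (by rwa [hs]))
    rwa [hk, ← hf, deriv_comp_sub_const, hs] at this

/-- The curvature bound gives R₁ ≥ 1, so for thickness 1 only the doubly critical chords have to be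
checked. -/
theorem IsConstrainedLoop.isThinCore {L : ℝ} {γ : ℝ → E3} (h : IsConstrainedLoop 1 L γ)
    (hcrit : ∀ u v, DoublyCritical γ u v → 1 ≤ dist (γ u) (γ v)) : IsThinCore 1 L γ := by
  refine ⟨by norm_num, h, le_min ?_ ?_⟩
  · have h1 : (⨆ s : ℝ, ‖deriv (deriv γ) s‖ₑ) ≤ 1 := iSup_le fun s => by
      by_cases hd : DifferentiableAt ℝ (deriv γ) s
      · rw [← ofReal_norm, ENNReal.ofReal_le_one]
        exact h.curvature_le s hd
      -- At breakpoints the second derivative takes the default value 0, which does not raise the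
      -- supremum.
      · simp [deriv_zero_of_not_differentiableAt hd]
    calc ENNReal.ofReal (1 / 2) ≤ 1 := by rw [ENNReal.ofReal_le_one]; norm_num
      _ ≤ curvatureRadius γ := ENNReal.one_le_inv.2 h1
  · have h1 : 1 ≤ criticalDistance γ := le_iInf fun u => le_iInf fun v => le_iInf fun huv => by
      rw [edist_dist, ENNReal.one_le_ofReal]
      exact hcrit u v huv
    calc ENNReal.ofReal (1 / 2) = 1 / 2 := by
          rw [ENNReal.ofReal_div_of_pos two_pos, ENNReal.ofReal_one, ENNReal.ofReal_ofNat]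
      _ ≤ criticalDistance γ / 2 := ENNReal.div_le_div_right h1 _

/-- The condition on doubly critical chords in coordinates: such a chord is parallel to the
normals `(cos (θ u), sin (θ u))` and `(cos (θ v), sin (θ v))`. -/
theorem IsCentralLoop.isThinCore (h : IsCentralLoop θ x y P) (h1 : ‖e₁‖ = 1)
    (h2 : ‖e₂‖ = 1) (h12 : inner ℝ e₁ e₂ = 0)
    (hinj : ∀ s ∈ Ico 0 (2 * P), ∀ t ∈ Ico 0 (2 * P), x s = x t → y s = y t → s = t)
    (hcrit : ∀ u v, ¬ (x u = x v ∧ y u = y v) →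
      (x u - x v) * Real.sin (θ u) = (y u - y v) * Real.cos (θ u) →
      (x u - x v) * Real.sin (θ v) = (y u - y v) * Real.cos (θ v) →
      1 ≤ (x u - x v) ^ 2 + (y u - y v) ^ 2) :
    IsThinCore 1 (2 * P) (planarCurve e₁ e₂ x y) := by
  refine (h.isConstrainedLoop h1 h2 h12 hinj).isThinCore fun u v ⟨huv, hu, hv⟩ => ?_
  have hsub : planarCurve e₁ e₂ x y u - planarCurve e₁ e₂ x y v =
      (x u - x v) • e₁ + (y u - y v) • e₂ := by
    rw [planarCurve, planarCurve]; module
  rw [hsub, h.deriv_curve, inner_smul_add_smul h1 h2 h12] at hu hv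
  rw [dist_eq_norm, hsub, ← one_le_sq_iff₀ (norm_nonneg _), norm_smul_add_smul_sq h1 h2 h12]
  exact hcrit u v (fun hc => huv ((planarCurve_eq_iff h1 h2 h12).2 hc)) (by linarith) (by linarith)

/-- On an interval where the angle is affine, the curve is an arc of a circle or a segment. -/
theorem IsCentralLoop.arc (h : IsCentralLoop θ x y P) {a b κ c : ℝ}
    (hθ : ∀ r ∈ Icc a b, θ r = c + κ * r) {s : ℝ} (hs : s ∈ Icc a b) :
    κ * (x s - x a) = Real.cos (θ s) - Real.cos (θ a) ∧
      κ * (y s - y a) = Real.sin (θ s) - Real.sin (θ a) := by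
  have hl : ∀ r, HasDerivAt (fun r => c + κ * r) κ r := fun r => by
    simpa using ((hasDerivAt_id r).const_mul κ).const_add c
  have ha := hθ a ⟨le_rfl, hs.1.trans hs.2⟩
  constructor
  · have := constant_of_has_deriv_right_zero (a := a) (b := b)
      (f := fun r => κ * x r - Real.cos (c + κ * r))
      (fun r _ => (((h.hasDerivAt_x r).const_mul κ).sub
        (hl r).cos).continuousAt.continuousWithinAt)
      (fun r hr => by
        refine (((h.hasDerivAt_x r).const_mul κ).sub (hl r).cos).hasDerivWithinAt.congr_deriv ?_
        rw [hθ r (Ico_subset_Icc_self hr)]; ring) s hs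
    rw [hθ s hs, ha]
    linarith
  · have := constant_of_has_deriv_right_zero (a := a) (b := b)
      (f := fun r => κ * y r - Real.sin (c + κ * r))
      (fun r _ => (((h.hasDerivAt_y r).const_mul κ).sub
        (hl r).sin).continuousAt.continuousWithinAt)
      (fun r hr => by
        refine (((h.hasDerivAt_y r).const_mul κ).sub (hl r).sin).hasDerivWithinAt.congr_deriv ?_
        rw [hθ r (Ico_subset_Icc_self hr)]; ring) s hs
    rw [hθ s hs, ha]
    linarith

theorem IsCentralLoop.line (h : IsCentralLoop θ x y P) {a b c : ℝ}
    (hθ : ∀ r ∈ Icc a b, θ r = c) {s : ℝ} (hs : s ∈ Icc a b) :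
    x s = x a - Real.sin c * (s - a) ∧ y s = y a + Real.cos c * (s - a) := by
  constructor
  · have := constant_of_has_deriv_right_zero (a := a) (b := b)
      (f := fun r => x r + Real.sin c * r)
      (fun r _ => ((h.hasDerivAt_x r).add
        ((hasDerivAt_id r).const_mul _)).continuousAt.continuousWithinAt)
      (fun r hr => by
        refine ((h.hasDerivAt_x r).add ((hasDerivAt_id r).const_mul
          (Real.sin c))).hasDerivWithinAt.congr_deriv ?_
        rw [hθ r (Ico_subset_Icc_self hr)]; ring) s hs
    linarith
  · have := constant_of_has_deriv_right_zero (a := a) (b := b)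
      (f := fun r => y r - Real.cos c * r)
      (fun r _ => ((h.hasDerivAt_y r).sub
        ((hasDerivAt_id r).const_mul _)).continuousAt.continuousWithinAt)
      (fun r hr => by
        refine ((h.hasDerivAt_y r).sub ((hasDerivAt_id r).const_mul
          (Real.cos c))).hasDerivWithinAt.congr_deriv ?_
        rw [hθ r (Ico_subset_Icc_self hr)]; ring) s hs
    linarith

/-- The unit normal changes sign after `P`, so each coordinate is antiperiodic up to a constant.
Subtracting half of its increment removes the constant and makes the curve close up, centred at the
origin. -/
theorem exists_isCentralLoop {θ : ℝ → ℝ} {P : ℝ} (hP : 0 < P) (hθ : Continuous θ)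
    (hadd : ∀ s, θ (s + P) = θ s + Real.pi) (haff : PiecewiseAffine θ 0 P) :
    ∃ x y : ℝ → ℝ, IsCentralLoop θ x y P := by
  have key : ∀ f : ℝ → ℝ, Continuous f →
      ∃ g : ℝ → ℝ, (∀ s, HasDerivAt g (f s) s) ∧ g P = -g 0 := fun f hf =>
    ⟨fun s => (∫ r in (0 : ℝ)..s, f r) - (∫ r in (0 : ℝ)..P, f r) / 2,
      fun s => (hf.integral_hasStrictDerivAt 0 s).hasDerivAt.sub_const _, by simp; ring⟩
  obtain ⟨x, hx, hx0⟩ := key (fun s => -Real.sin (θ s)) (by fun_prop)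
  obtain ⟨y, hy, hy0⟩ := key (fun s => Real.cos (θ s)) (by fun_prop)
  refine ⟨x, y, hP, hθ, hadd, ?_, hx, hy, hx0, hy0⟩
  have := haff.shift hadd
  rw [zero_add, ← two_mul] at this
  exact haff.trans this

/-- A property of the position and the normal that is invariant under the central symmetry need
only be checked on half of the curve. -/
theorem IsCentralLoop.forall_of_Ico (h : IsCentralLoop θ x y P) {p : ℝ → ℝ → ℝ → ℝ → Prop}
    (hneg : ∀ x y c d, p x y c d → p (-x) (-y) (-c) (-d))
    (h0 : ∀ s ∈ Ico 0 P, p (x s) (y s) (Real.cos (θ s)) (Real.sin (θ s))) (s : ℝ) :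
    p (x s) (y s) (Real.cos (θ s)) (Real.sin (θ s)) := by
  have hstep : ∀ s, p (x s) (y s) (Real.cos (θ s)) (Real.sin (θ s)) ↔
      p (x (s + P)) (y (s + P)) (Real.cos (θ (s + P))) (Real.sin (θ (s + P))) := fun s => by
    rw [h.x_add, h.y_add, h.angle_add, Real.cos_add_pi, Real.sin_add_pi]
    exact ⟨hneg _ _ _ _, fun h => by simpa using hneg _ _ _ _ h⟩
  have hper : Function.Periodic
      (fun s => p (x s) (y s) (Real.cos (θ s)) (Real.sin (θ s))) P :=
    fun s => propext (hstep s).symm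
  obtain ⟨t, ht, hst⟩ := hper.exists_mem_Ico₀ h.pos s
  exact hst.mpr (h0 t ht)

/-- The second half of the curve is the negative of the first. Embeddedness thus needs only that one
half is injective and contains no two opposite points; the case of equal parameters excludes the
origin. -/
theorem IsCentralLoop.injOn_of_Ico (h : IsCentralLoop θ x y P) (a : ℝ)
    (hinj : ∀ s ∈ Ico a (a + P), ∀ t ∈ Ico a (a + P), x s = x t → y s = y t → s = t)
    (hne : ∀ s ∈ Ico a (a + P), ∀ t ∈ Ico a (a + P), x s = -x t → y s = -y t → False) :
    ∀ s ∈ Ico 0 (2 * P), ∀ t ∈ Ico 0 (2 * P), x s = x t → y s = y t → s = t := by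
  have hP := h.pos
  have hL : 0 < 2 * P := by linarith
  have hpx : Function.Periodic x (2 * P) := fun s => by
    rw [two_mul, ← add_assoc, h.x_add, h.x_add, neg_neg]
  have hpy : Function.Periodic y (2 * P) := fun s => by
    rw [two_mul, ← add_assoc, h.y_add, h.y_add, neg_neg]
  have key : ∀ s ∈ Ico a (a + 2 * P), ∀ t ∈ Ico a (a + 2 * P), x s = x t → y s = y t → s = t := by
    have hx : ∀ s, x s = -x (s - P) := fun s => by rw [← h.x_add, sub_add_cancel]
    have hy : ∀ s, y s = -y (s - P) := fun s => by rw [← h.y_add, sub_add_cancel]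
    intro s hs t ht hxst hyst
    rcases lt_or_ge s (a + P) with h1 | h1 <;> rcases lt_or_ge t (a + P) with h2 | h2
    · exact hinj s ⟨hs.1, h1⟩ t ⟨ht.1, h2⟩ hxst hyst
    · exact (hne s ⟨hs.1, h1⟩ (t - P) ⟨by linarith, by linarith [ht.2]⟩ (hxst.trans (hx t))
        (hyst.trans (hy t))).elim
    · exact (hne t ⟨ht.1, h2⟩ (s - P) ⟨by linarith, by linarith [hs.2]⟩ (hxst.symm.trans (hx s))
        (hyst.symm.trans (hy s))).elim
    · rw [hx s, hx t, neg_inj] at hxst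
      rw [hy s, hy t, neg_inj] at hyst
      have := hinj (s - P) ⟨by linarith, by linarith [hs.2]⟩ (t - P)
        ⟨by linarith, by linarith [ht.2]⟩ hxst hyst
      linarith
  intro s hs t ht hxst hyst
  have hm : ∀ f : ℝ → ℝ, Function.Periodic f (2 * P) → ∀ r, f (toIcoMod hL a r) = f r :=
    fun f hf r => hf.sub_zsmul_eq _
  have h1 := key _ (toIcoMod_mem_Ico hL a s) _ (toIcoMod_mem_Ico hL a t)
    (by rw [hm x hpx, hm x hpx, hxst]) (by rw [hm y hpy, hm y hpy, hyst])
  have h2 := congrArg (toIcoMod hL 0) h1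
  rw [toIcoMod_toIcoMod, toIcoMod_toIcoMod] at h2
  rwa [(toIcoMod_eq_self hL).2 (by simpa using hs), (toIcoMod_eq_self hL).2 (by simpa using ht)] at h2

end PlanarLoops

/-! ### The stadium curve as a thin knot -/

section StadiumCurve

/-- The angle of the outward normal along half of a stadium curve: a half-circle and a segment. -/
noncomputable def stadiumAngle (s : ℝ) : ℝ := min s Real.pi - Real.pi / 2

theorem exists_stadiumLoop : ∃ θ x y : ℝ → ℝ, IsCentralLoop θ x y (Real.pi + 1) ∧
    (∀ s ∈ Icc 0 Real.pi, θ s = s - Real.pi / 2) ∧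
    ∀ s ∈ Icc Real.pi (Real.pi + 1), θ s = Real.pi / 2 := by
  have hpi := Real.pi_pos
  have hP : 0 < Real.pi + 1 := by linarith
  have h0 : stadiumAngle (Real.pi + 1) = stadiumAngle 0 + Real.pi := by
    rw [stadiumAngle, stadiumAngle, min_eq_right (by linarith), min_eq_left (by linarith)]
    ring
  have hθ := fun s => @turningAngle_of_mem stadiumAngle (Real.pi + 1) s
  have h1 : ∀ s ∈ Icc 0 Real.pi, turningAngle stadiumAngle (Real.pi + 1) s = s - Real.pi / 2 :=
    fun s hs => by
      rw [hθ s hP h0 ⟨hs.1, by linarith [hs.2]⟩, stadiumAngle, min_eq_left hs.2]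
  have h2 : ∀ s ∈ Icc Real.pi (Real.pi + 1),
      turningAngle stadiumAngle (Real.pi + 1) s = Real.pi / 2 := fun s hs => by
    rw [hθ s hP h0 ⟨by linarith [hs.1], hs.2⟩, stadiumAngle, min_eq_right hs.1]
    ring
  obtain ⟨x, y, hxy⟩ := exists_isCentralLoop hP
    (continuous_turningAngle h0 (by unfold stadiumAngle; fun_prop)) (turningAngle_add hP)
    ((PiecewiseAffine.refl.snoc hpi (κ := 1) (d := -(Real.pi / 2)) (by simp)
      fun r hr => by rw [h1 r hr]; ring).snoc (by linarith) (κ := 0) (d := Real.pi / 2) (by simp)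
      fun r hr => by rw [h2 r hr]; ring)
  exact ⟨_, x, y, hxy, h1, h2⟩

variable {θ x y : ℝ → ℝ}

/-- Integration leaves the starting point free; central symmetry after half the length fixes it. -/
theorem IsCentralLoop.stadium_coordinates (h : IsCentralLoop θ x y (Real.pi + 1))
    (h1 : ∀ s ∈ Icc 0 Real.pi, θ s = s - Real.pi / 2)
    (h2 : ∀ s ∈ Icc Real.pi (Real.pi + 1), θ s = Real.pi / 2) :
    (∀ s ∈ Icc 0 Real.pi, x s = 1 / 2 + Real.cos (θ s) ∧ y s = Real.sin (θ s)) ∧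
      ∀ s ∈ Icc Real.pi (Real.pi + 1), x s = 1 / 2 - (s - Real.pi) ∧ y s = 1 := by
  have hpi := Real.pi_pos
  have e1 : ∀ s ∈ Icc 0 Real.pi, x s = x 0 + Real.cos (θ s) ∧ y s = y 0 + Real.sin (θ s) + 1 := by
    intro s hs
    have := h.arc (κ := 1) (c := -(Real.pi / 2)) (fun r hr => by rw [h1 r hr]; ring) hs
    rw [h1 0 ⟨le_rfl, hpi.le⟩, zero_sub, Real.cos_neg, Real.sin_neg, Real.cos_pi_div_two,
      Real.sin_pi_div_two] at this
    constructor <;> linarith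
  have e2 := e1 Real.pi ⟨hpi.le, le_rfl⟩
  rw [h1 _ ⟨hpi.le, le_rfl⟩, show Real.pi - Real.pi / 2 = Real.pi / 2 by ring, Real.cos_pi_div_two,
      Real.sin_pi_div_two] at e2
  have e3 : ∀ s ∈ Icc Real.pi (Real.pi + 1), x s = x 0 - (s - Real.pi) ∧ y s = y 0 + 2 := by
    intro s hs
    have := h.line h2 hs
    rw [Real.cos_pi_div_two, Real.sin_pi_div_two] at this
    constructor <;> linarith
  have e4 := e3 (Real.pi + 1) ⟨by linarith, le_rfl⟩
  have hx0 : x 0 = 1 / 2 := by linarith [h.x_end]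
  have hy0 : y 0 = -1 := by linarith [h.y_end]
  rw [hx0, hy0] at e1 e3
  refine ⟨fun s hs => ⟨(e1 s hs).1, by linarith [(e1 s hs).2]⟩,
    fun s hs => ⟨(e3 s hs).1, by linarith [(e3 s hs).2]⟩⟩

/-- A point of the stadium curve is at distance `1` from a point `(q, 0)` of its core segment, in
the direction of the outward normal `(c, d)`. -/
def StadiumPoint (x y c d : ℝ) : Prop :=
  c ^ 2 + d ^ 2 = 1 ∧ y = d ∧ |x - c| ≤ 1 / 2 ∧ (0 < c → x = 1 / 2 + c) ∧ (c < 0 → x = -(1 / 2) + c)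

theorem IsCentralLoop.stadiumPoint (h : IsCentralLoop θ x y (Real.pi + 1))
    (h1 : ∀ s ∈ Icc 0 Real.pi, θ s = s - Real.pi / 2)
    (h2 : ∀ s ∈ Icc Real.pi (Real.pi + 1), θ s = Real.pi / 2) (s : ℝ) :
    StadiumPoint (x s) (y s) (Real.cos (θ s)) (Real.sin (θ s)) := by
  obtain ⟨e1, e2⟩ := h.stadium_coordinates h1 h2
  revert s
  refine h.forall_of_Ico (fun x y c d hp => ?_) fun s hs => ?_
  · obtain ⟨h1, h2, h3, h4, h5⟩ := hp
    refine ⟨by linarith, by linarith, by rwa [neg_sub_neg, abs_sub_comm], fun h => ?_, fun h => ?_⟩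
    · linarith [h5 (by linarith)]
    · linarith [h4 (by linarith)]
  · refine ⟨Real.cos_sq_add_sin_sq _, ?_⟩
    rcases le_total s Real.pi with hsp | hsp
    · have hs' : s ∈ Icc 0 Real.pi := ⟨hs.1, hsp⟩
      have hc : 0 ≤ Real.cos (θ s) := by
        rw [h1 s hs']
        exact Real.cos_nonneg_of_mem_Icc ⟨by linarith [hs.1], by linarith⟩
      rw [(e1 s hs').1]
      exact ⟨(e1 s hs').2, by norm_num, fun _ => rfl, fun h => absurd h (not_lt.2 hc)⟩
    · have hs' : s ∈ Icc Real.pi (Real.pi + 1) := ⟨hsp, hs.2.le⟩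
      rw [(e2 s hs').1, (e2 s hs').2, h2 s hs', Real.sin_pi_div_two, Real.cos_pi_div_two]
      exact ⟨rfl, abs_le.2 ⟨by linarith [hs'.2], by linarith⟩, fun h => absurd h (lt_irrefl _),
        fun h => absurd h (lt_irrefl _)⟩

/-- Parallel unit vectors of the plane are equal or opposite. -/
theorem eq_or_eq_neg_of_parallel {a b X Y c d : ℝ} (h1 : a ^ 2 + b ^ 2 = 1) (h2 : c ^ 2 + d ^ 2 = 1)
    (hne : ¬ (X = 0 ∧ Y = 0)) (hab : X * b = Y * a) (hcd : X * d = Y * c) :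
    (c = a ∧ d = b) ∨ (c = -a ∧ d = -b) := by
  have h3 : a * d - b * c = 0 := by
    by_contra h
    refine hne ⟨?_, ?_⟩
    · refine (mul_eq_zero.1 (?_ : X * (a * d - b * c) = 0)).resolve_right h
      linear_combination a * hcd - c * hab
    · refine (mul_eq_zero.1 (?_ : Y * (a * d - b * c) = 0)).resolve_right h
      linear_combination b * hcd - d * hab
  have h4 : (a * c + b * d) ^ 2 = 1 := by
    linear_combination (c ^ 2 + d ^ 2) * h1 + h2 - (a * d - b * c) * h3
  have hc : c = a * (a * c + b * d) := by linear_combination (-c) * h1 - b * h3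
  have hd : d = b * (a * c + b * d) := by linear_combination (-d) * h1 + a * h3
  rcases mul_self_eq_one_iff.1 ((sq _).symm.trans h4) with h | h
  · left; rw [h] at hc hd; constructor <;> linarith
  · right; rw [h] at hc hd; constructor <;> linarith

/-- The normals at the ends of a doubly critical chord are equal or opposite. Equal normals force
the points to coincide or the chord to be tangential to a straight side, which is impossible.
Opposite normals belong to opposite sides or opposite half-circles. -/
theorem StadiumPoint.one_le {x y c d x' y' c' d' : ℝ} (h : StadiumPoint x y c d)
    (h' : StadiumPoint x' y' c' d') (hne : ¬ (x = x' ∧ y = y'))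
    (h1 : (x - x') * d = (y - y') * c) (h2 : (x - x') * d' = (y - y') * c') :
    1 ≤ (x - x') ^ 2 + (y - y') ^ 2 := by
  obtain ⟨a1, a2, a3, a4, a5⟩ := h
  obtain ⟨b1, b2, b3, b4, b5⟩ := h'
  have hne' : ¬ (x - x' = 0 ∧ y - y' = 0) := by rwa [sub_eq_zero, sub_eq_zero]
  rcases eq_or_eq_neg_of_parallel a1 b1 hne' h1 h2 with ⟨rfl, rfl⟩ | ⟨rfl, rfl⟩
  · exfalso
    have hy : y = y' := by rw [a2, b2]
    have hx : x - x' ≠ 0 := fun h => hne ⟨by linarith, hy⟩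
    have hd : d' = 0 := by
      rw [hy, sub_self, zero_mul] at h1
      exact (mul_eq_zero.1 h1).resolve_left hx
    rcases lt_trichotomy c' 0 with hc | hc | hc
    · exact hx (by linarith [a5 hc, b5 hc])
    · rw [hc, hd] at a1; norm_num at a1
    · exact hx (by linarith [a4 hc, b4 hc])
  · rcases lt_trichotomy c 0 with hc | hc | hc
    · have := a5 hc
      have := b4 (by linarith)
      nlinarith [sq_nonneg (y - y')]
    · have : y - y' = 2 * d := by rw [a2, b2]; ring
      rw [this]
      nlinarith [sq_nonneg (x - x')]
    · have := a4 hc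
      have := b5 (by linarith)
      nlinarith [sq_nonneg (y - y')]

theorem IsCentralLoop.stadium_injOn (h : IsCentralLoop θ x y (Real.pi + 1))
    (h1 : ∀ s ∈ Icc 0 Real.pi, θ s = s - Real.pi / 2)
    (h2 : ∀ s ∈ Icc Real.pi (Real.pi + 1), θ s = Real.pi / 2) :
    ∀ s ∈ Ico 0 (2 * (Real.pi + 1)), ∀ t ∈ Ico 0 (2 * (Real.pi + 1)),
      x s = x t → y s = y t → s = t := by
  obtain ⟨e1, e2⟩ := h.stadium_coordinates h1 h2
  have e3 : ∀ s ∈ Ico 0 (Real.pi + 1), (s ∈ Icc 0 Real.pi ∧ y s < 1 ∧ 1 / 2 ≤ x s ∧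
      y s = Real.sin (s - Real.pi / 2)) ∨ (y s = 1 ∧ x s = 1 / 2 - (s - Real.pi) ∧
      -(1 / 2) < x s) := by
    intro s hs
    rcases lt_or_ge s Real.pi with hsp | hsp
    · have hs' : s ∈ Icc 0 Real.pi := ⟨hs.1, hsp.le⟩
      have hc : 0 ≤ Real.cos (θ s) := by
        rw [h1 s hs']
        exact Real.cos_nonneg_of_mem_Icc ⟨by linarith [hs.1], by linarith⟩
      have hy : y s = Real.sin (s - Real.pi / 2) := by rw [(e1 s hs').2, h1 s hs']
      refine .inl ⟨hs', ?_, by linarith [(e1 s hs').1], hy⟩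
      rw [hy, ← Real.sin_pi_div_two]
      exact Real.sin_lt_sin_of_lt_of_le_pi_div_two (by linarith [hs.1]) le_rfl (by linarith)
    · have := e2 s ⟨hsp, hs.2.le⟩
      exact .inr ⟨this.2, this.1, by linarith [hs.2]⟩
  refine h.injOn_of_Ico 0 ?_ ?_ <;> rw [zero_add] <;> intro s hs t ht hx hy
  · rcases e3 s hs with ⟨a1, a2, a3, a4⟩ | ⟨a1, a2, a3⟩ <;>
      rcases e3 t ht with ⟨b1, b2, b3, b4⟩ | ⟨b1, b2, b3⟩
    · have := Real.injOn_sin ⟨by linarith [a1.1], by linarith [a1.2]⟩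
        ⟨by linarith [b1.1], by linarith [b1.2]⟩ (a4.symm.trans (hy.trans b4))
      linarith
    all_goals linarith
  · rcases e3 s hs with ⟨a1, a2, a3, a4⟩ | ⟨a1, a2, a3⟩ <;>
      rcases e3 t ht with ⟨b1, b2, b3, b4⟩ | ⟨b1, b2, b3⟩
    · linarith
    · have := (e1 s a1).2
      have h3 := Real.cos_sq_add_sin_sq (θ s)
      have h4 : Real.cos (θ s) ^ 2 = 0 := by nlinarith
      have := (e1 s a1).1
      rw [pow_eq_zero_iff two_ne_zero] at h4
      linarith
    · have := (e1 t b1).2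
      have h3 := Real.cos_sq_add_sin_sq (θ t)
      have h4 : Real.cos (θ t) ^ 2 = 0 := by nlinarith
      have := (e1 t b1).1
      rw [pow_eq_zero_iff two_ne_zero] at h4
      linarith
    · linarith

theorem norm_single_one (i : Fin 3) : ‖(EuclideanSpace.single i 1 : E3)‖ = 1 := by simp

theorem inner_single_single {i j : Fin 3} (h : i ≠ j) :
    inner ℝ (EuclideanSpace.single i 1 : E3) (EuclideanSpace.single j 1) = 0 := by
  simp [EuclideanSpace.inner_single_left, h]

theorem dist_sq_coordinates (p q : E3) :
    dist p q ^ 2 = (p 0 - q 0) ^ 2 + (p 1 - q 1) ^ 2 + (p 2 - q 2) ^ 2 := by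
  rw [EuclideanSpace.dist_sq_eq, Fin.sum_univ_three]
  simp [Real.dist_eq, sq_abs]

theorem mem_segment_single {u v : ℝ} (huv : u ≤ v) {p : E3} :
    p ∈ segment ℝ (EuclideanSpace.single 0 u) (EuclideanSpace.single 0 v : E3) ↔
      ∃ q ∈ Icc u v, p = EuclideanSpace.single 0 q := by
  have hlin : ∀ t : ℝ, (EuclideanSpace.single 0 t : E3) = t • EuclideanSpace.single 0 1 := by
    intro t; ext i; fin_cases i <;> simp
  have := image_segment ℝ ((LinearMap.id (R := ℝ) (M := ℝ)).smulRight
    (EuclideanSpace.single 0 1 : E3)).toAffineMap u v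
  simp only [LinearMap.coe_toAffineMap, LinearMap.smulRight_apply, LinearMap.id_apply,
    ← hlin] at this
  rw [← this, segment_eq_Icc huv]
  exact ⟨fun ⟨q, h1, h2⟩ => ⟨q, h1, h2.symm.trans (hlin q).symm⟩,
    fun ⟨q, h1, h2⟩ => ⟨q, h1, (hlin q).symm.trans h2.symm⟩⟩

/-- The stadium around the segment `[-1/2, 1/2]` of the first coordinate axis. -/
theorem mem_stadium_single_iff {p : E3} :
    p ∈ stadium (EuclideanSpace.single 0 (1 / 2)) (EuclideanSpace.single 0 (-(1 / 2))) ↔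
      p 2 = 0 ∧ ∃ c, StadiumPoint (p 0) (p 1) c (p 1) := by
  rw [stadium_comm]
  have hd : ∀ q : ℝ, p 2 = 0 → dist p (EuclideanSpace.single 0 q) ^ 2 =
      (p 0 - q) ^ 2 + p 1 ^ 2 := fun q h => by rw [dist_sq_coordinates]; simp [h]
  constructor
  · rintro ⟨h2, hinf⟩
    refine ⟨h2, ?_⟩
    have hle : ∀ q ∈ Icc (-(1 / 2) : ℝ) (1 / 2), 1 ≤ (p 0 - q) ^ 2 + p 1 ^ 2 := fun q hq => by
      rw [← hd q h2, one_le_sq_iff₀ dist_nonneg, ← hinf]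
      exact Metric.infDist_le_dist_of_mem ((mem_segment_single (by norm_num)).2 ⟨q, hq, rfl⟩)
    have hcomp : IsCompact (segment ℝ (EuclideanSpace.single 0 (-(1 / 2)))
        (EuclideanSpace.single 0 (1 / 2) : E3)) := by
      rw [← convexHull_pair (𝕜 := ℝ)]; exact (Set.toFinite _).isCompact_convexHull ℝ
    obtain ⟨z, hz, hz'⟩ := hcomp.exists_infDist_eq_dist
      ⟨EuclideanSpace.single 0 (-(1 / 2)), left_mem_segment ℝ _ _⟩ p
    obtain ⟨q, hq, rfl⟩ := (mem_segment_single (by norm_num)).1 hz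
    have heq : (p 0 - q) ^ 2 + p 1 ^ 2 = 1 := by rw [← hd q h2, ← hz', hinf, one_pow]
    -- The centre is the nearest point `q` of the core segment. If `p` lay to the right of `q` and
    -- `q` were not the right end, moving `q` towards `p` would shorten the distance; likewise on
    -- the left.
    refine ⟨p 0 - q, heq, rfl, ?_, fun h => ?_, fun h => ?_⟩
    · rw [sub_sub_cancel]; exact abs_le.2 hq
    · have := hle (min (1 / 2) (p 0)) ⟨le_min (by norm_num) (by linarith [hq.1]), min_le_left _ _⟩
      rcases min_cases (1 / 2) (p 0) with ⟨h3, h4⟩ | ⟨h3, h4⟩ <;> rw [h3] at this <;>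
        nlinarith [hq.2]
    · have := hle (max (-(1 / 2)) (p 0)) ⟨le_max_left _ _, max_le (by norm_num) (by linarith [hq.2])⟩
      rcases max_cases (-(1 / 2)) (p 0) with ⟨h3, h4⟩ | ⟨h3, h4⟩ <;> rw [h3] at this <;>
        nlinarith [hq.1]
  · rintro ⟨h2, c, h1, -, h3, h4, h5⟩
    have h3' := abs_le.1 h3
    refine mem_stadium_of_dist h2 ((mem_segment_single (by norm_num)).2 ⟨p 0 - c, h3', rfl⟩) ?_ ?_
    · rw [← pow_eq_one_iff_of_nonneg dist_nonneg two_ne_zero, hd _ h2, sub_sub_cancel, h1]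
    · intro z hz
      obtain ⟨q, hq, rfl⟩ := (mem_segment_single (by norm_num)).1 hz
      rw [← one_le_sq_iff₀ dist_nonneg, hd _ h2, ← h1]
      rcases lt_trichotomy c 0 with hc | hc | hc
      · nlinarith [h5 hc, hq.1]
      · rw [hc]; nlinarith [sq_nonneg (p 0 - q)]
      · nlinarith [h4 hc, hq.2]

theorem planarCurve_zero_one (s : ℝ) :
    planarCurve (EuclideanSpace.single 0 1) (EuclideanSpace.single 1 1) x y s = !₂[x s, y s, 0] := by
  ext i; fin_cases i <;> simp [planarCurve]

theorem IsCentralLoop.range_eq_stadium (h : IsCentralLoop θ x y (Real.pi + 1))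
    (h1 : ∀ s ∈ Icc 0 Real.pi, θ s = s - Real.pi / 2)
    (h2 : ∀ s ∈ Icc Real.pi (Real.pi + 1), θ s = Real.pi / 2) :
    range (planarCurve (EuclideanSpace.single 0 1) (EuclideanSpace.single 1 1) x y) =
      stadium (EuclideanSpace.single 0 (1 / 2)) (EuclideanSpace.single 0 (-(1 / 2))) := by
  have hpi := Real.pi_pos
  obtain ⟨e1, e2⟩ := h.stadium_coordinates h1 h2
  ext p
  rw [mem_stadium_single_iff]
  constructor
  · rintro ⟨s, rfl⟩
    rw [planarCurve_zero_one]
    refine ⟨rfl, Real.cos (θ s), ?_⟩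
    have := h.stadiumPoint h1 h2 s
    have h3 := this.2.1
    simpa [h3] using this
  -- These normals occur on the half of the curve with explicit coordinates; all others are reached
  -- by central symmetry.
  · have key : ∀ X Y c : ℝ, StadiumPoint X Y c Y → (0 < c ∨ (c = 0 ∧ Y = 1)) →
        ∃ s, x s = X ∧ y s = Y := by
      rintro X Y c ⟨h3, -, h4, h5, h6⟩ (hc | ⟨rfl, rfl⟩)
      · have hY : Y ∈ Icc (-1) 1 := abs_le.1 ((sq_le_one_iff_abs_le_one Y).1 (by nlinarith))
        have hs : Real.arcsin Y + Real.pi / 2 ∈ Icc 0 Real.pi :=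
          ⟨by linarith [Real.neg_pi_div_two_le_arcsin Y], by linarith [Real.arcsin_le_pi_div_two Y]⟩
        refine ⟨Real.arcsin Y + Real.pi / 2, ?_, ?_⟩
        · rw [(e1 _ hs).1, h1 _ hs, add_sub_cancel_right, Real.cos_arcsin, h5 hc,
            show 1 - Y ^ 2 = c ^ 2 by linarith, Real.sqrt_sq hc.le]
        · rw [(e1 _ hs).2, h1 _ hs, add_sub_cancel_right, Real.sin_arcsin hY.1 hY.2]
      · rw [sub_zero, abs_le] at h4
        have := e2 (Real.pi + (1 / 2 - X)) ⟨by linarith, by linarith⟩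
        exact ⟨_, by linarith [this.1], this.2⟩
    rintro ⟨hp, c, h3⟩
    have h4 : ∃ s, x s = p 0 ∧ y s = p 1 := by
      rcases lt_trichotomy c 0 with hc | hc | hc
      · obtain ⟨s, hs1, hs2⟩ := key (-p 0) (-p 1) (-c)
          ⟨by linarith [h3.1], rfl, by rw [neg_sub_neg, abs_sub_comm]; exact h3.2.2.1,
            fun _ => by linarith [h3.2.2.2.2 hc], fun h => by linarith⟩ (.inl (by linarith))
        exact ⟨s + (Real.pi + 1), by rw [h.x_add, hs1, neg_neg], by rw [h.y_add, hs2, neg_neg]⟩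
      · have hp1 : p 1 ^ 2 = 1 := by have := h3.1; rw [hc] at this; linarith
        rcases mul_self_eq_one_iff.1 ((sq _).symm.trans hp1) with h4 | h4
        · exact key _ _ c h3 (.inr ⟨hc, h4⟩)
        · obtain ⟨s, hs1, hs2⟩ := key (-p 0) (-p 1) 0
            ⟨by linarith, rfl, by have := h3.2.2.1; rwa [hc, sub_zero, ← abs_neg, ← sub_zero (-p 0)]
              at this, fun h => by linarith, fun h => by linarith⟩ (.inr ⟨rfl, by linarith⟩)
          exact ⟨s + (Real.pi + 1), by rw [h.x_add, hs1, neg_neg], by rw [h.y_add, hs2, neg_neg]⟩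
      · exact key _ _ c h3 (.inl hc)
    obtain ⟨s, hs1, hs2⟩ := h4
    refine ⟨s, ?_⟩
    rw [planarCurve_zero_one]
    ext i; fin_cases i <;> simp [hs1, hs2, hp]

theorem exists_isThinCore_stadium : ∃ β : ℝ → E3, IsThinCore 1 (2 * Real.pi + 2) β ∧
    range β = stadium (EuclideanSpace.single 0 (1 / 2)) (EuclideanSpace.single 0 (-(1 / 2))) := by
  obtain ⟨θ, x, y, h, h1, h2⟩ := exists_stadiumLoop
  refine ⟨_, ?_, h.range_eq_stadium h1 h2⟩
  rw [show 2 * Real.pi + 2 = 2 * (Real.pi + 1) by ring]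
  exact h.isThinCore (norm_single_one 0) (norm_single_one 1) (inner_single_single (by decide))
    (h.stadium_injOn h1 h2) fun u v => (h.stadiumPoint h1 h2 u).one_le (h.stadiumPoint h1 h2 v)

end StadiumCurve

/-! ### The dumbbell curve and its doubly critical chords -/

section DumbbellCurve

/-- The angle of each of the four unit arcs of a dumbbell curve. -/
noncomputable def neckAngle : ℝ := Real.arccos (3 / 5)

theorem cos_neckAngle : Real.cos neckAngle = 3 / 5 :=
  Real.cos_arccos (by norm_num) (by norm_num)

theorem sin_neckAngle : Real.sin neckAngle = 4 / 5 := by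
  rw [neckAngle, Real.sin_arccos, show (1 : ℝ) - (3 / 5) ^ 2 = (4 / 5) ^ 2 by norm_num,
    Real.sqrt_sq (by norm_num)]

theorem neckAngle_pos : 0 < neckAngle := Real.arccos_pos.2 (by norm_num)

theorem neckAngle_lt : neckAngle < Real.pi / 2 := by
  rw [neckAngle, Real.arccos_lt_pi_div_two]; norm_num

/-- The length of each of the two arcs of radius `3 / 2` of a dumbbell curve. -/
noncomputable def capLength : ℝ := 3 * neckAngle + 3 * Real.pi / 2

/-- Half of the length of the dumbbell curve whose strands have length `2 * h`. -/
noncomputable def dumbbellHalfLength (h : ℝ) : ℝ := 2 * h + 2 * neckAngle + capLength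

/-- The angle of the outward normal along half of a dumbbell curve: a segment of length `2 * h`, an
arc of curvature `-1`, an arc of curvature `2 / 3` and another arc of curvature `-1`. -/
noncomputable def dumbbellAngle (h s : ℝ) : ℝ :=
  -max 0 (min (s - 2 * h) neckAngle) +
    2 / 3 * max 0 (min (s - 2 * h - neckAngle) capLength) -
    max 0 (s - 2 * h - neckAngle - capLength)

/-- A dumbbell curve, with the values of the angle on half of the curve. -/
structure IsDumbbellLoop (θ x z : ℝ → ℝ) (h : ℝ) : Prop where
  one_le : 1 ≤ h
  isCentralLoop : IsCentralLoop θ x z (dumbbellHalfLength h)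
  angle₁ : ∀ s ∈ Icc 0 (2 * h), θ s = 0
  angle₂ : ∀ s ∈ Icc (2 * h) (2 * h + neckAngle), θ s = 2 * h + -1 * s
  angle₃ : ∀ s ∈ Icc (2 * h + neckAngle) (2 * h + neckAngle + capLength),
    θ s = -neckAngle - 2 / 3 * (2 * h + neckAngle) + 2 / 3 * s
  angle₄ : ∀ s ∈ Icc (2 * h + neckAngle + capLength) (dumbbellHalfLength h),
    θ s = Real.pi + dumbbellHalfLength h + -1 * s

theorem capLength_pos : 0 < capLength := by
  unfold capLength; linarith [neckAngle_pos, Real.pi_pos]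

theorem exists_isDumbbellLoop {h : ℝ} (hh : 1 ≤ h) : ∃ θ x z : ℝ → ℝ, IsDumbbellLoop θ x z h := by
  have hα := neckAngle_pos
  have hw := capLength_pos
  have hP : dumbbellHalfLength h = 2 * h + 2 * neckAngle + capLength := rfl
  have hw' : capLength = 3 * neckAngle + 3 * Real.pi / 2 := rfl
  have hP0 : 0 < dumbbellHalfLength h := by linarith
  have a1 : ∀ s ∈ Icc 0 (2 * h), dumbbellAngle h s = 0 := fun s hs => by
    rw [dumbbellAngle, max_eq_left, max_eq_left, max_eq_left]
    · simp
    · linarith [hs.2]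
    · exact (min_le_left _ _).trans (by linarith [hs.2])
    · exact (min_le_left _ _).trans (by linarith [hs.2])
  have a2 : ∀ s ∈ Icc (2 * h) (2 * h + neckAngle), dumbbellAngle h s = 2 * h + -1 * s :=
    fun s hs => by
      rw [dumbbellAngle, min_eq_left (by linarith [hs.2]), max_eq_right (by linarith [hs.1]),
        max_eq_left, max_eq_left]
      · ring
      · linarith [hs.2]
      · exact (min_le_left _ _).trans (by linarith [hs.2])
  have a3 : ∀ s ∈ Icc (2 * h + neckAngle) (2 * h + neckAngle + capLength),
      dumbbellAngle h s = -neckAngle - 2 / 3 * (2 * h + neckAngle) + 2 / 3 * s := fun s hs => by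
    rw [dumbbellAngle, min_eq_right (by linarith [hs.1]), max_eq_right hα.le,
      min_eq_left (by linarith [hs.2]), max_eq_right (by linarith [hs.1]),
      max_eq_left (by linarith [hs.2])]
    ring
  have a4 : ∀ s ∈ Icc (2 * h + neckAngle + capLength) (dumbbellHalfLength h),
      dumbbellAngle h s = Real.pi + dumbbellHalfLength h + -1 * s := fun s hs => by
    rw [dumbbellAngle, min_eq_right (by linarith [hs.1]), max_eq_right hα.le,
      min_eq_right (by linarith [hs.1]), max_eq_right hw.le,
      max_eq_right (by linarith [hs.1]), hP, hw']
    ring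
  have h0 : dumbbellAngle h (dumbbellHalfLength h) = dumbbellAngle h 0 + Real.pi := by
    rw [a1 0 ⟨le_rfl, by linarith⟩, a4 _ ⟨by linarith, le_rfl⟩]; ring
  have key : ∀ s ∈ Icc 0 (dumbbellHalfLength h),
      turningAngle (dumbbellAngle h) (dumbbellHalfLength h) s = dumbbellAngle h s :=
    fun s hs => turningAngle_of_mem hP0 h0 hs
  have b1 : ∀ s ∈ Icc 0 (2 * h),
      turningAngle (dumbbellAngle h) (dumbbellHalfLength h) s = 0 := fun s hs =>
    (key s ⟨hs.1, by linarith [hs.2]⟩).trans (a1 s hs)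
  have b2 : ∀ s ∈ Icc (2 * h) (2 * h + neckAngle),
      turningAngle (dumbbellAngle h) (dumbbellHalfLength h) s = 2 * h + -1 * s := fun s hs =>
    (key s ⟨by linarith [hs.1], by linarith [hs.2]⟩).trans (a2 s hs)
  have b3 : ∀ s ∈ Icc (2 * h + neckAngle) (2 * h + neckAngle + capLength),
      turningAngle (dumbbellAngle h) (dumbbellHalfLength h) s =
        -neckAngle - 2 / 3 * (2 * h + neckAngle) + 2 / 3 * s := fun s hs =>
    (key s ⟨by linarith [hs.1], by linarith [hs.2]⟩).trans (a3 s hs)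
  have b4 : ∀ s ∈ Icc (2 * h + neckAngle + capLength) (dumbbellHalfLength h),
      turningAngle (dumbbellAngle h) (dumbbellHalfLength h) s =
        Real.pi + dumbbellHalfLength h + -1 * s := fun s hs =>
    (key s ⟨by linarith [hs.1], hs.2⟩).trans (a4 s hs)
  obtain ⟨x, z, hxz⟩ := exists_isCentralLoop hP0
    (continuous_turningAngle h0 (by unfold dumbbellAngle; fun_prop)) (turningAngle_add hP0)
    ((((PiecewiseAffine.refl.snoc (by linarith) (κ := 0) (d := 0) (by simp)
        fun r hr => by rw [b1 r hr]; ring).snoc (by linarith) (by simp) b2).snoc (by linarith)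
        (by rw [abs_of_pos] <;> norm_num) b3).snoc (by linarith) (by simp) b4)
  exact ⟨_, x, z, hh, hxz, b1, b2, b3, b4⟩

variable {θ x z : ℝ → ℝ} {h : ℝ}

/-- The unit neck arcs at the top have centres (±3/2, h), the cap has centre (0, h + 2) and radius
3/2. The centres are at distance 5/2 = 1 + 3/2, a 3-4-5 triangle, so the arcs join tangentially;
this is the origin of the neck angle with cosine 3/5. -/
theorem IsDumbbellLoop.coordinates (H : IsDumbbellLoop θ x z h) :
    (∀ s ∈ Icc 0 (2 * h), x s = 1 / 2 ∧ z s = s - h) ∧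
      (∀ s ∈ Icc (2 * h) (2 * h + neckAngle),
        x s = 3 / 2 - Real.cos (θ s) ∧ z s = h - Real.sin (θ s)) ∧
      (∀ s ∈ Icc (2 * h + neckAngle) (2 * h + neckAngle + capLength),
        x s = 3 / 2 * Real.cos (θ s) ∧ z s = h + 2 + 3 / 2 * Real.sin (θ s)) ∧
      ∀ s ∈ Icc (2 * h + neckAngle + capLength) (dumbbellHalfLength h),
        x s = -(3 / 2) - Real.cos (θ s) ∧ z s = h - Real.sin (θ s) := by
  have hα := neckAngle_pos
  have hw := capLength_pos
  have hP : dumbbellHalfLength h = 2 * h + 2 * neckAngle + capLength := rfl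
  have hw' : capLength = 3 * neckAngle + 3 * Real.pi / 2 := rfl
  have hh := H.one_le
  have H' := H.isCentralLoop
  have e1 : ∀ s ∈ Icc 0 (2 * h), x s = x 0 ∧ z s = z 0 + s := fun s hs => by
    have := H'.line H.angle₁ hs
    simpa using this
  have f1 := e1 (2 * h) ⟨by linarith, le_rfl⟩
  have e2 : ∀ s ∈ Icc (2 * h) (2 * h + neckAngle),
      x s = x 0 + 1 - Real.cos (θ s) ∧ z s = z 0 + 2 * h - Real.sin (θ s) := fun s hs => by
    have := H'.arc H.angle₂ hs
    rw [H.angle₁ (2 * h) ⟨by linarith, le_rfl⟩, Real.cos_zero, Real.sin_zero] at this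
    constructor <;> linarith
  have f2 := e2 (2 * h + neckAngle) ⟨by linarith, le_rfl⟩
  have t2 : θ (2 * h + neckAngle) = -neckAngle := by
    rw [H.angle₂ _ ⟨by linarith, le_rfl⟩]; ring
  rw [t2, Real.cos_neg, Real.sin_neg, cos_neckAngle, sin_neckAngle] at f2
  have e3 : ∀ s ∈ Icc (2 * h + neckAngle) (2 * h + neckAngle + capLength),
      x s = x 0 - 1 / 2 + 3 / 2 * Real.cos (θ s) ∧
        z s = z 0 + 2 * h + 2 + 3 / 2 * Real.sin (θ s) := fun s hs => by
    have := H'.arc H.angle₃ hs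
    rw [t2, Real.cos_neg, Real.sin_neg, cos_neckAngle, sin_neckAngle] at this
    constructor <;> linarith
  have f3 := e3 (2 * h + neckAngle + capLength) ⟨by linarith, le_rfl⟩
  have t3 : θ (2 * h + neckAngle + capLength) = neckAngle + Real.pi := by
    rw [H.angle₄ _ ⟨le_rfl, by linarith⟩, hP]; ring
  rw [t3, Real.cos_add_pi, Real.sin_add_pi, cos_neckAngle, sin_neckAngle] at f3
  have e4 : ∀ s ∈ Icc (2 * h + neckAngle + capLength) (dumbbellHalfLength h),
      x s = x 0 - 2 - Real.cos (θ s) ∧ z s = z 0 + 2 * h - Real.sin (θ s) := fun s hs => by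
    have := H'.arc H.angle₄ hs
    rw [t3, Real.cos_add_pi, Real.sin_add_pi, cos_neckAngle, sin_neckAngle] at this
    constructor <;> linarith
  have f4 := e4 (dumbbellHalfLength h) ⟨by linarith, le_rfl⟩
  have t4 : θ (dumbbellHalfLength h) = Real.pi := by
    rw [H.angle₄ _ ⟨by linarith, le_rfl⟩]; ring
  rw [t4, Real.cos_pi, Real.sin_pi] at f4
  have hx0 : x 0 = 1 / 2 := by linarith [H'.x_end]
  have hz0 : z 0 = -h := by linarith [H'.y_end]
  rw [hx0, hz0] at e1 e2 e3 e4
  refine ⟨fun s hs => ?_, fun s hs => ?_, fun s hs => ?_, fun s hs => ?_⟩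
  · have := e1 s hs; constructor <;> linarith
  · have := e2 s hs; constructor <;> linarith
  · have := e3 s hs; constructor <;> linarith
  · have := e4 s hs; constructor <;> linarith

/-- Position and normal of a point of the upper head of a dumbbell curve. -/
def HeadPoint (h x z c d : ℝ) : Prop :=
  c ^ 2 + d ^ 2 = 1 ∧ -(4 / 5) ≤ d ∧ ((x = 3 / 2 - c ∧ z = h - d ∧ 3 / 5 ≤ c ∧ d ≤ 0) ∨
    (x = 3 / 2 * c ∧ z = h + 2 + 3 / 2 * d) ∨ (x = -(3 / 2) - c ∧ z = h - d ∧ c ≤ -(3 / 5) ∧ d ≤ 0))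

/-- Position and normal of a point of a dumbbell curve. -/
def DumbbellPoint (h x z c d : ℝ) : Prop :=
  (d = 0 ∧ |z| ≤ h ∧ ((c = 1 ∧ x = 1 / 2) ∨ (c = -1 ∧ x = -(1 / 2)))) ∨
    HeadPoint h x z c d ∨ HeadPoint h (-x) (-z) (-c) (-d)

theorem IsDumbbellLoop.dumbbellPoint (H : IsDumbbellLoop θ x z h) (s : ℝ) :
    DumbbellPoint h (x s) (z s) (Real.cos (θ s)) (Real.sin (θ s)) := by
  have hα := neckAngle_pos
  have hα' := neckAngle_lt
  have hpi := Real.pi_pos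
  have hP : dumbbellHalfLength h = 2 * h + 2 * neckAngle + capLength := rfl
  have hw' : capLength = 3 * neckAngle + 3 * Real.pi / 2 := rfl
  obtain ⟨e1, e2, e3, e4⟩ := H.coordinates
  revert s
  refine H.isCentralLoop.forall_of_Ico (fun x z c d hp => ?_) fun s hs => ?_
  · rcases hp with ⟨h1, h2, h3⟩ | h1 | h1
    · refine .inl ⟨by linarith, by rwa [abs_neg], ?_⟩
      rcases h3 with ⟨h3, h4⟩ | ⟨h3, h4⟩
      · right; constructor <;> linarith
      · left; constructor <;> linarith
    · exact .inr (.inr (by simpa only [neg_neg] using h1))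
    · exact .inr (.inl h1)
  · have hcs := Real.cos_sq_add_sin_sq (θ s)
    -- the normal along an arc of curvature `-1`
    have arc : ∀ t ∈ Icc (-neckAngle) 0,
        3 / 5 ≤ Real.cos t ∧ -(4 / 5) ≤ Real.sin t ∧ Real.sin t ≤ 0 := fun t ht => by
      refine ⟨?_, ?_, ?_⟩
      · rw [← cos_neckAngle, ← Real.cos_neg t]
        exact Real.cos_le_cos_of_nonneg_of_le_pi (by linarith [ht.2]) (by linarith)
          (by linarith [ht.1])
      · rw [← sin_neckAngle, ← Real.sin_neg]
        exact Real.sin_le_sin_of_le_of_le_pi_div_two (by linarith) (by linarith [ht.2]) ht.1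
      · exact Real.sin_nonpos_of_nonpos_of_neg_pi_le ht.2 (by linarith [ht.1])
    rcases le_total s (2 * h) with h1 | h1
    · have hs' : s ∈ Icc 0 (2 * h) := ⟨hs.1, h1⟩
      rw [H.angle₁ s hs', Real.cos_zero, Real.sin_zero, (e1 s hs').1, (e1 s hs').2]
      exact .inl ⟨rfl, abs_le.2 ⟨by linarith [hs'.1], by linarith⟩, .inl ⟨rfl, rfl⟩⟩
    refine .inr (.inl ⟨hcs, ?_⟩)
    rcases le_total s (2 * h + neckAngle) with h2 | h2
    · have hs' : s ∈ Icc (2 * h) (2 * h + neckAngle) := ⟨h1, h2⟩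
      have := arc (θ s) (by rw [H.angle₂ s hs']; constructor <;> linarith)
      exact ⟨this.2.1, .inl ⟨(e2 s hs').1, (e2 s hs').2, this.1, this.2.2⟩⟩
    rcases le_total s (2 * h + neckAngle + capLength) with h3 | h3
    · have hs' : s ∈ Icc (2 * h + neckAngle) (2 * h + neckAngle + capLength) := ⟨h2, h3⟩
      refine ⟨?_, .inr (.inl (e3 s hs'))⟩
      have ht : -neckAngle ≤ θ s ∧ θ s ≤ Real.pi + neckAngle := by
        rw [H.angle₃ s hs']; constructor <;> linarith
      rw [← sin_neckAngle, ← Real.sin_neg]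
      rcases le_total (θ s) (Real.pi / 2) with h4 | h4
      · exact Real.sin_le_sin_of_le_of_le_pi_div_two (by linarith) h4 ht.1
      · rw [← Real.sin_pi_sub (θ s)]
        exact Real.sin_le_sin_of_le_of_le_pi_div_two (by linarith) (by linarith) (by linarith)
    · have hs' : s ∈ Icc (2 * h + neckAngle + capLength) (dumbbellHalfLength h) := ⟨h3, hs.2.le⟩
      have := arc (Real.pi - θ s) (by rw [H.angle₄ s hs']; constructor <;> linarith [hs'.2])
      rw [Real.cos_pi_sub, Real.sin_pi_sub] at this
      exact ⟨this.2.1, .inr (.inr ⟨(e4 s hs').1, (e4 s hs').2, by linarith, this.2.2⟩)⟩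

theorem HeadPoint.le {x z c d : ℝ} (H : HeadPoint h x z c d) : h ≤ z := by
  obtain ⟨-, h1, ⟨h2, h3, h4, h5⟩ | ⟨h2, h3⟩ | ⟨h2, h3, h4, h5⟩⟩ := H <;> linarith

/-- The ends of such a chord have equal or opposite normals, so the chord between two circular arcs
lies on the line through their centres. The pairs of arcs are checked one by one, with the
reflection x ↦ -x saving cases. -/
theorem HeadPoint.one_le {x z c d x' z' c' d' : ℝ} (H : HeadPoint h x z c d)
    (H' : HeadPoint h x' z' c' d') (hne : ¬ (x = x' ∧ z = z'))
    (h1 : (x - x') * d = (z - z') * c) (h2 : (x - x') * d' = (z - z') * c') :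
    1 ≤ (x - x') ^ 2 + (z - z') ^ 2 := by
  have hne' : ¬ (x - x' = 0 ∧ z - z' = 0) := by rwa [sub_eq_zero, sub_eq_zero]
  have hpar := eq_or_eq_neg_of_parallel H.1 H'.1 hne' h1 h2
  have hsq := H.1
  -- an arc of curvature `-1` and the cap
  have key : ∀ {x z c d x' z' c' d' : ℝ}, c ^ 2 + d ^ 2 = 1 → (x = 3 / 2 - c) → (z = h - d) →
      3 / 5 ≤ c → d ≤ 0 → (x' = 3 / 2 * c') → (z' = h + 2 + 3 / 2 * d') →
      ((c' = c ∧ d' = d) ∨ (c' = -c ∧ d' = -d)) → (x - x') * d = (z - z') * c →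
      ¬ (x = x' ∧ z = z') → 1 ≤ (x - x') ^ 2 + (z - z') ^ 2 := by
    rintro x z c d x' z' c' d' hsq rfl rfl h3 h4 rfl rfl hpar h1 hne
    -- The line through the centres of neck and cap has direction (3, -4). Equal normals give the
    -- junction of the two arcs, opposite ones the far side of the cap.
    have h5 : 3 * d = -4 * c := by rcases hpar with ⟨rfl, rfl⟩ | ⟨rfl, rfl⟩ <;> linarith
    have h6 : c = 3 / 5 := by nlinarith
    have h7 : d = -(4 / 5) := by linarith
    rcases hpar with ⟨rfl, rfl⟩ | ⟨rfl, rfl⟩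
    · exact absurd ⟨by linarith, by linarith⟩ hne
    · rw [h6, h7, show h - -(4 / 5) - (h + 2 + 3 / 2 * - -(4 / 5)) = -(12 / 5) by ring]
      norm_num
  obtain ⟨-, a1, a⟩ := H
  obtain ⟨-, b1, b⟩ := H'
  have hsq' : c' ^ 2 + d' ^ 2 = 1 := by
    rcases hpar with ⟨rfl, rfl⟩ | ⟨rfl, rfl⟩ <;> linarith
  have hpar' : (c = c' ∧ d = d') ∨ (c = -c' ∧ d = -d') := by
    rcases hpar with ⟨rfl, rfl⟩ | ⟨rfl, rfl⟩ <;> simp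
  have hcomm : (x - x') ^ 2 + (z - z') ^ 2 = (x' - x) ^ 2 + (z' - z) ^ 2 := by ring
  have hnec : ¬ (x' = x ∧ z' = z) := fun h => hne ⟨h.1.symm, h.2.symm⟩
  -- opposite normals on two arcs of curvature `-1`
  have opp : d ≤ 0 → d' ≤ 0 → c' = -c → d' = -d → d = 0 ∧ c ^ 2 = 1 := fun h3 h4 h5 h6 => by
    have : d = 0 := by linarith
    exact ⟨this, by rw [this] at hsq; linarith⟩
  rcases a with ⟨a2, a3, a4, a5⟩ | ⟨a2, a3⟩ | ⟨a2, a3, a4, a5⟩ <;>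
    rcases b with ⟨b2, b3, b4, b5⟩ | ⟨b2, b3⟩ | ⟨b2, b3, b4, b5⟩
  · rcases hpar with ⟨rfl, rfl⟩ | ⟨rfl, rfl⟩
    · exact absurd ⟨by linarith, by linarith⟩ hne
    · linarith
  · exact key hsq a2 a3 a4 a5 b2 b3 hpar h1 hne
  · rcases hpar with ⟨rfl, rfl⟩ | ⟨rfl, rfl⟩
    · linarith
    · obtain ⟨h3, h4⟩ := opp a5 b5 rfl rfl
      have : c = 1 := by nlinarith
      rw [a2, b2, this]; nlinarith [sq_nonneg (z - z')]
  · rw [hcomm]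
    exact key hsq' b2 b3 b4 b5 a2 a3 hpar' (by linarith) hnec
  · rcases hpar with ⟨rfl, rfl⟩ | ⟨rfl, rfl⟩
    · exact absurd ⟨by linarith, by linarith⟩ hne
    · rw [a2, b2, a3, b3]; nlinarith
  · rw [hcomm]
    have := key (x := -x') (z := z') (c := -c') (d := d') (x' := -x) (z' := z) (c' := -c) (d' := d)
      (by linarith) (by linarith) b3 (by linarith) b5 (by linarith) a3
      (by rcases hpar' with ⟨h3, h4⟩ | ⟨h3, h4⟩
          · left; constructor <;> linarith
          · right; constructor <;> linarith) (by linarith)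
      (fun h => hne ⟨by linarith [h.1], h.2.symm⟩)
    linarith
  · rcases hpar with ⟨rfl, rfl⟩ | ⟨rfl, rfl⟩
    · linarith
    · obtain ⟨h3, h4⟩ := opp a5 b5 rfl rfl
      have : c = -1 := by nlinarith
      rw [a2, b2, this]; nlinarith [sq_nonneg (z - z')]
  · have := key (x := -x) (z := z) (c := -c) (d := d) (x' := -x') (z' := z') (c' := -c') (d' := d')
      (by linarith) (by linarith) a3 (by linarith) a5 (by linarith) b3
      (by rcases hpar with ⟨h3, h4⟩ | ⟨h3, h4⟩
          · left; constructor <;> linarith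
          · right; constructor <;> linarith) (by linarith)
      (fun h => hne ⟨by linarith [h.1], h.2⟩)
    linarith
  · rcases hpar with ⟨rfl, rfl⟩ | ⟨rfl, rfl⟩
    · exact absurd ⟨by linarith, by linarith⟩ hne
    · linarith

theorem DumbbellPoint.one_le {x z c d x' z' c' d' : ℝ} (hh : 1 ≤ h) (H : DumbbellPoint h x z c d)
    (H' : DumbbellPoint h x' z' c' d') (hne : ¬ (x = x' ∧ z = z'))
    (h1 : (x - x') * d = (z - z') * c) (h2 : (x - x') * d' = (z - z') * c') :
    1 ≤ (x - x') ^ 2 + (z - z') ^ 2 := by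
  -- a chord from a strand is horizontal
  have strand : ∀ {x z c d x' z' c' d' : ℝ}, d = 0 → |z| ≤ h →
      ((c = 1 ∧ x = 1 / 2) ∨ (c = -1 ∧ x = -(1 / 2))) → DumbbellPoint h x' z' c' d' →
      ¬ (x = x' ∧ z = z') → (x - x') * d = (z - z') * c → (x - x') * d' = (z - z') * c' →
      1 ≤ (x - x') ^ 2 + (z - z') ^ 2 := by
    intro x z c d x' z' c' d' hd hz hc H' hne h1 h2
    have hzz : z - z' = 0 := by
      rcases hc with ⟨rfl, -⟩ | ⟨rfl, -⟩ <;> rw [hd] at h1 <;> linarith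
    have hx : x - x' ≠ 0 := fun h => hne ⟨by linarith, by linarith⟩
    have hd' : d' = 0 := by
      rw [hzz, zero_mul] at h2
      exact (mul_eq_zero.1 h2).resolve_left hx
    have hx' : x' ^ 2 = 1 / 4 := by
      have head : ∀ {x' z' c' : ℝ}, |z'| ≤ h → HeadPoint h x' z' c' 0 → x' ^ 2 = 1 / 4 := by
        rintro x' z' c' hz ⟨h3, -, ⟨h4, h5, h6, -⟩ | ⟨h4, h5⟩ | ⟨h4, h5, h6, -⟩⟩
        · have : c' = 1 := by nlinarith
          rw [h4, this]; norm_num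
        · linarith [(abs_le.1 hz).2]
        · have : c' = -1 := by nlinarith
          rw [h4, this]; norm_num
      have hz' : |z'| ≤ h := by rwa [show z' = z by linarith]
      rcases H' with ⟨-, -, ⟨-, h3⟩ | ⟨-, h3⟩⟩ | h3 | h3
      · rw [h3]; norm_num
      · rw [h3]; norm_num
      · rw [hd'] at h3; exact head hz' h3
      · rw [hd', neg_zero] at h3
        rw [← neg_sq]; exact head (by rwa [abs_neg]) h3
    have hx2 : x ^ 2 = 1 / 4 := by
      rcases hc with ⟨-, h3⟩ | ⟨-, h3⟩ <;> rw [h3] <;> norm_num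
    have : x + x' = 0 := (mul_eq_zero.1 (by linarith : (x + x') * (x - x') = 0)).resolve_right hx
    rw [hzz, show x - x' = 2 * x by linarith]
    linarith
  have hcomm : (x - x') ^ 2 + (z - z') ^ 2 = (x' - x) ^ 2 + (z' - z) ^ 2 := by ring
  rcases H with ⟨a1, a2, a3⟩ | a1 | a1
  · exact strand a1 a2 a3 H' hne h1 h2
  · rcases H' with ⟨b1, b2, b3⟩ | b1 | b1
    · rw [hcomm]
      exact strand b1 b2 b3 (.inr (.inl a1)) (fun h => hne ⟨h.1.symm, h.2.symm⟩) (by linarith)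
        (by linarith)
    · exact a1.one_le b1 hne h1 h2
    -- Points of opposite heads differ in height by at least 2h ≥ 2.
    · nlinarith [a1.le, b1.le, sq_nonneg (x - x')]
  · rcases H' with ⟨b1, b2, b3⟩ | b1 | b1
    · rw [hcomm]
      exact strand b1 b2 b3 (.inr (.inr a1)) (fun h => hne ⟨h.1.symm, h.2.symm⟩) (by linarith)
        (by linarith)
    · nlinarith [a1.le, b1.le, sq_nonneg (x - x')]
    · have := a1.one_le b1 (fun h => hne ⟨neg_inj.1 h.1, neg_inj.1 h.2⟩) (by linarith) (by linarith)
      linarith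

end DumbbellCurve

/-! ### The dumbbell and the stadium form a stadium pair -/

section DumbbellPair

variable {θ x z : ℝ → ℝ} {h : ℝ}

/-- The parameter of the highest point of a dumbbell curve. -/
noncomputable def dumbbellTop (h : ℝ) : ℝ := 2 * h + neckAngle + capLength / 2

theorem IsDumbbellLoop.top (H : IsDumbbellLoop θ x z h) :
    θ (dumbbellTop h) = Real.pi / 2 ∧ x (dumbbellTop h) = 0 ∧ z (dumbbellTop h) = h + 7 / 2 := by
  have hw := capLength_pos
  have hm : dumbbellTop h = 2 * h + neckAngle + capLength / 2 := rfl
  have hw' : capLength = 3 * neckAngle + 3 * Real.pi / 2 := rfl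
  have hmem : dumbbellTop h ∈ Icc (2 * h + neckAngle) (2 * h + neckAngle + capLength) :=
    ⟨by linarith, by linarith⟩
  have h1 : θ (dumbbellTop h) = Real.pi / 2 := by
    rw [H.angle₃ _ hmem, hm, hw']; ring
  obtain ⟨-, -, e3, -⟩ := H.coordinates
  rw [(e3 _ hmem).1, (e3 _ hmem).2, h1, Real.cos_pi_div_two, Real.sin_pi_div_two]
  exact ⟨rfl, by ring, by ring⟩

/-- From the lowest to the highest point the curve runs up on the right. A positive cosine of the
normal angle makes the height strictly increasing, and positive abscissae keep this half apart from
its mirror image. -/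
theorem IsDumbbellLoop.pos (H : IsDumbbellLoop θ x z h) {s : ℝ}
    (hs : s ∈ Ioo (dumbbellTop h - dumbbellHalfLength h) (dumbbellTop h)) :
    0 < Real.cos (θ s) ∧ 0 < x s := by
  have hα := neckAngle_pos
  have hα' := neckAngle_lt
  have hw := capLength_pos
  have hpi := Real.pi_pos
  have hm : dumbbellTop h = 2 * h + neckAngle + capLength / 2 := rfl
  have hP : dumbbellHalfLength h = 2 * h + 2 * neckAngle + capLength := rfl
  have hw' : capLength = 3 * neckAngle + 3 * Real.pi / 2 := rfl
  obtain ⟨e1, e2, e3, e4⟩ := H.coordinates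
  rcases le_total 0 s with h0 | h0
  · rcases le_total s (2 * h) with h1 | h1
    · rw [H.angle₁ s ⟨h0, h1⟩, (e1 s ⟨h0, h1⟩).1]; norm_num
    rcases le_total s (2 * h + neckAngle) with h2 | h2
    · refine ⟨?_, ?_⟩
      · rw [H.angle₂ s ⟨h1, h2⟩]
        exact Real.cos_pos_of_mem_Ioo ⟨by linarith, by linarith⟩
      · rw [(e2 s ⟨h1, h2⟩).1]; linarith [Real.cos_le_one (θ s)]
    · have hs' : s ∈ Icc (2 * h + neckAngle) (2 * h + neckAngle + capLength) :=
        ⟨h2, by linarith [hs.2]⟩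
      have hc : 0 < Real.cos (θ s) := by
        rw [H.angle₃ s hs']
        exact Real.cos_pos_of_mem_Ioo ⟨by linarith, by linarith [hs.2]⟩
      exact ⟨hc, by rw [(e3 s hs').1]; linarith⟩
  · obtain ⟨t, rfl⟩ : ∃ t, s = t - dumbbellHalfLength h := ⟨s + dumbbellHalfLength h, by ring⟩
    have ht : dumbbellTop h < t := by linarith [hs.1]
    have hx := H.isCentralLoop.x_add (t - dumbbellHalfLength h)
    have hθ := H.isCentralLoop.angle_add (t - dumbbellHalfLength h)
    rw [sub_add_cancel] at hx hθ
    suffices Real.cos (θ t) < 0 ∧ x t < 0 by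
      rw [hθ, Real.cos_add_pi] at this
      constructor <;> linarith
    rcases le_total t (2 * h + neckAngle + capLength) with h3 | h3
    · have hs' : t ∈ Icc (2 * h + neckAngle) (2 * h + neckAngle + capLength) :=
        ⟨by linarith, h3⟩
      have hc : Real.cos (θ t) < 0 := by
        rw [H.angle₃ t hs']
        exact Real.cos_neg_of_pi_div_two_lt_of_lt (by linarith) (by linarith)
      exact ⟨hc, by rw [(e3 t hs').1]; linarith⟩
    · have hs' : t ∈ Icc (2 * h + neckAngle + capLength) (dumbbellHalfLength h) :=
        ⟨h3, by linarith⟩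
      refine ⟨?_, by rw [(e4 t hs').1]; linarith [Real.neg_one_le_cos (θ t)]⟩
      rw [H.angle₄ t hs']
      exact Real.cos_neg_of_pi_div_two_lt_of_lt (by linarith [hs'.2]) (by linarith)

theorem IsDumbbellLoop.bottom (H : IsDumbbellLoop θ x z h) :
    x (dumbbellTop h - dumbbellHalfLength h) = 0 ∧
      z (dumbbellTop h - dumbbellHalfLength h) = -(h + 7 / 2) := by
  have hx := H.isCentralLoop.x_add (dumbbellTop h - dumbbellHalfLength h)
  have hz := H.isCentralLoop.y_add (dumbbellTop h - dumbbellHalfLength h)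
  rw [sub_add_cancel] at hx hz
  rw [H.top.2.1] at hx
  rw [H.top.2.2] at hz
  constructor <;> linarith

theorem IsDumbbellLoop.strictMonoOn (H : IsDumbbellLoop θ x z h) :
    StrictMonoOn z (Icc (dumbbellTop h - dumbbellHalfLength h) (dumbbellTop h)) := by
  refine strictMonoOn_of_deriv_pos (convex_Icc _ _)
    (fun s _ => (H.isCentralLoop.hasDerivAt_y s).continuousAt.continuousWithinAt) fun s hs => ?_
  rw [interior_Icc] at hs
  rw [(H.isCentralLoop.hasDerivAt_y s).deriv]
  exact (H.pos hs).1

theorem IsDumbbellLoop.injOn (H : IsDumbbellLoop θ x z h) :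
    ∀ s ∈ Ico 0 (2 * dumbbellHalfLength h), ∀ t ∈ Ico 0 (2 * dumbbellHalfLength h),
      x s = x t → z s = z t → s = t := by
  have hP := H.isCentralLoop.pos
  refine H.isCentralLoop.injOn_of_Ico (dumbbellTop h - dumbbellHalfLength h) ?_ ?_ <;>
    rw [sub_add_cancel] <;> intro s hs t ht hx hz
  · exact H.strictMonoOn.injOn (Ico_subset_Icc_self hs) (Ico_subset_Icc_self ht) hz
  -- The bottom point, where the abscissa vanishes, is opposite only to the top, which the half-open
  -- interval omits.
  · have key : ∀ {s t}, s ∈ Ico (dumbbellTop h - dumbbellHalfLength h) (dumbbellTop h) →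
        t ∈ Ico (dumbbellTop h - dumbbellHalfLength h) (dumbbellTop h) → z s = -z t →
        dumbbellTop h - dumbbellHalfLength h < s := by
      intro s t hs ht hz
      refine hs.1.lt_of_ne fun h => ?_
      rw [← h, H.bottom.2, neg_inj, ← H.top.2.2] at hz
      exact ht.2.ne' (H.strictMonoOn.injOn ⟨by linarith, le_rfl⟩ (Ico_subset_Icc_self ht) hz)
    have h1 := H.pos ⟨key hs ht hz, hs.2⟩
    have h2 := H.pos ⟨key ht hs (by linarith), ht.2⟩
    linarith [h1.2, h2.2]

theorem planarCurve_zero_two (s : ℝ) :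
    planarCurve (EuclideanSpace.single 0 1) (EuclideanSpace.single 2 1) x z s = !₂[x s, 0, z s] := by
  ext i; fin_cases i <;> simp [planarCurve]

/-- The dumbbell curve in the `xz`-plane. -/
noncomputable def dumbbellCurve (x z : ℝ → ℝ) : ℝ → E3 :=
  planarCurve (EuclideanSpace.single 0 1) (EuclideanSpace.single 2 1) x z

theorem dumbbellCurve_apply (s : ℝ) : dumbbellCurve x z s = !₂[x s, 0, z s] :=
  planarCurve_zero_two s

theorem IsDumbbellLoop.isThinCore (H : IsDumbbellLoop θ x z h) :
    IsThinCore 1 (2 * dumbbellHalfLength h) (dumbbellCurve x z) :=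
  H.isCentralLoop.isThinCore (norm_single_one 0) (norm_single_one 2)
    (inner_single_single (by decide)) H.injOn
    fun u v => (H.dumbbellPoint u).one_le H.one_le (H.dumbbellPoint v)

theorem IsDumbbellLoop.deriv_curve (H : IsDumbbellLoop θ x z h) (s : ℝ) :
    deriv (dumbbellCurve x z) s =
      -Real.sin (θ s) • EuclideanSpace.single 0 1 + Real.cos (θ s) • ez := by
  rw [dumbbellCurve, H.isCentralLoop.deriv_curve, ez]

theorem one_le_dist_of_infDist_segment {a b p q : E3} (h : Metric.infDist p (segment ℝ a b) = 1)
    (hq : q ∈ segment ℝ a b) : 1 ≤ dist p q :=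
  h ▸ Metric.infDist_le_dist_of_mem hq

/-- The strands lie over the ends of the core segment, which are at distance at least 1 from the
stadium; the heads are at height at least h ≥ 1. -/
theorem IsDumbbellLoop.isThinLink (H : IsDumbbellLoop θ x z h) {β : ℝ → E3}
    (hβ : IsThinCore 1 (2 * Real.pi + 2) β)
    (hrange : range β =
      stadium (EuclideanSpace.single 0 (1 / 2)) (EuclideanSpace.single 0 (-(1 / 2)))) :
    IsThinLink 1 (2 * dumbbellHalfLength h) (2 * Real.pi + 2) (dumbbellCurve x z) β := by
  refine ⟨H.isThinCore, hβ, ?_⟩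
  have hdist : ∀ s, ∀ p ∈ range β, 1 ≤ dist (dumbbellCurve x z s) p := by
    intro s p hp
    rw [hrange] at hp
    have hp2 : p 2 = 0 := hp.1
    have hh := H.one_le
    have hd : dist (dumbbellCurve x z s) p ^ 2 = (x s - p 0) ^ 2 + p 1 ^ 2 + z s ^ 2 := by
      rw [dist_sq_coordinates, dumbbellCurve_apply]
      simp [hp2]
    rw [← one_le_sq_iff₀ dist_nonneg, hd]
    rcases H.dumbbellPoint s with ⟨-, -, hx⟩ | h1 | h1
    · have hq : (EuclideanSpace.single 0 (x s) : E3) ∈ segment ℝ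
          (EuclideanSpace.single 0 (1 / 2) : E3) (EuclideanSpace.single 0 (-(1 / 2))) := by
        rcases hx with ⟨-, hx⟩ | ⟨-, hx⟩ <;> rw [hx]
        · exact left_mem_segment ℝ _ _
        · exact right_mem_segment ℝ _ _
      have h2 := one_le_dist_of_infDist_segment hp.2 hq
      rw [← one_le_sq_iff₀ dist_nonneg, dist_sq_coordinates] at h2
      simp only [PiLp.single_apply, hp2] at h2
      norm_num [show (2 : Fin 3) ≠ 0 by decide] at h2
      nlinarith [sq_nonneg (z s)]
    · nlinarith [h1.le, sq_nonneg (x s - p 0), sq_nonneg (p 1)]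
    · nlinarith [h1.le, sq_nonneg (x s - p 0), sq_nonneg (p 1)]
  rw [Set.disjoint_left]
  intro p h1 h2
  rw [tube, Metric.mem_thickening_iff] at h1 h2
  obtain ⟨_, ⟨s, rfl⟩, h3⟩ := h1
  obtain ⟨q, hq, h4⟩ := h2
  have := hdist s q hq
  have := dist_triangle_left (dumbbellCurve x z s) q p
  linarith

/-- The unit sphere through (±1/2, 0, 0) has its centre at depth √3/2 and meets the vertical line
through either point only at heights 0 and -√3 (on the side given by σ). Any strand point beyond the
plane therefore lies over the sphere. -/
theorem isLongArc_of_straight {σ a u v s : ℝ} {γ : ℝ → E3} (hσ : σ ^ 2 = 1) (hs : s ∈ Icc u v)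
    (ha : a ^ 2 = 1 / 4) (hu : γ u = !₂[a, 0, 0]) (hv : γ v = !₂[-a, 0, 0]) (h0 : γ s 0 = a)
    (h1 : γ s 1 = 0) (h2 : 0 < σ * γ s 2) : IsLongArc σ γ u v := by
  have h3 : Real.sqrt 3 ^ 2 = 3 := Real.sq_sqrt (by norm_num)
  have h3' : 0 < Real.sqrt 3 := by positivity
  have hd : ∀ q : E3, q 1 = 0 → dist q !₂[0, 0, -(σ * (Real.sqrt 3 / 2))] ^ 2 =
      q 0 ^ 2 + (q 2 + σ * (Real.sqrt 3 / 2)) ^ 2 := fun q hq => by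
    rw [dist_sq_coordinates]; simp [hq]
  have hone : ∀ b : ℝ, b ^ 2 = 1 / 4 →
      dist (!₂[b, 0, 0] : E3) !₂[0, 0, -(σ * (Real.sqrt 3 / 2))] = 1 := fun b hb => by
    rw [← pow_eq_one_iff_of_nonneg dist_nonneg two_ne_zero, hd _ (by simp)]
    simp only [Matrix.cons_val]
    rw [hb]
    linear_combination (1 / 4 * Real.sqrt 3 ^ 2) * hσ + 1 / 4 * h3
  refine ⟨!₂[0, 0, -(σ * (Real.sqrt 3 / 2))], ?_, ?_, ?_, ?_, ?_, s, hs,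
    ⟨!₂[a, 0, 0], hone a ha, by simp [h0], by simp [h1]⟩, fun q hq hq0 hq1 => ?_⟩
  · rw [hu, hv]; simp [midpoint_eq_smul_add]
  · rw [hu, hv]; simp [midpoint_eq_smul_add]
  · simp only [Matrix.cons_val]
    nlinarith
  · rw [hu]; exact hone a ha
  · rw [hv]; exact hone (-a) (by rwa [neg_sq])
  · have h4 := hd q (by rw [hq1, h1])
    rw [hq, hq0, h0, ha] at h4
    have h5 : (σ * q 2 + Real.sqrt 3 / 2) ^ 2 = (Real.sqrt 3 / 2) ^ 2 := by
      have : (σ * q 2 + Real.sqrt 3 / 2) ^ 2 = (q 2 + σ * (Real.sqrt 3 / 2)) ^ 2 := by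
        linear_combination (q 2 ^ 2 - (Real.sqrt 3 / 2) ^ 2) * hσ
      rw [this]; linarith
    have h6 := (abs_le_of_sq_le_sq' h5.le (by positivity)).2
    linarith

theorem IsDumbbellLoop.isStadiumPair (H : IsDumbbellLoop θ x z h) {β : ℝ → E3}
    (hrange : range β =
      stadium (EuclideanSpace.single 0 (1 / 2)) (EuclideanSpace.single 0 (-(1 / 2)))) :
    IsStadiumPair (2 * dumbbellHalfLength h) (dumbbellCurve x z) β h
      (h + dumbbellHalfLength h) := by
  have hα := neckAngle_pos
  have hw := capLength_pos
  have hh := H.one_le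
  have hP := H.isCentralLoop.pos
  have hm : dumbbellTop h = 2 * h + neckAngle + capLength / 2 := rfl
  have hP' : dumbbellHalfLength h = 2 * h + 2 * neckAngle + capLength := rfl
  obtain ⟨e1, -, -, -⟩ := H.coordinates
  have hmem : h ∈ Icc 0 (2 * h) := ⟨by linarith, by linarith⟩
  have hxh : x h = 1 / 2 := (e1 h hmem).1
  have hzh : z h = 0 := by rw [(e1 h hmem).2, sub_self]
  have hθh : θ h = 0 := H.angle₁ h hmem
  have g1 : dumbbellCurve x z h = !₂[1 / 2, 0, 0] := by rw [dumbbellCurve_apply, hxh, hzh]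
  have hadd : ∀ s, dumbbellCurve x z (s + dumbbellHalfLength h) = !₂[-x s, 0, -z s] := fun s => by
    rw [dumbbellCurve_apply, H.isCentralLoop.x_add, H.isCentralLoop.y_add]
  have g2 : dumbbellCurve x z (h + dumbbellHalfLength h) = !₂[-(1 / 2), 0, 0] := by
    rw [hadd, hxh, hzh, neg_zero]
  have g3 : dumbbellCurve x z (h + 2 * dumbbellHalfLength h) = !₂[1 / 2, 0, 0] := by
    rw [← g1]; exact H.isThinCore.constrained.periodic h
  have hup : ∀ s ∈ Ioo h (h + dumbbellHalfLength h), 0 < z s := by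
    intro s hs
    rcases le_total s (dumbbellTop h) with h1 | h1
    · rw [← hzh]
      exact H.strictMonoOn ⟨by linarith, by linarith⟩ ⟨by linarith [hs.1], h1⟩ hs.1
    · have h2 := H.strictMonoOn (a := s - dumbbellHalfLength h) (b := h)
        ⟨by linarith, by linarith [hs.2]⟩ ⟨by linarith, by linarith⟩ (by linarith [hs.2])
      have h3 := H.isCentralLoop.y_add (s - dumbbellHalfLength h)
      rw [sub_add_cancel] at h3
      linarith
  have s1 : (EuclideanSpace.single 0 (1 / 2) : E3) = !₂[1 / 2, 0, 0] := by
    ext i; fin_cases i <;> simp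
  have s2 : (EuclideanSpace.single 0 (-(1 / 2)) : E3) = !₂[-(1 / 2), 0, 0] := by
    ext i; fin_cases i <;> simp
  refine ⟨by linarith, by linarith, by rw [g1]; simp, by rw [g2]; simp, ?_, ?_, ?_, ?_, ?_, ?_, ?_,
    by rw [g1, g2, ← s1, ← s2, hrange]⟩
  · rw [g1, g2, ← pow_eq_one_iff_of_nonneg dist_nonneg two_ne_zero, dist_sq_coordinates]
    simp; norm_num
  · rw [H.deriv_curve, hθh]; simp
  · rw [H.deriv_curve, H.isCentralLoop.angle_add, hθh]; simp
  · intro s hs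
    rw [dumbbellCurve_apply]
    exact hup s hs
  · intro s hs
    have h3 := H.isCentralLoop.y_add (s - dumbbellHalfLength h)
    rw [sub_add_cancel] at h3
    have := hup (s - dumbbellHalfLength h) ⟨by linarith [hs.1], by linarith [hs.2]⟩
    rw [dumbbellCurve_apply]
    simp only [Matrix.cons_val]
    linarith
  · have h2 := e1 (2 * h) ⟨by linarith, le_rfl⟩
    refine isLongArc_of_straight (s := 2 * h) (by norm_num) ⟨by linarith, by linarith⟩
      (by norm_num) g1 g2 ?_ ?_ ?_ <;> rw [dumbbellCurve_apply, h2.1, h2.2] <;> simp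
    linarith
  · have h2 := e1 (2 * h) ⟨by linarith, le_rfl⟩
    refine isLongArc_of_straight (s := 2 * h + dumbbellHalfLength h) (a := -(1 / 2)) (by norm_num)
      ⟨by linarith, by linarith⟩ (by norm_num) g2 (by rw [neg_neg]; exact g3) ?_ ?_ ?_ <;>
      rw [hadd, h2.1, h2.2] <;> simp
    linarith

end DumbbellPair

/-! ### Implicit equations of the two curves -/

section Profiles

variable {θ x z : ℝ → ℝ} {h : ℝ}

/-- The dumbbell curve is given by `x ^ 2 = (h + 7 / 2 - |z|) * dumbbellProfile h |z|`. -/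
noncomputable def dumbbellProfile (h r : ℝ) : ℝ :=
  -- Up to height h + 4/5, where neck and cap meet, this is x² divided by the factor that vanishes
  -- at the top. On the cap the quotient is exactly z - h - 1/2, which is affine.
  (3 / 2 - Real.sqrt (1 - max (min r (h + 4 / 5) - h) 0 ^ 2)) ^ 2 /
    (h + 7 / 2 - min r (h + 4 / 5)) + max (r - (h + 4 / 5)) 0

theorem dumbbellProfile_pos (h r : ℝ) : 0 < dumbbellProfile h r := by
  have h1 : Real.sqrt (1 - max (min r (h + 4 / 5) - h) 0 ^ 2) ≤ 1 := by
    rw [Real.sqrt_le_one]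
    linarith [sq_nonneg (max (min r (h + 4 / 5) - h) 0)]
  have h2 : 0 < h + 7 / 2 - min r (h + 4 / 5) := by linarith [min_le_right r (h + 4 / 5)]
  exact add_pos_of_pos_of_nonneg (div_pos (pow_pos (by linarith) 2) h2) (le_max_right _ _)

theorem continuous_dumbbellProfile (h : ℝ) : Continuous (dumbbellProfile h) := by
  unfold dumbbellProfile
  refine (Continuous.div (by fun_prop) (by fun_prop) fun r => ?_).add (by fun_prop)
  linarith [min_le_right r (h + 4 / 5)]

theorem dumbbellProfile_of_le {r : ℝ} (hr : r ≤ h + 4 / 5) :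
    (h + 7 / 2 - r) * dumbbellProfile h r = (3 / 2 - Real.sqrt (1 - max (r - h) 0 ^ 2)) ^ 2 := by
  rw [dumbbellProfile, min_eq_left hr, max_eq_right (sub_nonpos.2 hr), add_zero,
    mul_div_cancel₀]
  linarith

theorem dumbbellProfile_of_ge {r : ℝ} (hr : h + 4 / 5 ≤ r) :
    dumbbellProfile h r = r - h - 1 / 2 := by
  rw [dumbbellProfile, min_eq_right hr, max_eq_left (by linarith), max_eq_left (by linarith),
    show (1 : ℝ) - (h + 4 / 5 - h) ^ 2 = (3 / 5) ^ 2 by ring, Real.sqrt_sq (by norm_num),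
    show h + 7 / 2 - (h + 4 / 5) = 27 / 10 by ring]
  ring

theorem HeadPoint.profile {x z c d : ℝ} (H : HeadPoint h x z c d) :
    x ^ 2 = (h + 7 / 2 - z) * dumbbellProfile h z := by
  have key : ∀ e : ℝ, e ^ 2 = c ^ 2 → 0 ≤ e → -(4 / 5) ≤ d → d ≤ 0 → z = h - d →
      (h + 7 / 2 - z) * dumbbellProfile h z = (3 / 2 - e) ^ 2 := by
    intro e he he0 h1 h2 h3
    rw [dumbbellProfile_of_le (by linarith), max_eq_left (by linarith), h3,
      show 1 - (h - d - h) ^ 2 = e ^ 2 by linarith [H.1], Real.sqrt_sq he0]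
  obtain ⟨h0, h1, ⟨h2, h3, h4, h5⟩ | ⟨h2, h3⟩ | ⟨h2, h3, h4, h5⟩⟩ := H
  · rw [key c rfl (by linarith) h1 h5 h3, h2]
  · rw [dumbbellProfile_of_ge (by linarith), h2, h3]
    linear_combination (9 / 4) * h0
  · rw [key (-c) (neg_sq c) (by linarith) h1 h5 h3, h2]
    ring

theorem DumbbellPoint.profile {x z c d : ℝ} (hh : 1 ≤ h) (H : DumbbellPoint h x z c d) :
    x ^ 2 = (h + 7 / 2 - |z|) * dumbbellProfile h |z| := by
  rcases H with ⟨-, h2, h3⟩ | h1 | h1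
  · rw [dumbbellProfile_of_le (by linarith), max_eq_right (by linarith)]
    rcases h3 with ⟨-, h3⟩ | ⟨-, h3⟩ <;> rw [h3] <;> norm_num
  · rw [abs_of_nonneg (by linarith [h1.le]), h1.profile]
  · rw [abs_of_nonpos (by linarith [h1.le]), ← h1.profile, neg_sq]

/-- Positivity of the profile bounds |z| by h + 7/2. The right half of the curve takes every such
height, the equation then determines |x|, and central symmetry supplies the left half. -/
theorem IsDumbbellLoop.mem_range_iff (H : IsDumbbellLoop θ x z h) {p : E3} :
    p ∈ range (dumbbellCurve x z) ↔
      p 1 = 0 ∧ p 0 ^ 2 = (h + 7 / 2 - |p 2|) * dumbbellProfile h |p 2| := by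
  have hP := H.isCentralLoop.pos
  constructor
  · rintro ⟨s, rfl⟩
    rw [dumbbellCurve_apply]
    exact ⟨rfl, (H.dumbbellPoint s).profile H.one_le⟩
  · rintro ⟨h1, h2⟩
    have hle : |p 2| ≤ h + 7 / 2 := by
      by_contra hc
      have := mul_neg_of_neg_of_pos (sub_neg.2 (not_le.1 hc)) (dumbbellProfile_pos h |p 2|)
      linarith [sq_nonneg (p 0)]
    have key : ∀ w : ℝ, |w| = |p 2| → ∃ s, z s = w ∧ x s = |p 0| := by
      intro w hw
      have hw' := abs_le.1 (hw.trans_le hle)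
      have hivt := intermediate_value_Icc (f := z)
        (by linarith : dumbbellTop h - dumbbellHalfLength h ≤ dumbbellTop h)
        fun s _ => (H.isCentralLoop.hasDerivAt_y s).continuousAt.continuousWithinAt
      rw [H.bottom.2, H.top.2.2] at hivt
      obtain ⟨s, hs, hsw⟩ := hivt hw'
      have hx : 0 ≤ x s := by
        rcases hs.1.eq_or_lt with h3 | h3
        · rw [← h3, H.bottom.1]
        rcases hs.2.eq_or_lt with h4 | h4
        · rw [h4, H.top.2.1]
        · exact (H.pos ⟨h3, h4⟩).2.le
      refine ⟨s, hsw, ?_⟩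
      rw [← abs_of_nonneg hx, ← sq_eq_sq_iff_abs_eq_abs, h2, ← hw, ← hsw]
      exact (H.dumbbellPoint s).profile H.one_le
    rcases le_total 0 (p 0) with h0 | h0
    · obtain ⟨s, hs, hs'⟩ := key (p 2) rfl
      refine ⟨s, ?_⟩
      rw [dumbbellCurve_apply, hs, hs', abs_of_nonneg h0]
      ext i; fin_cases i <;> simp [h1]
    · obtain ⟨s, hs, hs'⟩ := key (-p 2) (abs_neg _)
      refine ⟨s + dumbbellHalfLength h, ?_⟩
      rw [dumbbellCurve_apply, H.isCentralLoop.x_add, H.isCentralLoop.y_add, hs, hs',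
        abs_of_nonpos h0, neg_neg, neg_neg]
      ext i; fin_cases i <;> simp [h1]

/-- The stadium curve is given by `y ^ 2 = (3 / 2 - |x|) * stadiumProfile |x|`. -/
noncomputable def stadiumProfile (r : ℝ) : ℝ :=
  (3 / 2 - min r (1 / 2))⁻¹ + max (r - 1 / 2) 0

theorem stadiumProfile_pos (r : ℝ) : 0 < stadiumProfile r :=
  add_pos_of_pos_of_nonneg (inv_pos.2 (by linarith [min_le_right r (1 / 2)])) (le_max_right _ _)

theorem continuous_stadiumProfile : Continuous stadiumProfile := by
  unfold stadiumProfile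
  refine (Continuous.inv₀ (by fun_prop) fun r => ?_).add (by fun_prop)
  linarith [min_le_right r (1 / 2)]

theorem exists_stadiumPoint_iff {x y : ℝ} :
    (∃ c, StadiumPoint x y c y) ↔ y ^ 2 = (3 / 2 - |x|) * stadiumProfile |x| := by
  have e1 : |x| ≤ 1 / 2 → (3 / 2 - |x|) * stadiumProfile |x| = 1 := fun hx => by
    rw [stadiumProfile, min_eq_left hx, max_eq_right (by linarith), add_zero, mul_inv_cancel₀]
    linarith
  have e2 : 1 / 2 ≤ |x| → (3 / 2 - |x|) * stadiumProfile |x| = 1 - (|x| - 1 / 2) ^ 2 := fun hx => by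
    rw [stadiumProfile, min_eq_right hx, max_eq_left (by linarith)]
    ring
  constructor
  · rintro ⟨c, h1, -, h3, h4, h5⟩
    rcases lt_trichotomy c 0 with hc | hc | hc
    · have := h5 hc
      have hx : |x| = 1 / 2 - c := by rw [this, abs_of_neg (by linarith)]; ring
      rw [e2 (by linarith), hx]; linarith
    · rw [hc, sub_zero] at h3
      rw [e1 h3]; rw [hc] at h1; linarith
    · have := h4 hc
      have hx : |x| = 1 / 2 + c := by rw [this, abs_of_pos (by linarith)]
      rw [e2 (by linarith), hx]; linarith
  · intro h
    rcases le_or_gt |x| (1 / 2) with hx | hx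
    · rw [e1 hx] at h
      exact ⟨0, by linarith, rfl, by rwa [sub_zero], fun h => absurd h (lt_irrefl _),
        fun h => absurd h (lt_irrefl _)⟩
    · rw [e2 hx.le] at h
      rcases le_total 0 x with h0 | h0
      · rw [abs_of_nonneg h0] at h hx
        exact ⟨x - 1 / 2, by linarith, rfl, by norm_num, fun _ => by ring, fun h => by linarith⟩
      · rw [abs_of_nonpos h0] at h hx
        exact ⟨x + 1 / 2, by linarith, rfl, by norm_num, fun h => by linarith, fun _ => by ring⟩

end Profiles

/-! ### Ambient isotopies acting on one coordinate -/

section AmbientIsotopy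

/-- The set of points whose coordinates satisfy `Q`. -/
def coordSet (Q : ℝ → ℝ → ℝ → Prop) : Set E3 := {p | Q (p 0) (p 1) (p 2)}

/-- Some ambient isotopy carries the pair `(A, B)` to `(A', B')`. -/
def AmbientIsotopic (A B A' B' : Set E3) : Prop :=
  ∃ H : unitInterval → (E3 ≃ₜ E3),
    (Continuous fun p : unitInterval × E3 => H p.1 p.2) ∧ H 0 = Homeomorph.refl E3 ∧
      H 1 '' A = A' ∧ H 1 '' B = B'

/-- The two isotopies are composed at equal times instead of being run one after the other; the
start is still the identity. -/
theorem AmbientIsotopic.trans {A B A' B' A'' B'' : Set E3} (h : AmbientIsotopic A B A' B')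
    (h' : AmbientIsotopic A' B' A'' B'') : AmbientIsotopic A B A'' B'' := by
  obtain ⟨H, hc, h0, hA, hB⟩ := h
  obtain ⟨K, kc, k0, kA, kB⟩ := h'
  refine ⟨fun t => (H t).trans (K t), kc.comp (continuous_fst.prodMk hc), ?_, ?_, ?_⟩
  · change (H 0).trans (K 0) = _
    rw [h0, k0]; rfl
  · change (fun p => K 1 (H 1 p)) '' A = A''
    rw [← image_image, hA, kA]
  · change (fun p => K 1 (H 1 p)) '' B = B''
    rw [← image_image, hB, kB]

/-- Rescaling and translating the `i`-th coordinate by amounts that depend on the other coordinates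
is an ambient isotopy. -/
theorem AmbientIsotopic.of_coordinate (i : Fin 3) {f g : E3 → ℝ} (hf : Continuous f)
    (hg : Continuous g) (hfi : ∀ p (v : ℝ), f (p + v • EuclideanSpace.single i 1) = f p)
    (hgi : ∀ p (v : ℝ), g (p + v • EuclideanSpace.single i 1) = g p) {A B A' B' : Set E3}
    (hA : ∀ p, p ∈ A ↔
      p + (Real.exp (f p) * p i + g p - p i) • EuclideanSpace.single i 1 ∈ A')
    (hB : ∀ p, p ∈ B ↔
      p + (Real.exp (f p) * p i + g p - p i) • EuclideanSpace.single i 1 ∈ B') :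
    AmbientIsotopic A B A' B' := by
  have hi : ∀ (p : E3) (v : ℝ), (p + v • EuclideanSpace.single i 1 : E3) i = p i + v := by simp
  -- Writing the scale factor as an exponential keeps it positive at every intermediate time, so
  -- each stage is invertible by an explicit formula.
  obtain ⟨F, hF⟩ : ∃ F : ℝ → E3 → E3, ∀ t p, F t p =
      p + (Real.exp (t * f p) * p i + t * g p - p i) • EuclideanSpace.single i 1 :=
    ⟨_, fun _ _ => rfl⟩
  obtain ⟨G, hG⟩ : ∃ G : ℝ → E3 → E3, ∀ t p, G t p =
      p + (Real.exp (-(t * f p)) * (p i - t * g p) - p i) • EuclideanSpace.single i 1 :=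
    ⟨_, fun _ _ => rfl⟩
  have hFc : Continuous fun p : ℝ × E3 => F p.1 p.2 := by
    simp only [hF]; fun_prop
  have hGc : ∀ t, Continuous (G t) := fun t => by
    rw [show G t = _ from funext (hG t)]; fun_prop
  have hGF : ∀ t p, G t (F t p) = p := fun t p => by
    rw [hG, hF, hfi, hgi, hi, Real.exp_neg, add_assoc, ← add_smul]
    convert add_zero p
    rw [smul_eq_zero]
    left
    field_simp
    ring
  have hFG : ∀ t p, F t (G t p) = p := fun t p => by
    rw [hF, hG, hfi, hgi, hi, Real.exp_neg, add_assoc, ← add_smul]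
    convert add_zero p
    rw [smul_eq_zero]
    left
    field_simp
    ring
  have himage : ∀ {A A' : Set E3}, (∀ p, p ∈ A ↔
      p + (Real.exp (f p) * p i + g p - p i) • EuclideanSpace.single i 1 ∈ A') →
      F 1 '' A = A' := by
    intro A A' h
    have h' : ∀ p, p ∈ A ↔ F 1 p ∈ A' := fun p => by rw [h, hF, one_mul, one_mul]
    ext q
    refine ⟨?_, fun hq => ⟨G 1 q, (h' _).2 (by rwa [hFG]), hFG 1 q⟩⟩
    rintro ⟨p, hp, rfl⟩
    exact (h' p).1 hp
  refine ⟨fun t =>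
    { toFun := F t
      invFun := G t
      left_inv := hGF t
      right_inv := hFG t
      continuous_toFun := hFc.comp (continuous_const.prodMk continuous_id)
      continuous_invFun := hGc t }, ?_, ?_, himage hA, himage hB⟩
  · exact hFc.comp ((continuous_subtype_val.comp continuous_fst).prodMk continuous_snd)
  · ext1 p
    change F ((0 : unitInterval) : ℝ) p = p
    rw [hF]
    simp

variable {f g : ℝ → ℝ → ℝ} {A B A' B' : ℝ → ℝ → ℝ → Prop}

theorem AmbientIsotopic.of_zero (hf : Continuous (Function.uncurry f))
    (hg : Continuous (Function.uncurry g))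
    (hA : ∀ x y z, A x y z ↔ A' (Real.exp (f y z) * x + g y z) y z)
    (hB : ∀ x y z, B x y z ↔ B' (Real.exp (f y z) * x + g y z) y z) :
    AmbientIsotopic (coordSet A) (coordSet B) (coordSet A') (coordSet B') := by
  have hc : Continuous fun p : E3 => (p 1, p 2) := by fun_prop
  refine of_coordinate 0 (hf.comp hc) (hg.comp hc) (fun p v => by simp) (fun p v => by simp)
    (fun p => ?_) fun p => ?_
  · simpa [coordSet] using hA (p 0) (p 1) (p 2)
  · simpa [coordSet] using hB (p 0) (p 1) (p 2)

theorem AmbientIsotopic.of_one (hf : Continuous (Function.uncurry f))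
    (hg : Continuous (Function.uncurry g))
    (hA : ∀ x y z, A x y z ↔ A' x (Real.exp (f x z) * y + g x z) z)
    (hB : ∀ x y z, B x y z ↔ B' x (Real.exp (f x z) * y + g x z) z) :
    AmbientIsotopic (coordSet A) (coordSet B) (coordSet A') (coordSet B') := by
  have hc : Continuous fun p : E3 => (p 0, p 2) := by fun_prop
  refine of_coordinate 1 (hf.comp hc) (hg.comp hc) (fun p v => by simp) (fun p v => by simp)
    (fun p => ?_) fun p => ?_
  · simpa [coordSet] using hA (p 0) (p 1) (p 2)
  · simpa [coordSet] using hB (p 0) (p 1) (p 2)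

theorem AmbientIsotopic.of_two (hf : Continuous (Function.uncurry f))
    (hg : Continuous (Function.uncurry g))
    (hA : ∀ x y z, A x y z ↔ A' x y (Real.exp (f x y) * z + g x y))
    (hB : ∀ x y z, B x y z ↔ B' x y (Real.exp (f x y) * z + g x y)) :
    AmbientIsotopic (coordSet A) (coordSet B) (coordSet A') (coordSet B') := by
  have hc : Continuous fun p : E3 => (p 0, p 1) := by fun_prop
  refine of_coordinate 2 (hf.comp hc) (hg.comp hc) (fun p v => by simp) (fun p v => by simp)
    (fun p => ?_) fun p => ?_
  · simpa [coordSet] using hA (p 0) (p 1) (p 2)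
  · simpa [coordSet] using hB (p 0) (p 1) (p 2)

end AmbientIsotopy

/-! ### Untangling the dumbbell and the stadium -/

section Untangling

variable {h Z : ℝ}

theorem exp_half_log_mul_sq {a : ℝ} (ha : 0 < a) (x : ℝ) :
    (Real.exp (Real.log a / 2) * x + 0) ^ 2 = a * x ^ 2 := by
  rw [add_zero, mul_pow, ← Real.exp_nat_mul]
  push_cast
  rw [mul_div_cancel₀ _ two_ne_zero, Real.exp_log ha]

/-- The dumbbell curve can be deformed to an ellipse. -/
theorem ambientIsotopic_ellipse (hh : 1 ≤ h) : AmbientIsotopic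
    (coordSet fun x y z => y = 0 ∧ x ^ 2 = (h + 7 / 2 - |z|) * dumbbellProfile h |z|)
    (coordSet fun x y z => z = 0 ∧ ∃ c, StadiumPoint x y c y)
    (coordSet fun x y z => y = 0 ∧ 4 * x ^ 2 + (z / (h + 7 / 2)) ^ 2 = 1)
    (coordSet fun x y z => z = 0 ∧ ∃ c, StadiumPoint x y c y) := by
  have hZ : 0 < h + 7 / 2 := by linarith
  -- With Z = h + 7/2, this factor for x² turns x² = (Z - |z|) g into 4x² = 1 - z²/Z². The common
  -- factor Z - |z| has been divided out, so it stays positive and continuous at the tips.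
  have hpos : ∀ z : ℝ,
      0 < (h + 7 / 2 + |z|) / (4 * (h + 7 / 2) ^ 2 * dumbbellProfile h |z|) := fun z =>
    div_pos (by linarith [abs_nonneg z])
      (mul_pos (by positivity) (dumbbellProfile_pos h |z|))
  have hcont : Continuous fun z : ℝ =>
      Real.log ((h + 7 / 2 + |z|) / (4 * (h + 7 / 2) ^ 2 * dumbbellProfile h |z|)) / 2 := by
    have h1 : Continuous fun z : ℝ => dumbbellProfile h |z| :=
      (continuous_dumbbellProfile h).comp continuous_abs
    refine (Continuous.log (Continuous.div (by fun_prop) (by fun_prop) fun z => ?_)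
      fun z => (hpos z).ne').div_const 2
    exact (mul_pos (by positivity) (dumbbellProfile_pos h |z|)).ne'
  refine AmbientIsotopic.of_zero
    (f := fun _ z => Real.log ((h + 7 / 2 + |z|) /
      (4 * (h + 7 / 2) ^ 2 * dumbbellProfile h |z|)) / 2)
    (g := fun _ _ => 0) (hcont.comp continuous_snd) continuous_const ?_ ?_
  · intro x y z
    refine and_congr_right fun _ => ?_
    rw [exp_half_log_mul_sq (hpos z), div_pow]
    have hg := dumbbellProfile_pos h |z|
    generalize dumbbellProfile h |z| = g at hg ⊢
    have hz := abs_nonneg z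
    rw [← sq_abs z]
    generalize |z| = r at hz ⊢
    have e : 4 * ((h + 7 / 2 + r) / (4 * (h + 7 / 2) ^ 2 * g) * x ^ 2) + r ^ 2 / (h + 7 / 2) ^ 2 - 1
        = (h + 7 / 2 + r) / ((h + 7 / 2) ^ 2 * g) * (x ^ 2 - (h + 7 / 2 - r) * g) := by
      field_simp
      ring
    rw [← sub_eq_zero (b := (1 : ℝ)), e, mul_eq_zero, or_iff_right, sub_eq_zero]
    positivity
  · intro x y z
    refine and_congr_right fun hz => ?_
    -- In the plane z = 0 the factor is 1, because the strands have |x| = 1/2 there. The stadium is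
    -- therefore not moved.
    have h0 : (h + 7 / 2) * dumbbellProfile h 0 = 1 / 4 := by
      have := dumbbellProfile_of_le (h := h) (r := 0) (by linarith)
      rw [sub_zero, max_eq_right (by linarith)] at this
      rw [this]
      norm_num
    rw [hz, abs_zero, show (h + 7 / 2 + 0) / (4 * (h + 7 / 2) ^ 2 * dumbbellProfile h 0) = 1 by
      rw [div_eq_one_iff_eq (mul_pos (by positivity) (dumbbellProfile_pos h 0)).ne']
      linear_combination (-4) * (h + 7 / 2) * h0]
    simp

/-- Scaling y by a factor depending on x makes the stadium round and fixes the ellipse, which lies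
in the plane y = 0. -/
theorem ambientIsotopic_circle : AmbientIsotopic
    (coordSet fun x y z => y = 0 ∧ 4 * x ^ 2 + (z / Z) ^ 2 = 1)
    (coordSet fun x y z => z = 0 ∧ ∃ c, StadiumPoint x y c y)
    (coordSet fun x y z => y = 0 ∧ 4 * x ^ 2 + (z / Z) ^ 2 = 1)
    (coordSet fun x y z => z = 0 ∧ x ^ 2 + y ^ 2 = 9 / 4) := by
  have hpos : ∀ x : ℝ, 0 < (3 / 2 + |x|) / stadiumProfile |x| := fun x =>
    div_pos (by linarith [abs_nonneg x]) (stadiumProfile_pos |x|)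
  have hcont : Continuous fun x : ℝ => Real.log ((3 / 2 + |x|) / stadiumProfile |x|) / 2 := by
    refine (Continuous.log (Continuous.div (by fun_prop)
      (continuous_stadiumProfile.comp continuous_abs) fun x => ?_)
      fun x => (hpos x).ne').div_const 2
    exact (stadiumProfile_pos |x|).ne'
  refine AmbientIsotopic.of_one
    (f := fun x _ => Real.log ((3 / 2 + |x|) / stadiumProfile |x|) / 2)
    (g := fun _ _ => 0) (hcont.comp continuous_fst) continuous_const ?_ ?_
  · intro x y z
    simp [Real.exp_ne_zero]
  · intro x y z
    refine and_congr_right fun _ => ?_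
    rw [exp_half_log_mul_sq (hpos x), exists_stadiumPoint_iff]
    have hg := stadiumProfile_pos |x|
    generalize stadiumProfile |x| = g at hg ⊢
    have hx := abs_nonneg x
    rw [← sq_abs x]
    generalize |x| = r at hx ⊢
    have e : r ^ 2 + (3 / 2 + r) / g * y ^ 2 - 9 / 4
        = (3 / 2 + r) / g * (y ^ 2 - (3 / 2 - r) * g) := by
      field_simp
      ring
    rw [← sub_eq_zero (b := (9 / 4 : ℝ)), e, mul_eq_zero, or_iff_right, sub_eq_zero]
    positivity

/-- A circle around a narrow ellipse can be lifted off it. -/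
theorem ambientIsotopic_lift (hZ : 0 < Z) : AmbientIsotopic
    (coordSet fun x y z => y = 0 ∧ 4 * x ^ 2 + (z / Z) ^ 2 = 1)
    (coordSet fun x y z => z = 0 ∧ x ^ 2 + y ^ 2 = 9 / 4)
    (coordSet fun x y z => y = 0 ∧ 4 * x ^ 2 + z ^ 2 = 1)
    (coordSet fun x y z => z = 2 ∧ x ^ 2 + y ^ 2 = 9 / 4) := by
  -- The lift vanishes at radius at most 1/2, hence on the ellipse, and equals 2 on the circle of
  -- radius 3/2. Scaling by 1/Z brings the ellipse down to height at most 1, below the lifted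
  -- circle.
  refine AmbientIsotopic.of_two (f := fun _ _ => -Real.log Z)
    (g := fun x y => 2 * max 0 (Real.sqrt (x ^ 2 + y ^ 2) - 1 / 2)) continuous_const ?_ ?_ ?_
  · simp only [Function.uncurry_def]
    fun_prop
  · intro x y z
    refine and_congr_right fun hy => ?_
    have key : 4 * x ^ 2 ≤ 1 → max 0 (Real.sqrt (x ^ 2 + y ^ 2) - 1 / 2) = 0 := fun hx => by
      refine max_eq_left (sub_nonpos.2 (Real.sqrt_le_iff.2 ⟨by norm_num, ?_⟩))
      rw [hy]; linarith
    have e : Real.exp (-Real.log Z) * z = z / Z := by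
      rw [Real.exp_neg, Real.exp_log hZ, inv_mul_eq_div]
    rw [e]
    constructor
    · intro h1
      rw [key (by nlinarith [sq_nonneg (z / Z)]), mul_zero, add_zero, h1]
    · intro h1
      rwa [key (by nlinarith [sq_nonneg (z / Z + 2 * max 0 (Real.sqrt (x ^ 2 + y ^ 2) - 1 / 2))]),
        mul_zero, add_zero] at h1
  · intro x y z
    refine and_congr_left fun hxy => ?_
    rw [hxy, show (9 / 4 : ℝ) = (3 / 2) ^ 2 by norm_num, Real.sqrt_sq (by norm_num),
      max_eq_right (by norm_num), show (2 : ℝ) * (3 / 2 - 1 / 2) = 2 by norm_num, add_eq_right,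
      mul_eq_zero]
    simp [Real.exp_ne_zero]

theorem exp_log_two_sub {z : ℝ} :
    (z ^ 2 ≤ 1 → Real.exp (Real.log 2 - max 0 (z - 1) * Real.log 3) = 2) ∧
      (z = 2 → Real.exp (Real.log 2 - max 0 (z - 1) * Real.log 3) = 2 / 3) := by
  constructor
  · intro hz
    rw [max_eq_left (by nlinarith), zero_mul, sub_zero, Real.exp_log two_pos]
  · rintro rfl
    rw [max_eq_right (by norm_num), show (2 : ℝ) - 1 = 1 by norm_num, one_mul, Real.exp_sub,
      Real.exp_log two_pos, Real.exp_log three_pos]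

/-- Now the curves are at different heights and can be treated separately. For z ≤ 1 the
x-coordinate is doubled, which makes the ellipse round; at z = 2 it is scaled by 2/3 and shifted by
3. -/
theorem ambientIsotopic_scale_zero : AmbientIsotopic
    (coordSet fun x y z => y = 0 ∧ 4 * x ^ 2 + z ^ 2 = 1)
    (coordSet fun x y z => z = 2 ∧ x ^ 2 + y ^ 2 = 9 / 4)
    (coordSet fun x y z => y = 0 ∧ x ^ 2 + z ^ 2 = 1)
    (coordSet fun x y z => z = 2 ∧ 9 / 4 * (x - 3) ^ 2 + y ^ 2 = 9 / 4) := by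
  refine AmbientIsotopic.of_zero (f := fun _ z => Real.log 2 - max 0 (z - 1) * Real.log 3)
    (g := fun _ z => 3 * max 0 (z - 1)) ?_ ?_ ?_ ?_
  · simp only [Function.uncurry_def]
    fun_prop
  · simp only [Function.uncurry_def]
    fun_prop
  · intro x y z
    refine and_congr_right fun _ => ?_
    by_cases hz : z ^ 2 ≤ 1
    · rw [exp_log_two_sub.1 hz, max_eq_left (by nlinarith), mul_zero, add_zero, mul_pow]
      norm_num
    · refine iff_of_false (fun h => hz ?_) fun h => hz ?_
      · nlinarith [sq_nonneg x]
      · nlinarith [sq_nonneg (Real.exp (Real.log 2 - max 0 (z - 1) * Real.log 3) * x +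
          3 * max 0 (z - 1))]
  · intro x y z
    refine and_congr_right fun hz => ?_
    rw [exp_log_two_sub.2 hz, hz, max_eq_right (by norm_num)]
    ring_nf

theorem ambientIsotopic_scale_one : AmbientIsotopic
    (coordSet fun x y z => y = 0 ∧ x ^ 2 + z ^ 2 = 1)
    (coordSet fun x y z => z = 2 ∧ 9 / 4 * (x - 3) ^ 2 + y ^ 2 = 9 / 4)
    (coordSet fun x y z => y = 0 ∧ x ^ 2 + z ^ 2 = 1)
    (coordSet fun x y z => z = 2 ∧ (x - 3) ^ 2 + y ^ 2 = 1) := by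
  refine AmbientIsotopic.of_one (f := fun _ _ => Real.log (4 / 9) / 2) (g := fun _ _ => 0)
    continuous_const continuous_const ?_ ?_
  · intro x y z
    simp [Real.exp_ne_zero]
  · intro x y z
    refine and_congr_right fun _ => ?_
    rw [exp_half_log_mul_sq (by norm_num)]
    constructor <;> intro h <;> linarith

/-- A circle can be turned by a right angle about its diameter, here by two shears, while a circle
far from it stays fixed. -/
theorem ambientIsotopic_turn : AmbientIsotopic
    (coordSet fun x y z => y = 0 ∧ x ^ 2 + z ^ 2 = 1)
    (coordSet fun x y z => z = 2 ∧ (x - 3) ^ 2 + y ^ 2 = 1)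
    (coordSet fun x y z => z = 0 ∧ x ^ 2 + y ^ 2 = 1)
    (coordSet fun x y z => z = 2 ∧ (x - 3) ^ 2 + y ^ 2 = 1) := by
  -- A cutoff that switches the shears on over the first circle and off over the second.
  obtain ⟨ψ, hψ, hψ1, hψ0⟩ : ∃ ψ : ℝ → ℝ, Continuous ψ ∧ (∀ x, x ^ 2 ≤ 1 → ψ x = 1) ∧
      ∀ x, (x - 3) ^ 2 ≤ 1 → ψ x = 0 := by
    refine ⟨fun x => max 0 (min 1 (2 - x)), by fun_prop, fun x hx => ?_, fun x hx => ?_⟩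
    · have : min 1 (2 - x) = 1 := min_eq_left (by nlinarith)
      simp [this]
    · exact max_eq_left ((min_le_right _ _).trans (by nlinarith))
  refine AmbientIsotopic.trans (A' := coordSet fun x y z => z + y = 0 ∧ x ^ 2 + y ^ 2 = 1)
    (AmbientIsotopic.of_one (f := fun _ _ => 0)
    (g := fun x z => -ψ x * z)
    (B' := fun x y z => z = 2 ∧ (x - 3) ^ 2 + y ^ 2 = 1) continuous_const ?_ ?_ ?_)
    (AmbientIsotopic.of_two (f := fun _ _ => 0) (g := fun x y => ψ x * y) continuous_const ?_ ?_ ?_)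
  · simp only [Function.uncurry_def]
    fun_prop
  · intro x y z
    rw [Real.exp_zero, one_mul]
    by_cases hx : x ^ 2 ≤ 1
    · rw [hψ1 x hx]
      constructor
      · rintro ⟨rfl, h⟩
        constructor <;> linarith
      · rintro ⟨h1, h2⟩
        have : y = 0 := by linarith
        subst this
        exact ⟨rfl, by linarith⟩
    · exact iff_of_false (fun h => hx (by nlinarith [h.2, sq_nonneg z]))
        fun h => hx (by nlinarith [h.2, sq_nonneg (y + -ψ x * z)])
  · intro x y z
    rw [Real.exp_zero, one_mul]
    refine and_congr_right fun _ => ?_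
    by_cases hx : (x - 3) ^ 2 ≤ 1
    · rw [hψ0 x hx, neg_zero, zero_mul, add_zero]
    · exact iff_of_false (fun h => hx (by nlinarith [sq_nonneg y]))
        fun h => hx (by nlinarith [sq_nonneg (y + -ψ x * z)])
  · simp only [Function.uncurry_def]
    fun_prop
  · intro x y z
    rw [Real.exp_zero, one_mul]
    refine and_congr_left fun h => ?_
    rw [hψ1 x (by nlinarith [sq_nonneg y]), one_mul]
  · intro x y z
    rw [Real.exp_zero, one_mul]
    refine and_congr_left fun h => ?_
    rw [hψ0 x (by nlinarith [sq_nonneg y]), zero_mul, add_zero]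

/-- The circles now occupy disjoint ranges of x, so a drop depending on x alone moves only the
second one. -/
theorem ambientIsotopic_lower : AmbientIsotopic
    (coordSet fun x y z => z = 0 ∧ x ^ 2 + y ^ 2 = 1)
    (coordSet fun x y z => z = 2 ∧ (x - 3) ^ 2 + y ^ 2 = 1)
    (coordSet fun x y z => z = 0 ∧ x ^ 2 + y ^ 2 = 1)
    (coordSet fun x y z => z = 0 ∧ (x - 3) ^ 2 + y ^ 2 = 1) := by
  refine AmbientIsotopic.of_two (f := fun _ _ => 0)
    (g := fun x _ => -2 * max 0 (min 1 (x - 1))) continuous_const ?_ ?_ ?_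
  · simp only [Function.uncurry_def]
    fun_prop
  · intro x y z
    rw [Real.exp_zero, one_mul]
    refine and_congr_left fun h => ?_
    have : x ≤ 1 := by nlinarith [sq_nonneg y]
    rw [max_eq_left ((min_le_right _ _).trans (by linarith)), mul_zero, add_zero]
  · intro x y z
    rw [Real.exp_zero, one_mul]
    refine and_congr_left fun h => ?_
    have : 2 ≤ x := by nlinarith [sq_nonneg y]
    rw [min_eq_left (by linarith), max_eq_right zero_le_one]
    constructor <;> intro h <;> linarith

theorem roundCircle_single (a : ℝ) : roundCircle (EuclideanSpace.single 0 a) =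
    coordSet fun x y z => z = 0 ∧ (x - a) ^ 2 + y ^ 2 = 1 := by
  ext p
  have h20 : (EuclideanSpace.single 0 a : E3) 2 = 0 := by simp
  change p 2 = _ ∧ dist p _ = 1 ↔ p 2 = 0 ∧ (p 0 - a) ^ 2 + p 1 ^ 2 = 1
  rw [h20, ← pow_eq_one_iff_of_nonneg dist_nonneg two_ne_zero, dist_sq_coordinates]
  refine and_congr_right fun h => ?_
  simp [h]

theorem IsDumbbellLoop.isUnlink {θ x z : ℝ → ℝ} (H : IsDumbbellLoop θ x z h) {β : ℝ → E3}
    (hrange : range β =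
      stadium (EuclideanSpace.single 0 (1 / 2)) (EuclideanSpace.single 0 (-(1 / 2)))) :
    IsUnlink (dumbbellCurve x z) β := by
  have hγ : range (dumbbellCurve x z) = coordSet fun x y z =>
      y = 0 ∧ x ^ 2 = (h + 7 / 2 - |z|) * dumbbellProfile h |z| :=
    Set.ext fun p => H.mem_range_iff
  have hβ : range β = coordSet fun x y z => z = 0 ∧ ∃ c, StadiumPoint x y c y := by
    rw [hrange]
    exact Set.ext fun p => mem_stadium_single_iff
  have h0 : roundCircle 0 = coordSet fun x y z => z = 0 ∧ x ^ 2 + y ^ 2 = 1 := by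
    simpa only [sub_zero, show (EuclideanSpace.single 0 0 : E3) = 0 by simp] using roundCircle_single 0
  have := (((((ambientIsotopic_ellipse H.one_le).trans ambientIsotopic_circle).trans
    (ambientIsotopic_lift (by linarith [H.one_le]))).trans ambientIsotopic_scale_zero).trans
    ambientIsotopic_scale_one).trans (ambientIsotopic_turn.trans ambientIsotopic_lower)
  rw [← hγ, ← hβ, ← h0, ← roundCircle_single] at this
  exact this

end Untangling

/-! ### Conclusion -/

theorem exists_gordianUnlink {L : ℝ} (hL : 4 + 4 * neckAngle + 2 * capLength ≤ L) :
    ∃ (γ β : ℝ → E3) (t₁ t₂ : ℝ), IsStadiumPair L γ β t₁ t₂ ∧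
      IsGordianUnlink 1 L (2 * Real.pi + 2) γ β := by
  -- The strand length absorbs the prescribed length; the lower bound on `L` is the case h = 1.
  obtain ⟨h, hh, rfl⟩ : ∃ h, 1 ≤ h ∧ 2 * dumbbellHalfLength h = L :=
    ⟨(L - 4 * neckAngle - 2 * capLength) / 4, by linarith, by unfold dumbbellHalfLength; ring⟩
  obtain ⟨θ, x, z, H⟩ := exists_isDumbbellLoop hh
  obtain ⟨β, hβ, hrange⟩ := exists_isThinCore_stadium
  exact ⟨dumbbellCurve x z, β, h, h + dumbbellHalfLength h, H.isStadiumPair hrange,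
    H.isThinLink hβ hrange, H.isUnlink hrange,
    (H.isStadiumPair hrange).not_isSeparable (H.isThinLink hβ hrange)⟩

end GordianLinks

theorem mainTheorem1 :
    (∀ (L : ℝ) (γ β : ℝ → GordianLinks.E3) (t₁ t₂ : ℝ),
      GordianLinks.IsThinLink 1 L (2 * Real.pi + 2) γ β →
      GordianLinks.IsStadiumPair L γ β t₁ t₂ →
      ¬ GordianLinks.IsSeparable 1 L (2 * Real.pi + 2) γ β) ∧
    ∃ L₀ : ℝ, ∀ L : ℝ, L₀ ≤ L → ∃ (γ β : ℝ → GordianLinks.E3) (t₁ t₂ : ℝ),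
      GordianLinks.IsStadiumPair L γ β t₁ t₂ ∧
      GordianLinks.IsGordianUnlink 1 L (2 * Real.pi + 2) γ β :=
  ⟨fun _ _ _ _ _ hlink h => h.not_isSeparable hlink,
    _, fun _ hL => GordianLinks.exists_gordianUnlink hL⟩
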